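/- Let $m,n\in\mathbb R$, $\mathcal B>0$, put $q=m-n+1$ and assume $1<q<2$. For $0<\alpha<1$ let $k_\alpha$ be the unique positive periodic solution on $\mathbb R$ of $$k''+\frac{k^q-1}{q}=0,\qquad k(0)=\alpha,\quad k'(0)=0,$$ let $P(\alpha)$ be its least period, $A(\alpha)=\int_0^{P(\alpha)}k_\alpha\,dx$ and $E(\alpha)=P(\alpha)^{3-q}A(\alpha)^{q-1}$. Assume that there is $\alpha_{crit}\in(0,1)$ with $E'<0$ on $(0,\alpha_{crit})$ and $E'>0$ on $(\alpha_{crit},1)$, and that $\alpha\mapsto\alpha P(\alpha)^{2/(q-1)}$ is strictly increasing on $(0,1)$. Let $h_1,h_2\in C^4(\mathbb R)$ be non-constant positive periodic steady states of $$h_t=-(h^nh_{xxx})_x-\mathcal B(h^mh_x)_x$$ with the same least period $X$ and the same area $\int_0^Xh_1\,dx=\int_0^Xh_2\,dx$, and suppose $\min h_1<\min h_2$. Let $H$ be any function on $(0,\infty)$ with $H''(y)=\mathcal B y^{q-1}$, and for positive $\ell\in H^1(\mathbb T_X)$, where $\mathbb T_X$ is the circle of circumference $X$, let $$\mathcal E(\ell)=\int_0^X\Big[\tfrac12(\ell')^2-H(\ell)\Big]dx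 .$$ Then: 1. $h_1$ is energy stable: for every $u\in H^1(\mathbb T_X)\setminus\{0\}$ with $\int_0^Xu\,dx=0$ one has $\mathcal E(h_1+\varepsilon u)>\mathcal E(h_1)$ for all sufficiently small $\varepsilon>0$. 2. $h_2$ is energy unstable: there is a smooth $X$-periodic $u$ with $\int_0^Xu\,dx=0$ such that $\mathcal E(h_2+\varepsilon u)<\mathcal E(h_2)$ for all sufficiently small $\varepsilon>0$. 3. $\mathcal E(h_1)<\mathcal E(h_2)$. 4. $\mathcal E(h_2)>\mathcal E(\overline{h_2})$, where $\overline{h_2}=\frac1X\int_0^Xh_2\,dx$ is regarded as a constant function. -/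

import Mathlib

open Set Filter Topology MeasureTheory
open scoped ContDiff

namespace ThinFilm

noncomputable section

/-- `h` is a positive classical (`C⁴`) steady state of the evolution equation
`h_t = -(f(h) h_xxx)_x - (g(h) h_x)_x`. -/
structure IsPositiveSteadyState (f g h : ℝ → ℝ) : Prop where
  contDiff : ContDiff ℝ 4 h
  pos : ∀ x, 0 < h x
  steady : ∀ x, - deriv (fun y => f (h y) * iteratedDeriv 3 h y) x
      - deriv (fun y => g (h y) * deriv h y) x = 0

/-- `X` is the least positive period of `h`. (A continuous function with a least period is
non-constant.) -/
def IsLeastPeriod (h : ℝ → ℝ) (X : ℝ) : Prop :=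
  IsLeast {T : ℝ | 0 < T ∧ Function.Periodic h T} X

/-- `H'' = g / f` on the half-line `(0, ∞)`. -/
def IsEnergyDensity (f g H : ℝ → ℝ) : Prop :=
  ∀ y, 0 < y → DifferentiableAt ℝ H y ∧ HasDerivAt (deriv H) (g y / f y) y

/-- The energy `∫₀ˣ [ (1/2) (ℓ')² - H(ℓ) ] dx` at period `X`. For `ℓ` in `H¹` of the circle the
classical derivative exists almost everywhere and is the weak derivative. -/
def energy (H : ℝ → ℝ) (X : ℝ) (l : ℝ → ℝ) : ℝ :=
  ∫ x in (0 : ℝ)..X, ((1 / 2) * (deriv l x) ^ 2 - H (l x))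

/-- The Sobolev space `H¹` of the circle of circumference `X`, each class being given by its
continuous representative on the line: `X`-periodic, absolutely continuous functions whose
derivative is square integrable over a period. -/
structure IsH1Periodic (X : ℝ) (u : ℝ → ℝ) : Prop where
  periodic : Function.Periodic u X
  absCont : AbsolutelyContinuousOnInterval u 0 X
  deriv_memLp : MemLp (deriv u) 2 (volume.restrict (Ioc 0 X))

/-- Energy stability with respect to zero-mean `H¹` perturbations at period `X`. -/
def IsEnergyStable (H : ℝ → ℝ) (X : ℝ) (h : ℝ → ℝ) : Prop :=
  ∀ u : ℝ → ℝ, IsH1Periodic X u → u ≠ 0 → (∫ x in (0 : ℝ)..X, u x) = 0 →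
    ∀ᶠ ε in 𝓝[>] (0 : ℝ), energy H X h < energy H X (fun x => h x + ε * u x)

/-- Energy instability with respect to smooth zero-mean perturbations at period `X`. -/
def IsEnergyUnstable (H : ℝ → ℝ) (X : ℝ) (h : ℝ → ℝ) : Prop :=
  ∃ u : ℝ → ℝ, ContDiff ℝ ∞ u ∧ Function.Periodic u X ∧ (∫ x in (0 : ℝ)..X, u x) = 0 ∧
    ∀ᶠ ε in 𝓝[>] (0 : ℝ), energy H X (fun x => h x + ε * u x) < energy H X h

/-- `k` is a positive periodic solution of `k'' + (k^q - 1)/q = 0`, `k(0) = α`, `k'(0) = 0`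
(for `q ≠ 0`). -/
structure IsCanonicalProfile (q α : ℝ) (k : ℝ → ℝ) : Prop where
  contDiff : ContDiff ℝ 2 k
  pos : ∀ x, 0 < k x
  periodic : ∃ T, 0 < T ∧ Function.Periodic k T
  ode : ∀ x, deriv (deriv k) x + ((k x) ^ q - 1) / q = 0
  init : k 0 = α
  deriv_init : deriv k 0 = 0

/-- The canonical steady state `k_α`: the (unique, for `0 < α < 1`) canonical profile with
minimum value `α`. -/
def canonicalProfile (q α : ℝ) : ℝ → ℝ :=
  Classical.epsilon (IsCanonicalProfile q α)

/-- The least period `P(α)` of `k_α`. -/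
def period (q α : ℝ) : ℝ :=
  sInf {T : ℝ | 0 < T ∧ Function.Periodic (canonicalProfile q α) T}

/-- The area `A(α)` under one period of `k_α`. -/
def area (q α : ℝ) : ℝ :=
  ∫ x in (0 : ℝ)..(period q α), canonicalProfile q α x

/-- `E(α) = P(α)^(3-q) A(α)^(q-1)`. -/
def bifurcationE (q α : ℝ) : ℝ :=
  (period q α) ^ (3 - q) * (area q α) ^ (q - 1)

/-- The mean value of `h` over `[0, X]`. -/
def mean (X : ℝ) (h : ℝ → ℝ) : ℝ :=
  (1 / X) * ∫ x in (0 : ℝ)..X, h x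

end

end ThinFilm

/-! Up to translation and scaling, every positive periodic steady state of least period X is an
orbit of the canonical equation k'' + V'(k) = 0 with V = `pot`. The states of period X thus form a
one-parameter family, parametrised here by the amplitude r, where k'²/2 + V(k) = r². The signed
square root of V (`amp`) is an analytic coordinate with inverse κ = `kap`, in which the orbit
becomes a circle. The period P is then an integral of κ' over the circle, smooth up to r = 0, and P'
> 0 follows from κ''' > 0, which is Chicone's convexity condition on V (`dper_pos`). The action has
derivative 2rP and the area A is an explicit combination of action and period, so all quantities can
be differentiated in r.

One number decides everything: `dbifAmp`, a positive multiple of the r-derivative of the bifurcation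
function. Since r decreases in α, the hypothesis on that function makes `dbifAmp` negative below a
critical amplitude and positive above it. It is also a positive multiple of the r-derivative of the
mass at fixed period, so two states of equal mass lie on opposite sides of the critical amplitude
(`critical_between`). The monotonicity of α P^(2/(q-1)) assigns the smaller minimum to the larger
amplitude.

The second variation is ∫ (u'² - W u²) with W = k^(q-1), on functions of mean zero. The linearised
equation has explicit solutions: k', the amplitude derivative, and the generator of scalings (with
right-hand side 1). On each half period, subtracting the combination of the last two with the same
end values leaves a function vanishing at consecutive zeros of k', where Picone's identity gives
nonnegativity. What remains is a quadratic form in two coefficients, positive definite when `dbifAmp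
> 0` (`stable_form`). When `dbifAmp < 0`, a periodic solution of the linearised equation with
constant right-hand side has negative mean and yields a negative direction (`unstable_form`).
Translations always annihilate the second variation; along them q < 2 makes the fourth derivative of
the energy density negative, and this gives strict increase of the energy
(`integral_densRem_vel_neg`).

For the energies, states are critical at fixed mass, so along the family d(energy) = -λ d(mass) with
a multiplier λ that increases with r because P does. From the amplitude of h₂ to that of h₁ the mass
falls and then returns; the energy gained at small λ is less than that lost at large λ
(`energyN_lt`). Comparing λ with the smaller multiplier of a constant state of the same mass,
smaller because A < P, gives the last claim (`energyN_gt_const`). -/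

namespace ThinFilm

noncomputable section

/-! ### The potential of the canonical equation -/

/-- The nonlinearity of the canonical equation `k'' + force q k = 0`. -/
def force (q y : ℝ) : ℝ := (y ^ q - 1) / q

/-- The potential of the canonical equation, normalised to vanish at `1`. -/
def pot (q y : ℝ) : ℝ := (y ^ (q + 1) / (q + 1) - y) / q + 1 / (q + 1)

lemma force_one (q : ℝ) : force q 1 = 0 := by simp [force]

lemma pot_one {q : ℝ} (hq : 1 < q) : pot q 1 = 0 := by
  have : q ≠ 0 := by linarith
  have : q + 1 ≠ 0 := by linarith
  simp only [pot, Real.one_rpow]; field_simp; ring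

lemma hasDerivAt_force {q : ℝ} (hq : 1 < q) {y : ℝ} (hy : 0 < y) :
    HasDerivAt (force q) (y ^ (q - 1)) y := by
  have h := ((Real.hasDerivAt_rpow_const (x := y) (p := q) (Or.inl hy.ne')).sub_const 1).div_const q
  have : q ≠ 0 := by linarith
  refine h.congr_deriv ?_
  field_simp

lemma hasDerivAt_pot {q : ℝ} (hq : 1 < q) {y : ℝ} (hy : 0 < y) :
    HasDerivAt (pot q) (force q y) y := by
  have h := ((((Real.hasDerivAt_rpow_const (x := y) (p := q + 1) (Or.inl hy.ne')).div_const
    (q + 1)).sub (hasDerivAt_id y)).div_const q).add_const (1 / (q + 1))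
  have : q + 1 ≠ 0 := by linarith
  refine HasDerivAt.congr_deriv h ?_
  simp only [force, add_sub_cancel_right]
  field_simp

/-- Euler's identity for the homogeneous part of the potential. Integrated over a period it trades
the mean potential for action and area, as used in `are_eq`. -/
lemma mul_force {q : ℝ} (hq : 1 < q) {y : ℝ} (hy : 0 < y) :
    (q + 1) * pot q y = y * force q y - y + 1 := by
  have : q ≠ 0 := by linarith
  have : q + 1 ≠ 0 := by linarith
  simp only [pot, force, Real.rpow_add_one hy.ne']
  field_simp
  ring

lemma force_pos {q : ℝ} (hq : 1 < q) {y : ℝ} (hy : 1 < y) : 0 < force q y := by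
  have := Real.one_lt_rpow hy (show 0 < q by linarith)
  exact div_pos (by linarith) (by linarith)

lemma force_neg {q : ℝ} (hq : 1 < q) {y : ℝ} (hy : 0 < y) (hy1 : y < 1) : force q y < 0 := by
  have := Real.rpow_lt_one hy.le hy1 (show 0 < q by linarith)
  exact div_neg_of_neg_of_pos (by linarith) (by linarith)

/-- Bernoulli's inequality. As the force has mean zero along an orbit, this will put the area below
the period. -/
lemma sub_one_lt_force {q : ℝ} (hq : 1 < q) {y : ℝ} (hy : 0 < y) (hy1 : y ≠ 1) :
    y - 1 < force q y := by
  have h := one_add_mul_self_lt_rpow_one_add (s := y - 1) (by linarith) (sub_ne_zero.2 hy1) hq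
  have : 0 < q := by linarith
  rw [force, lt_div_iff₀ this]
  rw [add_sub_cancel] at h
  linarith

/-- A function vanishing at `1` whose derivative has the sign of `y - 1` is positive elsewhere. -/
lemma pos_of_deriv_sign {g g' : ℝ → ℝ} (h1 : g 1 = 0) (hg : ∀ y, 0 < y → HasDerivAt g (g' y) y)
    (hpos : ∀ y, 1 < y → 0 < g' y) (hneg : ∀ y, 0 < y → y < 1 → g' y < 0) {y : ℝ} (hy : 0 < y)
    (hy1 : y ≠ 1) : 0 < g y := by
  rcases lt_or_gt_of_ne hy1 with h | h
  · have hanti : StrictAntiOn g (Icc y 1) := by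
      apply strictAntiOn_of_deriv_neg (convex_Icc _ _)
      · exact fun z hz => (hg z (hy.trans_le hz.1)).continuousAt.continuousWithinAt
      · intro z hz
        rw [interior_Icc] at hz
        rw [(hg z (hy.trans hz.1)).deriv]
        exact hneg z (hy.trans hz.1) hz.2
    have := hanti ⟨le_rfl, h.le⟩ ⟨h.le, le_rfl⟩ h
    linarith
  · have hmono : StrictMonoOn g (Icc 1 y) := by
      apply strictMonoOn_of_deriv_pos (convex_Icc _ _)
      · exact fun z hz => (hg z (one_pos.trans_le hz.1)).continuousAt.continuousWithinAt
      · intro z hz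
        rw [interior_Icc] at hz
        rw [(hg z (one_pos.trans hz.1)).deriv]
        exact hpos z hz.1
    have := hmono ⟨le_rfl, h.le⟩ ⟨h.le, le_rfl⟩ h
    linarith

lemma pot_pos {q : ℝ} (hq : 1 < q) {y : ℝ} (hy : 0 < y) (hy1 : y ≠ 1) : 0 < pot q y :=
  pos_of_deriv_sign (pot_one hq) (fun _ h => hasDerivAt_pot hq h) (fun _ h => force_pos hq h)
    (fun _ h h' => force_neg hq h h') hy hy1

/-- Chicone's convexity condition for the potential: `V / V'²` is strictly convex. -/
lemma chicone_aux {q : ℝ} (hq : 1 < q) {y : ℝ} (hy : 0 < y) (hy1 : y ≠ 1) :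
    3 * (q + 1) * y * (y ^ q - 1) ^ 2 <
      2 * (q * (q + 1) * pot q y) * ((2 * q + 1) * y ^ q + (q - 1)) := by
  have hL : ∀ z : ℝ, 0 < z → 0 < (2 * q + 1) * z ^ q + (q - 1) := fun z hz => by
    have := Real.rpow_pos_of_pos hz q
    have : 0 < (2 * q + 1) * z ^ q := mul_pos (by linarith) this
    linarith
  -- Dividing first by the positive factor `(2 * q + 1) * z ^ q + (q - 1)` makes one differentiation
  -- enough: the derivative collapses to a positive multiple of `(z ^ q - 1) ^ 3`, which has the
  -- sign of `z - 1`.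
  have key := pos_of_deriv_sign
    (g := fun z => q * (q + 1) * pot q z -
      3 / 2 * (q + 1) * (z * (z ^ q - 1) ^ 2 / ((2 * q + 1) * z ^ q + (q - 1))))
    (g' := fun z => (q + 1) * (q - 1) * (2 * q + 1) * (z ^ q - 1) ^ 3 /
      (2 * ((2 * q + 1) * z ^ q + (q - 1)) ^ 2))
    (by simp [pot_one hq]) ?_ ?_ ?_ hy hy1
  · have hLy := hL y hy
    have h2 : 3 / 2 * (q + 1) * (y * (y ^ q - 1) ^ 2 / ((2 * q + 1) * y ^ q + (q - 1))) <
      q * (q + 1) * pot q y := by linarith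
    rw [← mul_div_assoc, div_lt_iff₀ hLy] at h2
    linarith
  · intro z hz
    have hLz := (hL z hz).ne'
    have hp : HasDerivAt (fun z : ℝ => z ^ q) (q * z ^ (q - 1)) z :=
      Real.hasDerivAt_rpow_const (Or.inl hz.ne')
    have h := ((hasDerivAt_pot hq hz).const_mul (q * (q + 1))).sub
      ((((hasDerivAt_id z).mul ((hp.sub_const 1).pow 2)).div
        ((hp.const_mul (2 * q + 1)).add_const (q - 1)) hLz).const_mul (3 / 2 * (q + 1)))
    refine HasDerivAt.congr_deriv h ?_
    have hw : z ^ (q - 1) = z ^ q / z := Real.rpow_sub_one hz.ne' q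
    have hz0 := hz.ne'
    have hq0 : q ≠ 0 := by linarith
    simp only [hw, force, id, Pi.pow_apply, Pi.mul_apply]
    generalize z ^ q = w at *
    clear h hL
    generalize hL : (2 * q + 1) * w + (q - 1) = L at *
    field_simp
    subst hL
    push_cast
    ring
  · intro z hz
    have hw : 1 < z ^ q := Real.one_lt_rpow hz (by linarith)
    have hLz := hL z (by linarith)
    have h1 : 0 < z ^ q - 1 := by linarith
    have h2 : 0 < q - 1 := by linarith
    positivity
  · intro z hz hz1
    have hw : z ^ q < 1 := Real.rpow_lt_one hz.le hz1 (by linarith)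
    have hLz := hL z hz
    have h1 : (z ^ q - 1) ^ 3 < 0 := Odd.pow_neg (by decide) (by linarith)
    have h2 : 0 < q - 1 := by linarith
    exact div_neg_of_neg_of_pos (mul_neg_of_pos_of_neg (by positivity) h1) (by positivity)

/-- With V = `pot` this is (V / V'²)'' > 0 cleared of denominators, the powers of y being V'' and
V'''. It is `chicone_aux` times a positive factor. -/
lemma chicone {q : ℝ} (hq : 1 < q) {y : ℝ} (hy : 0 < y) (hy1 : y ≠ 1) :
    3 * y ^ (q - 1) * force q y ^ 2 <
      2 * pot q y * (3 * (y ^ (q - 1)) ^ 2 - force q y * ((q - 1) * y ^ (q - 2))) := by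
  have h := chicone_aux hq hy hy1
  have hw : y ^ (q - 1) = y ^ q / y := Real.rpow_sub_one hy.ne' q
  have hw2 : y ^ (q - 2) = y ^ q / y ^ 2 := by
    rw [Real.rpow_sub hy, Real.rpow_two]
  have hpos := Real.rpow_pos_of_pos hy q
  simp only [force, hw, hw2]
  generalize y ^ q = w at *
  generalize pot q y = V at *
  have hq0 : 0 < q := by linarith
  rw [← sub_pos] at h ⊢
  have : 2 * V * (3 * (w / y) ^ 2 - (w - 1) / q * ((q - 1) * (w / y ^ 2))) -
      3 * (w / y) * ((w - 1) / q) ^ 2 = w / (q ^ 2 * y ^ 2 * (q + 1)) *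
      (2 * (q * (q + 1) * V) * ((2 * q + 1) * w + (q - 1)) - 3 * (q + 1) * y * (w - 1) ^ 2) := by
    field_simp
    ring
  rw [this]
  positivity

/-! ### The signed square root of the potential -/

/-- The signed square root of the potential, `sgn (y - 1) * √(pot q y)`. -/
def amp (q y : ℝ) : ℝ := (y - 1) * √(dslope (dslope (pot q) 1) 1 y)

lemma pot_analytic {q : ℝ} {y : ℝ} (hy : 0 < y) : AnalyticAt ℝ (pot q) y := by
  apply ContDiffAt.analyticAt
  have h1 : ContDiffAt ℝ ω (fun y : ℝ => y ^ (q + 1)) y :=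
    Real.contDiffAt_rpow_const_of_ne hy.ne'
  exact (((h1.div_const _).sub contDiffAt_id).div_const _).add contDiffAt_const

/-- A removable singularity: at the base point the power series can be divided, elsewhere the
quotient is analytic. Two applications extract the double zero of the potential at 1. -/
lemma dslope_analytic {g : ℝ → ℝ} (hg : ∀ y, 0 < y → AnalyticAt ℝ g y) {y : ℝ} (hy : 0 < y) :
    AnalyticAt ℝ (dslope g 1) y := by
  by_cases h : y = 1
  · subst h
    obtain ⟨p, hp⟩ := hg 1 hy
    exact ⟨_, hp.has_fpower_series_dslope_fslope⟩
  · have h1 : AnalyticAt ℝ (fun z => (z - 1)⁻¹ * (g z - g 1)) y := by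
      refine AnalyticAt.mul (AnalyticAt.inv (by fun_prop) (sub_ne_zero.2 h)) ?_
      exact (hg y hy).sub analyticAt_const
    refine h1.congr ?_
    filter_upwards [isOpen_ne.mem_nhds h] with z hz
    rw [dslope_of_ne _ hz, slope_def_field]
    ring

lemma sq_mul_dslope {q : ℝ} (hq : 1 < q) (y : ℝ) :
    (y - 1) ^ 2 * dslope (dslope (pot q) 1) 1 y = pot q y := by
  have h1 := sub_smul_dslope (pot q) 1 y
  have h2 := sub_smul_dslope (dslope (pot q) 1) 1 y
  rw [dslope_same, (hasDerivAt_pot hq one_pos).deriv, force_one] at h2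
  rw [pot_one hq] at h1
  simp only [smul_eq_mul, sub_zero] at h1 h2
  rw [← h1, ← h2]; ring

lemma dslope_one {q : ℝ} (hq : 1 < q) : dslope (dslope (pot q) 1) 1 1 = 1 / 2 := by
  set R := dslope (dslope (pot q) 1) 1 with hR
  have hRa : ∀ y, 0 < y → AnalyticAt ℝ R y := fun y hy =>
    dslope_analytic (fun z hz => dslope_analytic (fun _ h => pot_analytic h) hz) hy
  have h1 : ∀ y, 0 < y → force q y = 2 * (y - 1) * R y + (y - 1) ^ 2 * deriv R y := by
    intro y hy
    have hd : HasDerivAt (fun y => (y - 1) ^ 2 * R y)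
        (2 * (y - 1) * R y + (y - 1) ^ 2 * deriv R y) y := by
      have := (((hasDerivAt_id y).sub_const 1).pow 2).mul (hRa y hy).differentiableAt.hasDerivAt
      refine this.congr_deriv ?_
      simp
    rw [funext (sq_mul_dslope hq)] at hd
    exact (hasDerivAt_pot hq hy).unique hd
  have h2 : HasDerivAt (fun y => 2 * (y - 1) * R y + (y - 1) ^ 2 * deriv R y) (2 * R 1) 1 := by
    have hRd := (hRa 1 one_pos).differentiableAt.hasDerivAt
    have hRd' := (hRa 1 one_pos).deriv.differentiableAt.hasDerivAt
    have hi := (hasDerivAt_id (1 : ℝ)).sub_const 1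
    refine (((hi.const_mul 2).mul hRd).add ((hi.pow 2).mul hRd')).congr_deriv ?_
    simp
  have h3 : HasDerivAt (force q) (2 * R 1) 1 := by
    refine h2.congr_of_eventuallyEq ?_
    filter_upwards [lt_mem_nhds one_pos] with y hy using h1 y hy
  have h4 := h3.unique (hasDerivAt_force hq one_pos)
  rw [Real.one_rpow] at h4
  linarith

lemma dslope_pos {q : ℝ} (hq : 1 < q) {y : ℝ} (hy : 0 < y) :
    0 < dslope (dslope (pot q) 1) 1 y := by
  by_cases h : y = 1
  · rw [h, dslope_one hq]; norm_num
  · have h1 := sq_mul_dslope hq y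
    have h2 := pot_pos hq hy h
    rw [← h1] at h2
    exact pos_of_mul_pos_right h2 (sq_nonneg _)

lemma amp_sq {q : ℝ} (hq : 1 < q) {y : ℝ} (hy : 0 < y) : amp q y ^ 2 = pot q y := by
  rw [amp, mul_pow, Real.sq_sqrt (dslope_pos hq hy).le, sq_mul_dslope hq]

lemma amp_pos {q : ℝ} (hq : 1 < q) {y : ℝ} (hy : 1 < y) : 0 < amp q y :=
  mul_pos (by linarith) (Real.sqrt_pos.2 (dslope_pos hq (by linarith)))

lemma amp_neg {q : ℝ} (hq : 1 < q) {y : ℝ} (hy : 0 < y) (hy1 : y < 1) : amp q y < 0 :=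
  mul_neg_of_neg_of_pos (by linarith) (Real.sqrt_pos.2 (dslope_pos hq hy))

lemma amp_one (q : ℝ) : amp q 1 = 0 := by simp [amp]

lemma contDiffAt_amp {q : ℝ} (hq : 1 < q) {y : ℝ} (hy : 0 < y) : ContDiffAt ℝ ω (amp q) y := by
  have hR : ContDiffAt ℝ ω (dslope (dslope (pot q) 1) 1) y :=
    (dslope_analytic (fun z hz => dslope_analytic (fun _ h => pot_analytic h) hz) hy).contDiffAt
  exact (contDiffAt_id.sub contDiffAt_const).mul (hR.sqrt (dslope_pos hq hy).ne')

/-- Away from 1, the identity 2 · amp · amp' = V' decides, as amp and V' have the same sign. At 1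
that identity is 0 = 0, and the derivative is read off the square root factor instead. -/
lemma deriv_amp_pos {q : ℝ} (hq : 1 < q) {y : ℝ} (hy : 0 < y) : 0 < deriv (amp q) y := by
  have hd := ((contDiffAt_amp hq hy).differentiableAt (by simp)).hasDerivAt
  by_cases h : y = 1
  · subst h
    have hR : AnalyticAt ℝ (dslope (dslope (pot q) 1) 1) 1 :=
      dslope_analytic (fun z hz => dslope_analytic (fun _ h => pot_analytic h) hz) hy
    have h1 := ((hasDerivAt_id (1 : ℝ)).sub_const 1).mul
      (hR.differentiableAt.hasDerivAt.sqrt (dslope_pos hq hy).ne')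
    have h2 := hd.unique h1
    rw [h2]
    simpa using dslope_pos hq hy
  · have h1 : HasDerivAt (pot q) (2 * amp q y * deriv (amp q) y) y := by
      refine ((hd.pow 2).congr_of_eventuallyEq ?_).congr_deriv (by simp)
      filter_upwards [lt_mem_nhds hy] with z hz
      simp [amp_sq hq hz]
    have h2 := h1.unique (hasDerivAt_pot hq hy)
    rcases lt_or_gt_of_ne h with h | h
    · have a := amp_neg hq hy h
      have b := force_neg hq hy h
      rw [← h2] at b
      by_contra hc
      have := mul_nonneg_of_nonpos_of_nonpos (show 2 * amp q y ≤ 0 by linarith) (not_lt.1 hc)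
      linarith
    · have a := amp_pos hq h
      have b := force_pos hq h
      rw [← h2] at b
      exact pos_of_mul_pos_right b (by linarith)

lemma amp_strictMonoOn {q : ℝ} (hq : 1 < q) : StrictMonoOn (amp q) (Ioi 0) := by
  apply strictMonoOn_of_deriv_pos (convex_Ioi 0)
  · exact fun y hy => (contDiffAt_amp hq hy).continuousAt.continuousWithinAt
  · intro y hy
    rw [interior_Ioi] at hy
    exact deriv_amp_pos hq hy

/-! ### The inverse of the signed amplitude -/

/-- The interval of amplitudes on which all orbits are positive and periodic. -/
def ampRange (q : ℝ) : Set ℝ := Ioo (-√(1 / (q + 1))) √(1 / (q + 1))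

lemma mem_ampRange {q σ : ℝ} : σ ∈ ampRange q ↔ |σ| < √(1 / (q + 1)) := by
  rw [ampRange, mem_Ioo, abs_lt]

lemma isOpen_ampRange (q : ℝ) : IsOpen (ampRange q) := isOpen_Ioo

lemma ampRange_mono {q σ τ : ℝ} (hτ : τ ∈ ampRange q) (h : |σ| ≤ |τ|) : σ ∈ ampRange q :=
  mem_ampRange.2 (h.trans_lt (mem_ampRange.1 hτ))

lemma neg_mem_ampRange {q r : ℝ} (hr : r ∈ ampRange q) : -r ∈ ampRange q :=
  ampRange_mono hr (abs_neg r).le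

lemma zero_mem_ampRange {q : ℝ} (hq : 1 < q) : (0 : ℝ) ∈ ampRange q :=
  mem_ampRange.2 (by rw [abs_zero]; exact Real.sqrt_pos.2 (by positivity))

lemma sq_lt_of_mem_ampRange {q : ℝ} (hq : 1 < q) {σ : ℝ} (hσ : σ ∈ ampRange q) :
    (q + 1) * σ ^ 2 < 1 := by
  have h := mem_ampRange.1 hσ
  rw [Real.lt_sqrt (abs_nonneg _), sq_abs, lt_div_iff₀ (by linarith)] at h
  linarith

lemma mem_ampRange_of_sq_lt {q : ℝ} (hq : 1 < q) {σ : ℝ} (h : (q + 1) * σ ^ 2 < 1) :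
    σ ∈ ampRange q := by
  rw [mem_ampRange, Real.lt_sqrt (abs_nonneg _), sq_abs, lt_div_iff₀ (by linarith)]
  linarith

lemma exists_amp_eq {q : ℝ} (hq : 1 < q) {σ : ℝ} (hσ : σ ∈ ampRange q) :
    ∃ y, 0 < y ∧ amp q y = σ := by
  have hσ2 := sq_lt_of_mem_ampRange hq hσ
  have hq0 : 0 < q := by linarith
  -- Below 1: V tends to `1 / (q + 1)` at 0, the barrier that defines `ampRange`, so V exceeds σ² at
  -- some small y.
  obtain ⟨y₁, hy₁, hy₁1, h1⟩ : ∃ y, 0 < y ∧ y < 1 ∧ σ ^ 2 < pot q y := by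
    have hc : ContinuousAt (fun y : ℝ => (y ^ (q + 1) / (q + 1) - y) / q + 1 / (q + 1)) 0 := by
      have := (Real.continuous_rpow_const (q := q + 1) (by linarith)).continuousAt (x := 0)
      fun_prop
    have h0 : σ ^ 2 < (fun y : ℝ => (y ^ (q + 1) / (q + 1) - y) / q + 1 / (q + 1)) 0 := by
      simp only [Real.zero_rpow (show q + 1 ≠ 0 by linarith), zero_div, sub_zero, zero_add]
      rw [lt_div_iff₀ (by linarith)]; linarith
    have hev := (hc.eventually (lt_mem_nhds h0)).filter_mono (nhdsWithin_le_nhds (s := Ioi 0))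
    obtain ⟨y, hy, hy0, hy1⟩ := (hev.and (Ioo_mem_nhdsGT one_pos)).exists
    exact ⟨y, hy0, hy1, hy⟩
  have h1' : amp q y₁ < σ := by
    rw [← amp_sq hq hy₁] at h1
    have hn := amp_neg hq hy₁ hy₁1
    nlinarith [abs_lt_of_sq_lt_sq' (a := σ) (b := -amp q y₁) (by rwa [neg_sq]) (by linarith)]
  -- Above 1: V - 1/(q+1) = y (y^q/(q+1) - 1)/q vanishes at this point, so V takes here its limiting
  -- value at 0.
  set y₂ : ℝ := (q + 1) ^ (1 / q) with hy₂
  have hy₂1 : 1 < y₂ := Real.one_lt_rpow (by linarith) (by positivity)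
  have h2 : pot q y₂ = 1 / (q + 1) := by
    have : y₂ ^ q = q + 1 := by
      rw [hy₂, ← Real.rpow_mul (by linarith), one_div_mul_cancel hq0.ne', Real.rpow_one]
    rw [pot, Real.rpow_add_one (by linarith), this]
    field_simp
    ring
  have h2' : σ < amp q y₂ := by
    rw [← amp_sq hq (by linarith)] at h2
    have hp := amp_pos hq hy₂1
    refine lt_of_pow_lt_pow_left₀ 2 hp.le ?_
    rw [h2, lt_div_iff₀ (by linarith)]
    linarith
  have hc : ContinuousOn (amp q) (Icc y₁ y₂) := fun y hy =>
    (contDiffAt_amp hq (hy₁.trans_le hy.1)).continuousAt.continuousWithinAt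
  obtain ⟨y, hy, h⟩ := intermediate_value_Icc (by linarith) hc ⟨h1'.le, h2'.le⟩
  exact ⟨y, hy₁.trans_le hy.1, h⟩

/-- The inverse function of `amp q`. -/
def kap (q : ℝ) : ℝ → ℝ := Function.invFunOn (amp q) (Ioi 0)

lemma kap_pos {q : ℝ} (hq : 1 < q) {σ : ℝ} (hσ : σ ∈ ampRange q) : 0 < kap q σ :=
  Function.invFunOn_mem (exists_amp_eq hq hσ)

lemma amp_kap {q : ℝ} (hq : 1 < q) {σ : ℝ} (hσ : σ ∈ ampRange q) : amp q (kap q σ) = σ :=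
  Function.invFunOn_eq (exists_amp_eq hq hσ)

lemma eq_kap {q : ℝ} (hq : 1 < q) {σ y : ℝ} (hσ : σ ∈ ampRange q) (hy : 0 < y)
    (h : amp q y = σ) : y = kap q σ :=
  (amp_strictMonoOn hq).injOn hy (kap_pos hq hσ) (h.trans (amp_kap hq hσ).symm)

lemma pot_kap {q : ℝ} (hq : 1 < q) {σ : ℝ} (hσ : σ ∈ ampRange q) : pot q (kap q σ) = σ ^ 2 := by
  rw [← amp_sq hq (kap_pos hq hσ), amp_kap hq hσ]

lemma kap_zero {q : ℝ} (hq : 1 < q) : kap q 0 = 1 :=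
  (eq_kap hq (zero_mem_ampRange hq) one_pos (amp_one q)).symm

lemma kap_lt_kap {q : ℝ} (hq : 1 < q) {σ τ : ℝ} (hσ : σ ∈ ampRange q) (hτ : τ ∈ ampRange q)
    (h : σ < τ) : kap q σ < kap q τ := by
  rw [← (amp_strictMonoOn hq).lt_iff_lt (kap_pos hq hσ) (kap_pos hq hτ), amp_kap hq hσ,
    amp_kap hq hτ]
  exact h

lemma kap_ne_one {q : ℝ} (hq : 1 < q) {σ : ℝ} (hσ : σ ∈ ampRange q) (h : σ ≠ 0) :
    kap q σ ≠ 1 := by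
  intro h1
  have := amp_kap hq hσ
  rw [h1, amp_one] at this
  exact h this.symm

lemma amp_mem_ampRange {q : ℝ} (hq : 1 < q) {α : ℝ} (hα : 0 < α) (hα1 : α < 1) :
    amp q α ∈ ampRange q := by
  apply mem_ampRange_of_sq_lt hq
  rw [amp_sq hq hα, mul_force hq hα]
  have := mul_neg_of_pos_of_neg hα (force_neg hq hα hα1)
  linarith

/-- The analytic inverse function theorem; the local inverse agrees with `kap` because its values
near σ are positive, where `amp` is injective. -/
lemma contDiffAt_kap {q : ℝ} (hq : 1 < q) {σ : ℝ} (hσ : σ ∈ ampRange q) :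
    ContDiffAt ℝ ω (kap q) σ := by
  set y := kap q σ with hy
  have hy0 := kap_pos hq hσ
  have hs := contDiffAt_amp hq hy0
  have hd := (hs.differentiableAt (by simp)).hasDerivAt
  have hd0 := (deriv_amp_pos hq hy0).ne'
  have hf := hd.hasFDerivAt_equiv hd0
  have hg := hs.to_localInverse hf (by simp)
  rw [amp_kap hq hσ] at hg
  refine hg.congr_of_eventuallyEq ?_
  have hst := hs.hasStrictFDerivAt' hf (by simp)
  have hr := hst.eventually_right_inverse
  rw [amp_kap hq hσ] at hr
  have hgσ : hs.localInverse hf (by simp) σ = y := by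
    have := hs.localInverse_apply_image hf (by simp)
    rwa [amp_kap hq hσ] at this
  have hpos : ∀ᶠ τ in 𝓝 σ, 0 < hs.localInverse hf (by simp) τ := by
    have := hg.continuousAt.eventually_mem (s := Ioi 0) (by
      rw [hgσ]; exact lt_mem_nhds hy0)
    exact this
  filter_upwards [hr, hpos, (isOpen_ampRange q).mem_nhds hσ] with τ h1 h2 h3
  exact (eq_kap hq h3 h2 h1).symm

lemma analyticAt_kap {q : ℝ} (hq : 1 < q) {σ : ℝ} (hσ : σ ∈ ampRange q) :
    AnalyticAt ℝ (kap q) σ := (contDiffAt_kap hq hσ).analyticAt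

lemma hasDerivAt_kap {q : ℝ} (hq : 1 < q) {σ : ℝ} (hσ : σ ∈ ampRange q) :
    HasDerivAt (kap q) (deriv (kap q) σ) σ := (analyticAt_kap hq hσ).differentiableAt.hasDerivAt

lemma hasDerivAt_kap' {q : ℝ} (hq : 1 < q) {σ : ℝ} (hσ : σ ∈ ampRange q) :
    HasDerivAt (deriv (kap q)) (deriv (deriv (kap q)) σ) σ :=
  (analyticAt_kap hq hσ).deriv.differentiableAt.hasDerivAt

lemma hasDerivAt_kap'' {q : ℝ} (hq : 1 < q) {σ : ℝ} (hσ : σ ∈ ampRange q) :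
    HasDerivAt (deriv (deriv (kap q))) (deriv (deriv (deriv (kap q))) σ) σ :=
  (analyticAt_kap hq hσ).deriv.deriv.differentiableAt.hasDerivAt

lemma deriv_kap_pos {q : ℝ} (hq : 1 < q) {σ : ℝ} (hσ : σ ∈ ampRange q) :
    0 < deriv (kap q) σ := by
  have hd := ((contDiffAt_amp hq (kap_pos hq hσ)).differentiableAt (by simp)).hasDerivAt
  have h1 := hd.comp σ (hasDerivAt_kap hq hσ)
  have h2 : HasDerivAt (amp q ∘ kap q) 1 σ := by
    refine (hasDerivAt_id σ).congr_of_eventuallyEq ?_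
    filter_upwards [(isOpen_ampRange q).mem_nhds hσ] with τ hτ using amp_kap hq hτ
  have h3 := h1.unique h2
  refine pos_of_mul_pos_right ?_ (deriv_amp_pos hq (kap_pos hq hσ)).le
  rw [h3]; exact one_pos

/-- The derivative of V(κ(σ)) = σ². The next two derivatives of the same identity give
`kap_second_order` and `deriv3_kap_pos`. -/
lemma force_mul_deriv_kap {q : ℝ} (hq : 1 < q) {σ : ℝ} (hσ : σ ∈ ampRange q) :
    force q (kap q σ) * deriv (kap q) σ = 2 * σ := by
  have h1 := (hasDerivAt_pot hq (kap_pos hq hσ)).comp σ (hasDerivAt_kap hq hσ)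
  have h2 : HasDerivAt (pot q ∘ kap q) (2 * σ) σ := by
    refine ((hasDerivAt_pow 2 σ).congr_of_eventuallyEq ?_).congr_deriv (by simp)
    filter_upwards [(isOpen_ampRange q).mem_nhds hσ] with τ hτ using pot_kap hq hτ
  exact h1.unique h2

lemma hasDerivAt_force_kap {q : ℝ} (hq : 1 < q) {σ : ℝ} (hσ : σ ∈ ampRange q) :
    HasDerivAt (fun σ => force q (kap q σ)) (kap q σ ^ (q - 1) * deriv (kap q) σ) σ :=
  (hasDerivAt_force hq (kap_pos hq hσ)).comp σ (hasDerivAt_kap hq hσ)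

lemma kap_second_order {q : ℝ} (hq : 1 < q) {σ : ℝ} (hσ : σ ∈ ampRange q) :
    kap q σ ^ (q - 1) * deriv (kap q) σ ^ 2 + force q (kap q σ) * deriv (deriv (kap q)) σ = 2 := by
  have h1 := (hasDerivAt_force_kap hq hσ).mul (hasDerivAt_kap' hq hσ)
  have h2 : HasDerivAt ((fun σ => force q (kap q σ)) * deriv (kap q)) 2 σ := by
    refine (((hasDerivAt_id σ).const_mul 2).congr_of_eventuallyEq ?_).congr_deriv (by simp)
    filter_upwards [(isOpen_ampRange q).mem_nhds hσ] with τ hτ using force_mul_deriv_kap hq hτ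
  have := h1.unique h2
  linarith

/-- Differentiating V(κ(σ)) = σ² three times and eliminating κ'' exhibits κ''' as a positive
multiple of the Chicone expression. The elimination divides by V', which vanishes at σ = 0; hence
the exclusion. -/
lemma deriv3_kap_pos {q : ℝ} (hq : 1 < q) {σ : ℝ} (hσ : σ ∈ ampRange q) (h0 : σ ≠ 0) :
    0 < deriv (deriv (deriv (kap q))) σ := by
  have hk := kap_pos hq hσ
  have hp : HasDerivAt (fun σ => kap q σ ^ (q - 1))
      ((q - 1) * kap q σ ^ (q - 2) * deriv (kap q) σ) σ := by
    have := (hasDerivAt_kap hq hσ).rpow_const (p := q - 1) (Or.inl hk.ne')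
    refine this.congr_deriv ?_
    rw [show q - 1 - 1 = q - 2 by ring]; ring
  have h1 := (hp.mul ((hasDerivAt_kap' hq hσ).pow 2)).add
    ((hasDerivAt_force_kap hq hσ).mul (hasDerivAt_kap'' hq hσ))
  have h2 : HasDerivAt (((fun σ => kap q σ ^ (q - 1)) * deriv (kap q) ^ 2) +
      (fun σ => force q (kap q σ)) * deriv (deriv (kap q))) 0 σ := by
    refine (hasDerivAt_const σ (2 : ℝ)).congr_of_eventuallyEq ?_
    filter_upwards [(isOpen_ampRange q).mem_nhds hσ] with τ hτ using kap_second_order hq hτ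
  have h3 := h1.unique h2
  have e1 := force_mul_deriv_kap hq hσ
  have e2 := kap_second_order hq hσ
  have hc := chicone hq hk (kap_ne_one hq hσ h0)
  rw [pot_kap hq hσ] at hc
  have hk1 := deriv_kap_pos hq hσ
  have hF : force q (kap q σ) ≠ 0 := by
    intro h; rw [h, zero_mul] at e1; exact h0 (by linarith)
  have hF2 : 0 < force q (kap q σ) ^ 2 := by positivity
  simp only [Pi.pow_apply, Nat.cast_ofNat, Nat.add_one_sub_one, pow_one] at h3
  generalize deriv (deriv (deriv (kap q))) σ = k3 at *
  generalize deriv (deriv (kap q)) σ = k2 at *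
  generalize deriv (kap q) σ = k1 at *
  generalize force q (kap q σ) = F at *
  generalize kap q σ ^ (q - 1) = F1 at *
  generalize (q - 1) * kap q σ ^ (q - 2) = F2 at *
  have h4 : 2 * F ^ 2 * k3 = k1 * (4 * σ ^ 2 * (3 * F1 ^ 2 - F * F2) - 6 * F1 * F ^ 2) * (2 / F ^ 2)
      := by
    have e3 : F * k2 = 2 - F1 * k1 ^ 2 := by linarith
    have e4 : 4 * σ ^ 2 = F ^ 2 * k1 ^ 2 := by rw [← mul_pow, e1]; ring
    have e5 : F * k3 = -(F2 * k1 * k1 ^ 2 + 3 * F1 * k1 * k2) := by linarith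
    have e6 : F ^ 2 * k3 = -(F * F2 * k1 ^ 3 + 3 * F1 * k1 * (2 - F1 * k1 ^ 2)) := by
      rw [← e3]; linear_combination F * e5
    rw [e4]
    field_simp
    linear_combination e6
  have h5 : 0 < 2 * F ^ 2 * k3 := by
    rw [h4]
    have : 0 < 4 * σ ^ 2 * (3 * F1 ^ 2 - F * F2) - 6 * F1 * F ^ 2 := by linarith
    positivity
  exact pos_of_mul_pos_right h5 (by positivity)

/-- Since κ''' > 0 is only known off 0, monotonicity of κ'' is proved on each side and joined at 0.
-/
lemma deriv2_kap_lt {q : ℝ} (hq : 1 < q) {σ : ℝ} (hσ : σ ∈ ampRange q) (h0 : 0 < σ) :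
    deriv (deriv (kap q)) (-σ) < deriv (deriv (kap q)) σ := by
  have hsub : ∀ τ, -σ ≤ τ → τ ≤ σ → τ ∈ ampRange q := fun τ h1 h2 =>
    ampRange_mono hσ ((abs_le.2 ⟨h1, h2⟩).trans (le_abs_self σ))
  have ha : StrictMonoOn (deriv (deriv (kap q))) (Icc (-σ) 0) := by
    apply strictMonoOn_of_deriv_pos (convex_Icc _ _)
    · exact fun τ hτ => (hasDerivAt_kap'' hq (hsub τ hτ.1
        (by linarith [hτ.2]))).continuousAt.continuousWithinAt
    · intro τ hτ
      rw [interior_Icc] at hτ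
      exact deriv3_kap_pos hq (hsub τ hτ.1.le (by linarith [hτ.2])) hτ.2.ne
  have hb : StrictMonoOn (deriv (deriv (kap q))) (Icc 0 σ) := by
    apply strictMonoOn_of_deriv_pos (convex_Icc _ _)
    · exact fun τ hτ => (hasDerivAt_kap'' hq (hsub τ (by linarith [hτ.1])
        hτ.2)).continuousAt.continuousWithinAt
    · intro τ hτ
      rw [interior_Icc] at hτ
      exact deriv3_kap_pos hq (hsub τ (by linarith [hτ.1]) hτ.2.le) hτ.1.ne'
  have h1 := ha ⟨le_rfl, by linarith⟩ ⟨by linarith, le_rfl⟩ (by linarith : -σ < 0)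
  have h2 := hb ⟨le_rfl, h0.le⟩ ⟨h0.le, le_rfl⟩ h0
  exact h1.trans h2

/-! ### The periodic orbit of amplitude `r` -/

/-- Time spent per unit phase. -/
def speed (q r t : ℝ) : ℝ := deriv (kap q) (-(r * Real.cos t)) / √2

/-- The period of the orbit of amplitude `r`. -/
def per (q r : ℝ) : ℝ := ∫ t in (0 : ℝ)..(2 * Real.pi), speed q r t

/-- The time at which the orbit reaches a given phase. -/
def timeOf (q r t : ℝ) : ℝ := ∫ u in (0 : ℝ)..t, speed q r u

/-- The phase of the orbit at a given time. -/
def phase (q r : ℝ) : ℝ → ℝ := Function.invFun (timeOf q r)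

/-- The signed amplitude along the orbit. -/
def sig (q r x : ℝ) : ℝ := -(r * Real.cos (phase q r x))

/-- The orbit of amplitude `r`, starting from its minimum. -/
def orbit (q r x : ℝ) : ℝ := kap q (sig q r x)

/-- The velocity along the orbit. -/
def vel (q r x : ℝ) : ℝ := √2 * r * Real.sin (phase q r x)

lemma mul_cos_mem {q r : ℝ} (hr : r ∈ ampRange q) (t : ℝ) : -(r * Real.cos t) ∈ ampRange q := by
  refine ampRange_mono hr ?_
  rw [abs_neg, abs_mul]
  exact mul_le_of_le_one_right (abs_nonneg _) (Real.abs_cos_le_one t)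

lemma speed_pos {q r : ℝ} (hq : 1 < q) (hr : r ∈ ampRange q) (t : ℝ) : 0 < speed q r t :=
  div_pos (deriv_kap_pos hq (mul_cos_mem hr t)) (by positivity)

lemma continuous_speed {q r : ℝ} (hq : 1 < q) (hr : r ∈ ampRange q) : Continuous (speed q r) := by
  rw [continuous_iff_continuousAt]
  intro t
  refine ContinuousAt.div_const ?_ _
  exact ContinuousAt.comp (f := fun t => -(r * Real.cos t)) (g := deriv (kap q))
    (hasDerivAt_kap' hq (mul_cos_mem hr t)).continuousAt (by fun_prop)

lemma speed_periodic (q r : ℝ) : Function.Periodic (speed q r) (2 * Real.pi) := fun t => by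
  simp [speed]

lemma speed_neg (q r t : ℝ) : speed q r (-t) = speed q r t := by simp [speed]

lemma per_pos {q r : ℝ} (hq : 1 < q) (hr : r ∈ ampRange q) : 0 < per q r :=
  intervalIntegral.intervalIntegral_pos_of_pos ((continuous_speed hq hr).intervalIntegrable _ _)
    (speed_pos hq hr) (by positivity)

lemma hasDerivAt_timeOf {q r : ℝ} (hq : 1 < q) (hr : r ∈ ampRange q) (t : ℝ) :
    HasDerivAt (timeOf q r) (speed q r t) t :=
  (continuous_speed hq hr).integral_hasStrictDerivAt 0 t |>.hasDerivAt

lemma timeOf_strictMono {q r : ℝ} (hq : 1 < q) (hr : r ∈ ampRange q) : StrictMono (timeOf q r) :=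
  strictMono_of_deriv_pos fun t => by
    rw [(hasDerivAt_timeOf hq hr t).deriv]; exact speed_pos hq hr t

lemma timeOf_surjective {q r : ℝ} (hq : 1 < q) (hr : r ∈ ampRange q) :
    Function.Surjective (timeOf q r) := by
  have hp := per_pos hq hr
  have hc : Continuous (timeOf q r) :=
    continuous_iff_continuousAt.2 fun t => (hasDerivAt_timeOf hq hr t).continuousAt
  exact hc.surjective
    ((speed_periodic q r).tendsto_atTop_intervalIntegral_of_pos hp (by positivity))
    ((speed_periodic q r).tendsto_atBot_intervalIntegral_of_pos hp (by positivity))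

lemma timeOf_phase {q r : ℝ} (hq : 1 < q) (hr : r ∈ ampRange q) (x : ℝ) :
    timeOf q r (phase q r x) = x :=
  Function.invFun_eq (timeOf_surjective hq hr x)

lemma phase_timeOf {q r : ℝ} (hq : 1 < q) (hr : r ∈ ampRange q) (t : ℝ) :
    phase q r (timeOf q r t) = t :=
  Function.leftInverse_invFun (timeOf_strictMono hq hr).injective t

lemma timeOf_add {q r : ℝ} (hq : 1 < q) (hr : r ∈ ampRange q) (t : ℝ) :
    timeOf q r (t + 2 * Real.pi) = timeOf q r t + per q r := by
  have hi := fun a b => (continuous_speed hq hr).intervalIntegrable (μ := volume) a b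
  rw [timeOf, ← intervalIntegral.integral_add_adjacent_intervals (hi 0 t) (hi _ _),
    (speed_periodic q r).intervalIntegral_add_eq t 0, zero_add]
  rfl

lemma timeOf_neg (q r t : ℝ) : timeOf q r (-t) = -timeOf q r t := by
  have := intervalIntegral.integral_comp_neg (a := 0) (b := t) (speed q r)
  simp only [speed_neg, neg_zero] at this
  rw [timeOf, intervalIntegral.integral_symm, timeOf, this]

lemma timeOf_pi {q r : ℝ} (hq : 1 < q) (hr : r ∈ ampRange q) :
    timeOf q r Real.pi = per q r / 2 := by
  have := timeOf_add hq hr (-Real.pi)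
  rw [timeOf_neg, show -Real.pi + 2 * Real.pi = Real.pi by ring] at this
  linarith

lemma phase_add {q r : ℝ} (hq : 1 < q) (hr : r ∈ ampRange q) (x : ℝ) :
    phase q r (x + per q r) = phase q r x + 2 * Real.pi := by
  conv_lhs => rw [← timeOf_phase hq hr x, ← timeOf_add hq hr, phase_timeOf hq hr]

lemma phase_neg {q r : ℝ} (hq : 1 < q) (hr : r ∈ ampRange q) (x : ℝ) :
    phase q r (-x) = -phase q r x := by
  conv_lhs => rw [← timeOf_phase hq hr x, ← timeOf_neg, phase_timeOf hq hr]

lemma phase_zero {q r : ℝ} (hq : 1 < q) (hr : r ∈ ampRange q) : phase q r 0 = 0 := by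
  have := phase_neg hq hr 0
  rw [neg_zero] at this; linarith

lemma phase_half {q r : ℝ} (hq : 1 < q) (hr : r ∈ ampRange q) :
    phase q r (per q r / 2) = Real.pi := by
  rw [← timeOf_pi hq hr, phase_timeOf hq hr]

lemma phase_strictMono {q r : ℝ} (hq : 1 < q) (hr : r ∈ ampRange q) : StrictMono (phase q r) :=
  fun x y h => by
  rwa [← (timeOf_strictMono hq hr).lt_iff_lt, timeOf_phase hq hr, timeOf_phase hq hr]

lemma continuous_phase {q r : ℝ} (hq : 1 < q) (hr : r ∈ ampRange q) : Continuous (phase q r) := by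
  refine (phase_strictMono hq hr).monotone.continuous_of_surjective fun t => ?_
  exact ⟨timeOf q r t, phase_timeOf hq hr t⟩

lemma hasDerivAt_phase {q r : ℝ} (hq : 1 < q) (hr : r ∈ ampRange q) (x : ℝ) :
    HasDerivAt (phase q r) (speed q r (phase q r x))⁻¹ x :=
  HasDerivAt.of_local_left_inverse (continuous_phase hq hr).continuousAt
    (hasDerivAt_timeOf hq hr _) (speed_pos hq hr _).ne' (.of_forall (timeOf_phase hq hr))

lemma sig_mem {q r : ℝ} (hr : r ∈ ampRange q) (x : ℝ) : sig q r x ∈ ampRange q := mul_cos_mem hr _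

lemma hasDerivAt_sig {q r : ℝ} (hq : 1 < q) (hr : r ∈ ampRange q) (x : ℝ) :
    HasDerivAt (sig q r) (vel q r x / deriv (kap q) (sig q r x)) x := by
  have h := ((hasDerivAt_phase hq hr x).cos.const_mul r).neg
  refine HasDerivAt.congr_deriv h ?_
  have h1 := (deriv_kap_pos hq (sig_mem hr x)).ne'
  simp only [speed, vel, sig] at *
  field_simp

lemma hasDerivAt_orbit {q r : ℝ} (hq : 1 < q) (hr : r ∈ ampRange q) (x : ℝ) :
    HasDerivAt (orbit q r) (vel q r x) x := by
  have h := (hasDerivAt_kap hq (sig_mem hr x)).comp x (hasDerivAt_sig hq hr x)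
  refine HasDerivAt.congr_deriv h ?_
  have h1 := (deriv_kap_pos hq (sig_mem hr x)).ne'
  field_simp

/-- Together with `hasDerivAt_orbit` this is the canonical equation; it reduces to V'(κ) κ' = 2σ.
The factor √2 comes from the kinetic energy v²/2. -/
lemma hasDerivAt_vel {q r : ℝ} (hq : 1 < q) (hr : r ∈ ampRange q) (x : ℝ) :
    HasDerivAt (vel q r) (-force q (orbit q r x)) x := by
  have h := (hasDerivAt_phase hq hr x).sin.const_mul (√2 * r)
  refine HasDerivAt.congr_deriv h ?_
  have h1 := (deriv_kap_pos hq (sig_mem hr x)).ne'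
  have h2 := force_mul_deriv_kap hq (sig_mem hr x)
  have h3 : √2 * √2 = 2 := Real.mul_self_sqrt (by norm_num)
  simp only [speed, orbit] at *
  rw [← eq_div_iff h1] at h2
  rw [h2]
  simp only [sig] at *
  field_simp
  linear_combination (r * Real.cos (phase q r x)) * h3

lemma orbit_pos {q r : ℝ} (hr : r ∈ ampRange q) (hq : 1 < q) (x : ℝ) : 0 < orbit q r x :=
  kap_pos hq (sig_mem hr x)

lemma phase_sin_cos_add {q r : ℝ} (hq : 1 < q) (hr : r ∈ ampRange q) (x : ℝ) :
    Real.cos (phase q r (x + per q r)) = Real.cos (phase q r x) ∧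
    Real.sin (phase q r (x + per q r)) = Real.sin (phase q r x) := by
  rw [phase_add hq hr]; simp

lemma sig_periodic {q r : ℝ} (hq : 1 < q) (hr : r ∈ ampRange q) :
    Function.Periodic (sig q r) (per q r) := fun x => by
  rw [sig, (phase_sin_cos_add hq hr x).1, sig]

lemma orbit_periodic {q r : ℝ} (hq : 1 < q) (hr : r ∈ ampRange q) :
    Function.Periodic (orbit q r) (per q r) := fun x => by
  rw [orbit, sig_periodic hq hr x, orbit]

lemma vel_periodic {q r : ℝ} (hq : 1 < q) (hr : r ∈ ampRange q) :
    Function.Periodic (vel q r) (per q r) := fun x => by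
  rw [vel, (phase_sin_cos_add hq hr x).2, vel]

lemma sig_neg {q r : ℝ} (hq : 1 < q) (hr : r ∈ ampRange q) (x : ℝ) : sig q r (-x) = sig q r x := by
  rw [sig, phase_neg hq hr, Real.cos_neg, sig]

lemma orbit_neg {q r : ℝ} (hq : 1 < q) (hr : r ∈ ampRange q) (x : ℝ) :
    orbit q r (-x) = orbit q r x := by
  rw [orbit, sig_neg hq hr, orbit]

lemma vel_neg {q r : ℝ} (hq : 1 < q) (hr : r ∈ ampRange q) (x : ℝ) : vel q r (-x) = -vel q r x := by
  rw [vel, phase_neg hq hr, Real.sin_neg, vel, mul_neg]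

lemma sig_zero {q r : ℝ} (hq : 1 < q) (hr : r ∈ ampRange q) : sig q r 0 = -r := by
  simp [sig, phase_zero hq hr]

lemma sig_half {q r : ℝ} (hq : 1 < q) (hr : r ∈ ampRange q) : sig q r (per q r / 2) = r := by
  simp [sig, phase_half hq hr]

lemma orbit_zero {q r : ℝ} (hq : 1 < q) (hr : r ∈ ampRange q) : orbit q r 0 = kap q (-r) := by
  rw [orbit, sig_zero hq hr]

lemma vel_zero {q r : ℝ} (hq : 1 < q) (hr : r ∈ ampRange q) : vel q r 0 = 0 := by
  simp [vel, phase_zero hq hr]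

lemma vel_half {q r : ℝ} (hq : 1 < q) (hr : r ∈ ampRange q) : vel q r (per q r / 2) = 0 := by
  simp [vel, phase_half hq hr]

lemma vel_pos {q r : ℝ} (hq : 1 < q) (hr : r ∈ ampRange q) (hr0 : 0 < r) {x : ℝ} (hx : 0 < x)
    (hx2 : x < per q r / 2) : 0 < vel q r x := by
  have h1 := phase_strictMono hq hr hx
  have h2 := phase_strictMono hq hr hx2
  rw [phase_zero hq hr] at h1
  rw [phase_half hq hr] at h2
  have := Real.sin_pos_of_pos_of_lt_pi h1 h2
  simp only [vel]
  positivity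

lemma energy_identity {q r : ℝ} (hq : 1 < q) (hr : r ∈ ampRange q) (x : ℝ) :
    vel q r x ^ 2 / 2 + pot q (orbit q r x) = r ^ 2 := by
  rw [orbit, pot_kap hq (sig_mem hr x), vel, sig]
  have h3 : √2 ^ 2 = 2 := Real.sq_sqrt (by norm_num)
  have := Real.sin_sq_add_cos_sq (phase q r x)
  rw [mul_pow, mul_pow, h3]
  linear_combination r ^ 2 * this

lemma continuous_sig {q r : ℝ} (hq : 1 < q) (hr : r ∈ ampRange q) : Continuous (sig q r) :=
  continuous_iff_continuousAt.2 fun x => (hasDerivAt_sig hq hr x).continuousAt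

lemma continuous_orbit {q r : ℝ} (hq : 1 < q) (hr : r ∈ ampRange q) : Continuous (orbit q r) :=
  continuous_iff_continuousAt.2 fun x => (hasDerivAt_orbit hq hr x).continuousAt

lemma continuous_vel {q r : ℝ} (hq : 1 < q) (hr : r ∈ ampRange q) : Continuous (vel q r) :=
  continuous_iff_continuousAt.2 fun x => (hasDerivAt_vel hq hr x).continuousAt

/-- If `k` has derivative `v`, `v` has derivative `g ∘ k` and `g` is smooth on the positive
half-line, then a positive `k` is smooth. -/
lemma contDiff_infty_of_second_order {k v g : ℝ → ℝ} (hk : ∀ x, HasDerivAt k (v x) x)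
    (hv : ∀ x, HasDerivAt v (g (k x)) x) (hpos : ∀ x, 0 < k x)
    (hg : ∀ y, 0 < y → ContDiffAt ℝ ∞ g y) : ContDiff ℝ ∞ k := by
  have hk' : deriv k = v := funext fun x => (hk x).deriv
  have hv' : deriv v = fun x => g (k x) := funext fun x => (hv x).deriv
  have hkd : Differentiable ℝ k := fun x => (hk x).differentiableAt
  have hvd : Differentiable ℝ v := fun x => (hv x).differentiableAt
  have key : ∀ n : ℕ, ContDiff ℝ n k ∧ ContDiff ℝ n v := by
    intro n
    induction n with
    | zero => exact ⟨contDiff_zero.2 hkd.continuous, contDiff_zero.2 hvd.continuous⟩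
    | succ n ih =>
      push_cast
      rw [contDiff_succ_iff_deriv, contDiff_succ_iff_deriv, hk', hv']
      refine ⟨⟨hkd, by simp, ih.2⟩, hvd, by simp, ?_⟩
      rw [contDiff_iff_contDiffAt]
      intro x
      exact ((hg _ (hpos x)).of_le (by exact_mod_cast le_top)).comp x ih.1.contDiffAt
  exact contDiff_infty.2 fun n => (key n).1

lemma contDiffAt_force {q : ℝ} {y : ℝ} (hy : 0 < y) {n : WithTop ℕ∞} :
    ContDiffAt ℝ n (force q) y := by
  have h1 : ContDiffAt ℝ n (fun y : ℝ => y ^ q) y := Real.contDiffAt_rpow_const_of_ne hy.ne'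
  exact (h1.sub contDiffAt_const).div_const _

lemma contDiff_orbit {q r : ℝ} (hq : 1 < q) (hr : r ∈ ampRange q) : ContDiff ℝ ∞ (orbit q r) :=
  contDiff_infty_of_second_order (g := fun y => -force q y) (hasDerivAt_orbit hq hr)
    (hasDerivAt_vel hq hr) (orbit_pos hr hq) fun _ hy => (contDiffAt_force hy).neg

lemma deriv_orbit {q r : ℝ} (hq : 1 < q) (hr : r ∈ ampRange q) : deriv (orbit q r) = vel q r :=
  funext fun x => (hasDerivAt_orbit hq hr x).deriv

lemma deriv_vel {q r : ℝ} (hq : 1 < q) (hr : r ∈ ampRange q) :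
    deriv (vel q r) = fun x => -force q (orbit q r x) :=
  funext fun x => (hasDerivAt_vel hq hr x).deriv

lemma isCanonicalProfile_orbit {q r : ℝ} (hq : 1 < q) (hr : r ∈ ampRange q) :
    IsCanonicalProfile q (kap q (-r)) (orbit q r) where
  contDiff := contDiff_infty.1 (contDiff_orbit hq hr) 2
  pos := orbit_pos hr hq
  periodic := ⟨_, per_pos hq hr, orbit_periodic hq hr⟩
  ode x := by rw [deriv_orbit hq hr, deriv_vel hq hr]; simp [force]
  init := orbit_zero hq hr
  deriv_init := by rw [deriv_orbit hq hr, vel_zero hq hr]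

/-- The amplitude coordinate is recovered from the orbit, so a return to the minimum forces
cos(phase) = 1, and the phase advances by exactly 2π in time `per q r`. For r = 0 the orbit is
constant. -/
lemma isLeastPeriod_orbit {q r : ℝ} (hq : 1 < q) (hr : r ∈ ampRange q) (hr0 : r ≠ 0) :
    IsLeastPeriod (orbit q r) (per q r) := by
  refine ⟨⟨per_pos hq hr, orbit_periodic hq hr⟩, fun T hT => ?_⟩
  obtain ⟨hT0, hT⟩ := hT
  have h1 : orbit q r T = orbit q r 0 := by simpa using hT 0
  have h2 : sig q r T = sig q r 0 := by
    rw [← amp_kap hq (sig_mem hr T), ← amp_kap hq (sig_mem hr 0)]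
    exact congrArg _ h1
  have h3 : Real.cos (phase q r T) = 1 := by
    rw [sig_zero hq hr, sig, neg_inj] at h2
    exact mul_left_cancel₀ hr0 (by rw [h2, mul_one])
  by_contra hlt
  have h4 := phase_strictMono hq hr (not_le.1 hlt)
  have h5 := phase_strictMono hq hr hT0
  have h6 := phase_add hq hr 0
  rw [zero_add] at h6
  rw [h6, phase_zero hq hr] at h4
  rw [phase_zero hq hr] at h5
  rw [Real.cos_eq_one_iff_of_lt_of_lt (by linarith [Real.pi_pos]) (by linarith)] at h3
  linarith

/-- Integration over a period in terms of the phase. -/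
lemma integral_phase {q r : ℝ} (hq : 1 < q) (hr : r ∈ ampRange q) {F : ℝ → ℝ} (hF : Continuous F) :
    ∫ x in (0 : ℝ)..per q r, F (phase q r x) =
      ∫ t in (0 : ℝ)..(2 * Real.pi), F t * speed q r t := by
  have h := intervalIntegral.integral_comp_mul_deriv (a := 0) (b := 2 * Real.pi)
    (f := timeOf q r) (f' := speed q r) (g := fun x => F (phase q r x))
    (fun x _ => hasDerivAt_timeOf hq hr x) (continuous_speed hq hr).continuousOn
    (hF.comp (continuous_phase hq hr))
  simp only [Function.comp_def, phase_timeOf hq hr] at h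
  rw [h]
  simp [timeOf, per]

/-! ### Period, area and action as functions of the amplitude -/

/-- The area under one period of the orbit. -/
def are (q r : ℝ) : ℝ := ∫ x in (0 : ℝ)..per q r, orbit q r x

/-- The action of the orbit, in terms of the phase. -/
def act (q r : ℝ) : ℝ :=
  √2 * ∫ t in (0 : ℝ)..(2 * Real.pi), -(r * Real.cos t) * kap q (-(r * Real.cos t))

/-- The derivative of the period with respect to the amplitude. -/
def dper (q r : ℝ) : ℝ :=
  ∫ t in (0 : ℝ)..(2 * Real.pi), deriv (deriv (kap q)) (-(r * Real.cos t)) * -Real.cos t * (1 / √2)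

lemma continuous_comp_cos {q r : ℝ} (hr : r ∈ ampRange q) {g : ℝ → ℝ}
    (hg : ContinuousOn g (ampRange q)) : Continuous fun t => g (-(r * Real.cos t)) :=
  hg.comp_continuous (by fun_prop) (mul_cos_mem hr)

/-- Differentiation under the integral. The domination comes from a radius ρ strictly between |r|
and the edge of `ampRange`, on which g' is bounded by compactness. -/
lemma hasDerivAt_integral_cos {q r : ℝ} (hr : r ∈ ampRange q) {g g' c : ℝ → ℝ} (hc : Continuous c)
    (hg : ∀ σ ∈ ampRange q, HasDerivAt g (g' σ) σ) (hg' : ContinuousOn g' (ampRange q)) :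
    HasDerivAt (fun r => ∫ t in (0 : ℝ)..(2 * Real.pi), g (-(r * Real.cos t)) * c t)
      (∫ t in (0 : ℝ)..(2 * Real.pi), g' (-(r * Real.cos t)) * -Real.cos t * c t) r := by
  have hgc : ContinuousOn g (ampRange q) := fun σ hσ => (hg σ hσ).continuousAt.continuousWithinAt
  obtain ⟨ρ, hρ1, hρ2⟩ := exists_between (mem_ampRange.1 hr)
  have hρ0 : 0 ≤ ρ := (abs_nonneg r).trans hρ1.le
  have hsub : ∀ σ, |σ| ≤ ρ → σ ∈ ampRange q := fun σ h => mem_ampRange.2 (h.trans_lt hρ2)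
  have hcos : ∀ s, |s| < ρ → ∀ t, |-(s * Real.cos t)| ≤ ρ := fun s hs t => by
    rw [abs_neg, abs_mul]
    exact (mul_le_of_le_one_right (abs_nonneg _) (Real.abs_cos_le_one t)).trans hs.le
  obtain ⟨C, hC⟩ := (isCompact_Icc (a := -ρ) (b := ρ)).exists_bound_of_continuousOn
    (hg'.mono fun σ hσ => hsub σ (abs_le.2 hσ))
  have hC0 : 0 ≤ C := (norm_nonneg _).trans (hC 0 ⟨by linarith, hρ0⟩)
  refine (intervalIntegral.hasDerivAt_integral_of_dominated_loc_of_deriv_le (E := ℝ)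
    (F := fun r t => g (-(r * Real.cos t)) * c t)
    (F' := fun r t => g' (-(r * Real.cos t)) * -Real.cos t * c t)
    (s := {s | |s| < ρ}) (bound := fun t => C * |c t|)
    ((isOpen_lt continuous_abs continuous_const).mem_nhds hρ1) ?_ ?_ ?_ ?_ ?_ ?_).2
  · filter_upwards [(isOpen_ampRange q).mem_nhds hr] with s hs
    exact ((continuous_comp_cos hs hgc).mul hc).aestronglyMeasurable
  · exact ((continuous_comp_cos hr hgc).mul hc).intervalIntegrable _ _
  · exact (((continuous_comp_cos hr hg').mul (by fun_prop)).mul hc).aestronglyMeasurable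
  · refine .of_forall fun t _ s hs => ?_
    rw [norm_mul, norm_mul, Real.norm_eq_abs (c t), norm_neg, Real.norm_eq_abs (Real.cos t)]
    refine mul_le_mul_of_nonneg_right ?_ (abs_nonneg _)
    calc _ ≤ C * 1 := mul_le_mul (hC _ (abs_le.1 (hcos s hs t))) (Real.abs_cos_le_one t)
          (abs_nonneg _) hC0
      _ = C := mul_one C
  · exact (continuous_const.mul hc.abs).intervalIntegrable _ _
  · refine .of_forall fun t _ s hs => ?_
    have h1 : HasDerivAt (fun s => -(s * Real.cos t)) (-Real.cos t) s := by
      exact HasDerivAt.congr_deriv ((hasDerivAt_id s).mul_const (Real.cos t)).neg (by simp)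
    exact ((hg _ (hsub _ (hcos s hs t))).comp s h1).mul_const (c t)

lemma continuousOn_kap {q : ℝ} (hq : 1 < q) : ContinuousOn (kap q) (ampRange q) :=
  fun _ hσ => (hasDerivAt_kap hq hσ).continuousAt.continuousWithinAt

lemma continuousOn_kap' {q : ℝ} (hq : 1 < q) : ContinuousOn (deriv (kap q)) (ampRange q) :=
  fun _ hσ => (hasDerivAt_kap' hq hσ).continuousAt.continuousWithinAt

lemma continuousOn_kap'' {q : ℝ} (hq : 1 < q) :
    ContinuousOn (deriv (deriv (kap q))) (ampRange q) :=
  fun _ hσ => (hasDerivAt_kap'' hq hσ).continuousAt.continuousWithinAt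

lemma hasDerivAt_per {q r : ℝ} (hq : 1 < q) (hr : r ∈ ampRange q) :
    HasDerivAt (per q) (dper q r) r := by
  have h := hasDerivAt_integral_cos hr (c := fun _ => 1 / √2) continuous_const
    (fun σ hσ => hasDerivAt_kap' hq hσ) (continuousOn_kap'' hq)
  have e : per q = fun r => ∫ t in (0 : ℝ)..(2 * Real.pi),
      deriv (kap q) (-(r * Real.cos t)) * (1 / √2) := by
    funext r
    simp only [per, speed, div_eq_mul_one_div (deriv (kap q) _)]
  rw [e]
  exact h

/-- Pairing the phases t and t + π turns the integrand into a positive multiple of cos t · (κ''(r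
cos t) - κ''(-r cos t)), which is nonnegative by `deriv2_kap_lt` and positive at t = 0. -/
lemma dper_pos {q r : ℝ} (hq : 1 < q) (hr : r ∈ ampRange q) (hr0 : 0 < r) : 0 < dper q r := by
  set w := fun t => deriv (deriv (kap q)) (-(r * Real.cos t)) * -Real.cos t * (1 / √2) with hw
  have hwc : Continuous w :=
    ((continuous_comp_cos hr (continuousOn_kap'' hq)).mul (by fun_prop)).mul continuous_const
  have hi := fun a b => hwc.intervalIntegrable (μ := volume) a b
  have hwc' : Continuous fun t => w (t + Real.pi) := by fun_prop
  have h1 : dper q r = ∫ t in (0 : ℝ)..Real.pi, (w t + w (t + Real.pi)) := by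
    rw [intervalIntegral.integral_add (hi _ _)
      (hwc'.intervalIntegrable _ _),
      intervalIntegral.integral_comp_add_right (fun t => w t), zero_add, ← two_mul,
      intervalIntegral.integral_add_adjacent_intervals (hi _ _) (hi _ _)]
    rfl
  have h2 : ∀ t, w t + w (t + Real.pi) = Real.cos t * (deriv (deriv (kap q)) (r * Real.cos t) -
      deriv (deriv (kap q)) (-(r * Real.cos t))) * (1 / √2) := fun t => by
    simp only [hw, Real.cos_add_pi, mul_neg, neg_neg]; ring
  have hmem : ∀ t, r * Real.cos t ∈ ampRange q := fun t => by
    simpa using neg_mem_ampRange (mul_cos_mem hr t)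
  rw [h1]
  apply intervalIntegral.integral_pos Real.pi_pos
    (f := fun t => w t + w (t + Real.pi)) (by fun_prop)
  · intro t _
    simp only [h2]
    refine mul_nonneg ?_ (by positivity)
    rcases lt_trichotomy (Real.cos t) 0 with h | h | h
    · have := deriv2_kap_lt hq (mul_cos_mem hr t) (by
        rw [neg_pos]; exact mul_neg_of_pos_of_neg hr0 h)
      rw [neg_neg] at this
      exact mul_nonneg_of_nonpos_of_nonpos h.le (by linarith)
    · simp [h]
    · have := deriv2_kap_lt hq (hmem t) (by positivity)
      exact mul_nonneg h.le (by linarith)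
  · refine ⟨0, ⟨le_rfl, Real.pi_pos.le⟩, ?_⟩
    simp only [h2, Real.cos_zero, mul_one, one_mul]
    have := deriv2_kap_lt hq hr hr0
    have : 0 < deriv (deriv (kap q)) r - deriv (deriv (kap q)) (-r) := by linarith
    positivity

lemma hasDerivAt_kap_cos {q r : ℝ} (hq : 1 < q) (hr : r ∈ ampRange q) (t : ℝ) :
    HasDerivAt (fun t => kap q (-(r * Real.cos t)))
      (deriv (kap q) (-(r * Real.cos t)) * (r * Real.sin t)) t := by
  have h1 : HasDerivAt (fun t => -(r * Real.cos t)) (r * Real.sin t) t := by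
    exact HasDerivAt.congr_deriv ((Real.hasDerivAt_cos t).const_mul r).neg (by simp)
  exact (hasDerivAt_kap hq (mul_cos_mem hr t)).comp t h1

/-- The classical relation d(action)/d(energy) = period, with energy r². It follows by
differentiating under the integral and integrating the derivative of sin t · κ(-r cos t), which has
equal end values. -/
lemma hasDerivAt_act {q r : ℝ} (hq : 1 < q) (hr : r ∈ ampRange q) :
    HasDerivAt (act q) (2 * r * per q r) r := by
  have h := (hasDerivAt_integral_cos hr (g := fun σ => σ * kap q σ) (c := fun _ => 1)
      continuous_const
    (fun σ hσ => (hasDerivAt_id σ).mul (hasDerivAt_kap hq hσ))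
    ((continuousOn_const.mul (continuousOn_kap hq)).add
      (continuousOn_id.mul (continuousOn_kap' hq)))).const_mul √2
  have e : act q = fun r => √2 * ∫ t in (0 : ℝ)..(2 * Real.pi),
      (fun σ => σ * kap q σ) (-(r * Real.cos t)) * 1 := by
    funext r; simp only [act, mul_one]
  rw [e]
  refine h.congr_deriv ?_
  have hk := continuous_comp_cos hr (continuousOn_kap hq)
  have hk1 := continuous_comp_cos hr (continuousOn_kap' hq)
  have hz : ∫ t in (0 : ℝ)..(2 * Real.pi), (Real.cos t * kap q (-(r * Real.cos t)) +
      Real.sin t * (deriv (kap q) (-(r * Real.cos t)) * (r * Real.sin t))) = 0 := by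
    rw [intervalIntegral.integral_eq_sub_of_hasDerivAt
      (f := fun t => Real.sin t * kap q (-(r * Real.cos t)))
      (fun t _ => (Real.hasDerivAt_sin t).mul (hasDerivAt_kap_cos hq hr t))]
    · simp
    · refine Continuous.intervalIntegrable ?_ _ _
      fun_prop
  have h2 : √2 * √2 = 2 := Real.mul_self_sqrt (by norm_num)
  have e2 : 2 * r * per q r = √2 * ∫ t in (0 : ℝ)..(2 * Real.pi),
      r * deriv (kap q) (-(r * Real.cos t)) := by
    rw [intervalIntegral.integral_const_mul, per]
    simp only [speed, intervalIntegral.integral_div]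
    field_simp
    linear_combination (-r * ∫ t in (0 : ℝ)..(2 * Real.pi), deriv (kap q) (-(r * Real.cos t))) * h2
  rw [e2]
  congr 1
  rw [← sub_eq_zero, ← intervalIntegral.integral_sub]
  · rw [← neg_eq_zero, ← intervalIntegral.integral_neg]
    refine Eq.trans (intervalIntegral.integral_congr (E := ℝ) fun t _ => ?_) hz
    have := Real.sin_sq_add_cos_sq t
    simp only [id, one_mul, mul_one]
    linear_combination (r * deriv (kap q) (-(r * Real.cos t))) * (-this)
  · refine Continuous.intervalIntegrable ?_ _ _
    simp only [id, one_mul, mul_one]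
    fun_prop
  · refine Continuous.intervalIntegrable ?_ _ _
    fun_prop

lemma continuous_force_orbit {q r : ℝ} (hq : 1 < q) (hr : r ∈ ampRange q) :
    Continuous fun x => force q (orbit q r x) := by
  rw [continuous_iff_continuousAt]
  exact fun x => ContinuousAt.comp (g := force q) (hasDerivAt_force hq
    (orbit_pos hr hq x)).continuousAt (continuous_orbit hq hr).continuousAt

lemma continuous_pot_orbit {q r : ℝ} (hq : 1 < q) (hr : r ∈ ampRange q) :
    Continuous fun x => pot q (orbit q r x) := by
  rw [continuous_iff_continuousAt]
  exact fun x => ContinuousAt.comp (g := pot q) (hasDerivAt_pot hq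
    (orbit_pos hr hq x)).continuousAt (continuous_orbit hq hr).continuousAt

lemma integral_orbit_mul_force {q r : ℝ} (hq : 1 < q) (hr : r ∈ ampRange q) :
    ∫ x in (0 : ℝ)..per q r, orbit q r x * force q (orbit q r x) = act q r := by
  have hk := continuous_comp_cos hr (continuousOn_kap hq)
  have hf : Continuous fun t => force q (kap q (-(r * Real.cos t))) :=
    continuous_comp_cos hr (g := fun σ => force q (kap q σ))
      fun σ hσ => (hasDerivAt_force_kap hq hσ).continuousAt.continuousWithinAt
  have h := integral_phase hq hr (F := fun t => kap q (-(r * Real.cos t)) *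
    force q (kap q (-(r * Real.cos t)))) (hk.mul hf)
  simp only [orbit, sig] at *
  rw [h, act, ← intervalIntegral.integral_const_mul]
  refine intervalIntegral.integral_congr fun t _ => ?_
  have h2 : √2 * √2 = 2 := Real.mul_self_sqrt (by norm_num)
  have h3 := force_mul_deriv_kap hq (mul_cos_mem hr t)
  simp only [speed]
  field_simp
  linear_combination (kap q (-(r * Real.cos t))) * h3 -
    r * Real.cos t * kap q (-(r * Real.cos t)) * (-h2)

/-- Integrate (k k')' = k'² - k V'(k) over a period; the boundary terms vanish. -/
lemma integral_vel_sq {q r : ℝ} (hq : 1 < q) (hr : r ∈ ampRange q) :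
    ∫ x in (0 : ℝ)..per q r, vel q r x ^ 2 = act q r := by
  have cv := continuous_vel hq hr
  have ck := continuous_orbit hq hr
  have cf := continuous_force_orbit hq hr
  have i1 : Continuous fun x => vel q r x ^ 2 := by fun_prop
  have i2 : Continuous fun x => orbit q r x * force q (orbit q r x) := by fun_prop
  rw [← integral_orbit_mul_force hq hr, ← sub_eq_zero, ← intervalIntegral.integral_sub
    (i1.intervalIntegrable _ _) (i2.intervalIntegrable _ _)]
  have h := intervalIntegral.integral_eq_sub_of_hasDerivAt (a := 0) (b := per q r)
    (fun x _ => (hasDerivAt_orbit hq hr x).mul (hasDerivAt_vel hq hr x))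
    ((((continuous_vel hq hr).mul (continuous_vel hq hr)).add
      ((continuous_orbit hq hr).mul (continuous_force_orbit hq hr).neg)).intervalIntegrable _ _)
  have h0 := (vel_periodic hq hr) 0
  rw [zero_add, vel_zero hq hr] at h0
  simp only [Pi.mul_apply, h0, vel_zero hq hr, mul_zero, sub_zero] at h
  refine Eq.trans (intervalIntegral.integral_congr (E := ℝ) fun x _ => ?_) h
  ring

lemma integral_force_orbit {q r : ℝ} (hq : 1 < q) (hr : r ∈ ampRange q) :
    ∫ x in (0 : ℝ)..per q r, force q (orbit q r x) = 0 := by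
  have h := intervalIntegral.integral_eq_sub_of_hasDerivAt (a := 0) (b := per q r)
    (fun x _ => hasDerivAt_vel hq hr x)
    ((continuous_force_orbit hq hr).neg.intervalIntegrable _ _)
  have h0 := (vel_periodic hq hr) 0
  rw [zero_add, vel_zero hq hr] at h0
  rw [h0, vel_zero hq hr, sub_zero, intervalIntegral.integral_neg] at h
  linarith

/-- Two linear relations for ∫ V(k), one from conservation of energy and one from `mul_force`;
eliminating ∫ V(k) leaves the area in terms of period and action, both already differentiated. -/
lemma are_eq {q r : ℝ} (hq : 1 < q) (hr : r ∈ ampRange q) :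
    are q r = act q r + per q r - (q + 1) * (r ^ 2 * per q r - act q r / 2) := by
  have cv := continuous_vel hq hr
  have ck := continuous_orbit hq hr
  have cf := continuous_force_orbit hq hr
  have i1 := ck.intervalIntegrable (μ := volume) 0 (per q r)
  have i2 : IntervalIntegrable (fun x => orbit q r x * force q (orbit q r x)) volume 0 (per q r) :=
    (ck.mul cf).intervalIntegrable _ _
  have i3 := (continuous_pot_orbit hq hr).intervalIntegrable (μ := volume) 0 (per q r)
  have i4 : IntervalIntegrable (fun x => vel q r x ^ 2) volume 0 (per q r) :=
    (cv.pow 2).intervalIntegrable _ _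
  have h1 : (q + 1) * ∫ x in (0 : ℝ)..per q r, pot q (orbit q r x) =
      act q r - are q r + per q r := by
    rw [← intervalIntegral.integral_const_mul, ← integral_orbit_mul_force hq hr, are,
      ← intervalIntegral.integral_sub i2 i1]
    have i5 : IntervalIntegrable (fun x => orbit q r x * force q (orbit q r x) - orbit q r x)
      volume 0 (per q r) := i2.sub i1
    have i6 := intervalIntegral.integral_add i5 (intervalIntegrable_const (c := (1 : ℝ)))
    simp only [intervalIntegral.integral_const, sub_zero, smul_eq_mul, mul_one] at i6
    rw [← i6]
    exact intervalIntegral.integral_congr fun x _ => mul_force hq (orbit_pos hr hq x)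
  have h2 : act q r / 2 + ∫ x in (0 : ℝ)..per q r, pot q (orbit q r x) = r ^ 2 * per q r := by
    rw [← integral_vel_sq hq hr, ← intervalIntegral.integral_div,
      ← intervalIntegral.integral_add (i4.div_const 2) i3]
    simp only [energy_identity hq hr]
    simp [mul_comm]
  linear_combination (-(q + 1)) * h2 + h1

lemma hasDerivAt_are {q r : ℝ} (hq : 1 < q) (hr : r ∈ ampRange q) :
    HasDerivAt (are q) (dper q r * (1 - (q + 1) * r ^ 2) - (q - 1) * r * per q r) r := by
  have hP := hasDerivAt_per hq hr
  have hS := hasDerivAt_act hq hr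
  have h := (hS.add hP).sub ((((hasDerivAt_pow 2 r).mul hP).sub (hS.div_const 2)).const_mul (q + 1))
  refine (h.congr_of_eventuallyEq ?_).congr_deriv ?_
  · filter_upwards [(isOpen_ampRange q).mem_nhds hr] with s hs using are_eq hq hs
  · simp
    ring

lemma act_zero (q : ℝ) : act q 0 = 0 := by simp [act]

lemma are_zero {q : ℝ} (hq : 1 < q) : are q 0 = per q 0 := by
  rw [are_eq hq (zero_mem_ampRange hq), act_zero]; ring

lemma are_pos {q r : ℝ} (hq : 1 < q) (hr : r ∈ ampRange q) : 0 < are q r :=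
  intervalIntegral.intervalIntegral_pos_of_pos
    ((continuous_orbit hq hr).intervalIntegrable _ _) (orbit_pos hr hq) (per_pos hq hr)

/-- V'(k) has mean zero and dominates k - 1, strictly at the minimum. -/
lemma are_lt_per {q r : ℝ} (hq : 1 < q) (hr : r ∈ ampRange q) (hr0 : r ≠ 0) :
    are q r < per q r := by
  have hc : Continuous fun x => force q (orbit q r x) - (orbit q r x - 1) :=
    (continuous_force_orbit hq hr).sub ((continuous_orbit hq hr).sub continuous_const)
  have h : 0 < ∫ x in (0 : ℝ)..per q r, (force q (orbit q r x) - (orbit q r x - 1)) := by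
    apply intervalIntegral.integral_pos (per_pos hq hr) hc.continuousOn
    · intro x _
      by_cases h1 : orbit q r x = 1
      · simp [h1, force_one]
      · have := sub_one_lt_force hq (orbit_pos hr hq x) h1
        linarith
    · refine ⟨0, ⟨le_rfl, (per_pos hq hr).le⟩, ?_⟩
      have h1 : orbit q r 0 ≠ 1 := by
        rw [orbit_zero hq hr]
        exact kap_ne_one hq (neg_mem_ampRange hr) (neg_ne_zero.2 hr0)
      have := sub_one_lt_force hq (orbit_pos hr hq 0) h1
      linarith
  have i1 : Continuous fun x => orbit q r x - 1 := (continuous_orbit hq hr).sub continuous_const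
  rw [intervalIntegral.integral_sub ((continuous_force_orbit hq hr).intervalIntegrable _ _)
    (i1.intervalIntegrable _ _),
    intervalIntegral.integral_sub ((continuous_orbit hq hr).intervalIntegrable _ _)
    (continuous_const.intervalIntegrable _ _), integral_force_orbit hq hr] at h
  simp only [intervalIntegral.integral_const, sub_zero, smul_eq_mul, mul_one] at h
  rw [are]
  linarith

/-! ### Identification of the canonical profiles -/

lemma exists_bounds_of_periodic {k : ℝ → ℝ} {T : ℝ} (hT : 0 < T) (hk : Function.Periodic k T)
    (hc : Continuous k) (hpos : ∀ x, 0 < k x) : ∃ a b, 0 < a ∧ ∀ x, k x ∈ Icc a b := by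
  obtain ⟨x₀, _, h₀⟩ := (isCompact_Icc (a := 0) (b := T)).exists_isMinOn
    (nonempty_Icc.2 hT.le) hc.continuousOn
  obtain ⟨x₁, _, h₁⟩ := (isCompact_Icc (a := 0) (b := T)).exists_isMaxOn
    (nonempty_Icc.2 hT.le) hc.continuousOn
  refine ⟨k x₀, k x₁, hpos x₀, fun x => ?_⟩
  obtain ⟨y, hy, hxy⟩ := hk.exists_mem_Ico₀ hT x
  rw [hxy]
  exact ⟨h₀ (Ico_subset_Icc_self hy), h₁ (Ico_subset_Icc_self hy)⟩

lemma force_lipschitzOn {q : ℝ} {a b : ℝ} (ha : 0 < a) :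
    ∃ K, LipschitzOnWith K (force q) (Icc a b) := by
  have hcd : ContDiffOn ℝ 1 (force q) (Icc a b) := fun y hy =>
    (contDiffAt_force (ha.trans_le hy.1)).contDiffWithinAt
  exact hcd.exists_lipschitzOnWith one_ne_zero (convex_Icc _ _) isCompact_Icc

/-- Uniqueness for the canonical equation among periodic positive solutions. -/
lemma eq_of_canonical_ode {q : ℝ} {k₁ k₂ v₁ v₂ : ℝ → ℝ} {T₁ T₂ : ℝ}
    (hT₁ : 0 < T₁) (hT₂ : 0 < T₂) (hp₁ : Function.Periodic k₁ T₁) (hp₂ : Function.Periodic k₂ T₂)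
    (hpos₁ : ∀ x, 0 < k₁ x) (hpos₂ : ∀ x, 0 < k₂ x)
    (hk₁ : ∀ x, HasDerivAt k₁ (v₁ x) x) (hk₂ : ∀ x, HasDerivAt k₂ (v₂ x) x)
    (hv₁ : ∀ x, HasDerivAt v₁ (-force q (k₁ x)) x) (hv₂ : ∀ x, HasDerivAt v₂ (-force q (k₂ x)) x)
    {x₀ : ℝ} (hk : k₁ x₀ = k₂ x₀) (hv : v₁ x₀ = v₂ x₀) : k₁ = k₂ := by
  obtain ⟨a₁, b₁, ha₁, h₁⟩ := exists_bounds_of_periodic hT₁ hp₁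
    (continuous_iff_continuousAt.2 fun x => (hk₁ x).continuousAt) hpos₁
  obtain ⟨a₂, b₂, ha₂, h₂⟩ := exists_bounds_of_periodic hT₂ hp₂
    (continuous_iff_continuousAt.2 fun x => (hk₂ x).continuousAt) hpos₂
  -- Positive periodic solutions stay in a compact part of the open half-line, so a single Lipschitz
  -- constant serves for all times.
  obtain ⟨K, hK⟩ := force_lipschitzOn (q := q) (a := min a₁ a₂) (b := max b₁ b₂) (lt_min ha₁ ha₂)
  have hL : ∀ _ : ℝ, LipschitzOnWith (max 1 K) (fun p : ℝ × ℝ => (p.2, -force q p.1))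
      (Icc (min a₁ a₂) (max b₁ b₂) ×ˢ univ) := by
    intro _
    refine LipschitzOnWith.prodMk (LipschitzWith.prod_snd.lipschitzOnWith) ?_
    have h3 := hK.comp (LipschitzWith.prod_fst (α := ℝ) (β := ℝ)).lipschitzOnWith
      (s := Icc (min a₁ a₂) (max b₁ b₂) ×ˢ univ) fun p hp => hp.1
    rw [mul_one] at h3
    exact h3.neg
  have := ODE_solution_unique_univ (f := fun x => (k₁ x, v₁ x)) (g := fun x => (k₂ x, v₂ x))
    (t₀ := x₀) hL
    (fun x => ⟨(hk₁ x).prodMk (hv₁ x), ⟨(min_le_left _ _).trans (h₁ x).1,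
      (h₁ x).2.trans (le_max_left _ _)⟩, trivial⟩)
    (fun x => ⟨(hk₂ x).prodMk (hv₂ x), ⟨(min_le_right _ _).trans (h₂ x).1,
      (h₂ x).2.trans (le_max_right _ _)⟩, trivial⟩) (by simp [hk, hv])
  exact funext fun x => congrArg Prod.fst (congrFun this x)

lemma IsCanonicalProfile.hasDerivAt {q α : ℝ} {k : ℝ → ℝ} (hk : IsCanonicalProfile q α k) (x : ℝ) :
    HasDerivAt k (deriv k x) x :=
  (hk.contDiff.differentiable (by norm_num) x).hasDerivAt

lemma IsCanonicalProfile.hasDerivAt_deriv {q α : ℝ} {k : ℝ → ℝ} (hk : IsCanonicalProfile q α k)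
    (x : ℝ) : HasDerivAt (deriv k) (-force q (k x)) x := by
  have h1 : ContDiff ℝ 1 (deriv k) := (contDiff_succ_iff_deriv (n := 1).1 hk.contDiff).2.2
  have h2 := (h1.differentiable (by norm_num) x).hasDerivAt
  refine h2.congr_deriv ?_
  have := hk.ode x
  rw [force]; linarith

/-- The amplitude of the canonical profile with minimum `α`. -/
def ampOf (q α : ℝ) : ℝ := -amp q α

lemma ampOf_mem {q : ℝ} (hq : 1 < q) {α : ℝ} (hα : α ∈ Ioo (0 : ℝ) 1) : ampOf q α ∈ ampRange q :=
  neg_mem_ampRange (amp_mem_ampRange hq hα.1 hα.2)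

lemma ampOf_pos {q : ℝ} (hq : 1 < q) {α : ℝ} (hα : α ∈ Ioo (0 : ℝ) 1) : 0 < ampOf q α :=
  neg_pos.2 (amp_neg hq hα.1 hα.2)

lemma kap_neg_ampOf {q : ℝ} (hq : 1 < q) {α : ℝ} (hα : α ∈ Ioo (0 : ℝ) 1) :
    kap q (-ampOf q α) = α := by
  rw [ampOf, neg_neg]
  exact (eq_kap hq (amp_mem_ampRange hq hα.1 hα.2) hα.1 rfl).symm

lemma ampOf_kap_neg {q : ℝ} (hq : 1 < q) {r : ℝ} (hr : r ∈ ampRange q) :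
    ampOf q (kap q (-r)) = r := by
  rw [ampOf, amp_kap hq (neg_mem_ampRange hr), neg_neg]

lemma kap_neg_mem {q : ℝ} (hq : 1 < q) {r : ℝ} (hr : r ∈ ampRange q) (hr0 : 0 < r) :
    kap q (-r) ∈ Ioo (0 : ℝ) 1 := by
  refine ⟨kap_pos hq (neg_mem_ampRange hr), ?_⟩
  rw [← kap_zero hq]
  exact kap_lt_kap hq (neg_mem_ampRange hr) (zero_mem_ampRange hq) (by linarith)

lemma ampOf_lt_ampOf {q : ℝ} (hq : 1 < q) {α β : ℝ} (hα : 0 < α) (h : α < β) :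
    ampOf q β < ampOf q α :=
  neg_lt_neg (amp_strictMonoOn hq hα (hα.trans h) h)

/-- Uniqueness for the initial value problem. It identifies the profile chosen by
`Classical.epsilon` with the explicit orbit, hence `period` and `area` with `per` and `are`. -/
lemma isCanonicalProfile_eq_orbit {q : ℝ} (hq : 1 < q) {α : ℝ} (hα : α ∈ Ioo (0 : ℝ) 1) {k : ℝ → ℝ}
    (hk : IsCanonicalProfile q α k) : k = orbit q (ampOf q α) := by
  have hr := ampOf_mem hq hα
  obtain ⟨T, hT, hTp⟩ := hk.periodic
  refine eq_of_canonical_ode hT (per_pos hq hr) hTp (orbit_periodic hq hr) hk.pos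
    (orbit_pos hr hq) hk.hasDerivAt (hasDerivAt_orbit hq hr) hk.hasDerivAt_deriv
    (hasDerivAt_vel hq hr) (x₀ := 0) ?_ ?_
  · rw [hk.init, orbit_zero hq hr, kap_neg_ampOf hq hα]
  · rw [hk.deriv_init, vel_zero hq hr]

lemma canonicalProfile_eq {q : ℝ} (hq : 1 < q) {α : ℝ} (hα : α ∈ Ioo (0 : ℝ) 1) :
    canonicalProfile q α = orbit q (ampOf q α) := by
  have h := isCanonicalProfile_orbit hq (ampOf_mem hq hα)
  rw [kap_neg_ampOf hq hα] at h
  exact isCanonicalProfile_eq_orbit hq hα (Classical.epsilon_spec ⟨_, h⟩)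

lemma period_eq {q : ℝ} (hq : 1 < q) {α : ℝ} (hα : α ∈ Ioo (0 : ℝ) 1) :
    period q α = per q (ampOf q α) := by
  rw [period, canonicalProfile_eq hq hα]
  exact (isLeastPeriod_orbit hq (ampOf_mem hq hα) (ampOf_pos hq hα).ne').csInf_eq

lemma area_eq {q : ℝ} (hq : 1 < q) {α : ℝ} (hα : α ∈ Ioo (0 : ℝ) 1) :
    area q α = are q (ampOf q α) := by
  rw [area, canonicalProfile_eq hq hα, period_eq hq hα, are]

/-! ### The bifurcation function in terms of the amplitude -/

/-- `E` as a function of the amplitude. -/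
def bifAmp (q r : ℝ) : ℝ := per q r ^ (3 - q) * are q r ^ (q - 1)

/-- The derivative of the area with respect to the amplitude. -/
def dare (q r : ℝ) : ℝ := dper q r * (1 - (q + 1) * r ^ 2) - (q - 1) * r * per q r

/-- A positive multiple of the derivative of `bifAmp`. -/
def dbifAmp (q r : ℝ) : ℝ := (3 - q) * are q r * dper q r + (q - 1) * per q r * dare q r

lemma hasDerivAt_bifAmp {q r : ℝ} (hq : 1 < q) (hr : r ∈ ampRange q) :
    HasDerivAt (bifAmp q) (bifAmp q r / (per q r * are q r) * dbifAmp q r) r := by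
  have hP := per_pos hq hr
  have hA := are_pos hq hr
  have h := ((hasDerivAt_per hq hr).rpow_const (p := 3 - q) (Or.inl hP.ne')).mul
    ((hasDerivAt_are hq hr).rpow_const (p := q - 1) (Or.inl hA.ne'))
  refine HasDerivAt.congr_deriv h ?_
  rw [Real.rpow_sub_one hP.ne' (3 - q), Real.rpow_sub_one hA.ne' (q - 1), ← dare, bifAmp, dbifAmp]
  field_simp

lemma bifAmp_pos {q r : ℝ} (hq : 1 < q) (hr : r ∈ ampRange q) : 0 < bifAmp q r :=
  mul_pos (Real.rpow_pos_of_pos (per_pos hq hr) _) (Real.rpow_pos_of_pos (are_pos hq hr) _)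

lemma bifurcationE_eq {q : ℝ} (hq : 1 < q) {α : ℝ} (hα : α ∈ Ioo (0 : ℝ) 1) :
    bifurcationE q α = bifAmp q (ampOf q α) := by
  rw [bifurcationE, period_eq hq hα, area_eq hq hα, bifAmp]

lemma hasDerivAt_bifurcationE {q : ℝ} (hq : 1 < q) {α : ℝ} (hα : α ∈ Ioo (0 : ℝ) 1) :
    HasDerivAt (bifurcationE q) (-(bifAmp q (ampOf q α) / (per q (ampOf q α) * are q (ampOf q α)) *
      deriv (amp q) α) * dbifAmp q (ampOf q α)) α := by
  have h1 : HasDerivAt (ampOf q) (-deriv (amp q) α) α :=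
    ((contDiffAt_amp hq hα.1).differentiableAt (by simp)).hasDerivAt.neg
  have h2 := (hasDerivAt_bifAmp hq (ampOf_mem hq hα)).comp α h1
  refine (h2.congr_of_eventuallyEq ?_).congr_deriv (by ring)
  filter_upwards [isOpen_Ioo.mem_nhds hα] with β hβ using bifurcationE_eq hq hβ

/-- The amplitude decreases as the minimum α increases, so the signs are opposite. -/
lemma dbifAmp_sign {q : ℝ} (hq : 1 < q) {α : ℝ} (hα : α ∈ Ioo (0 : ℝ) 1) :
    (deriv (bifurcationE q) α < 0 → 0 < dbifAmp q (ampOf q α)) ∧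
      (0 < deriv (bifurcationE q) α → dbifAmp q (ampOf q α) < 0) := by
  have hr := ampOf_mem hq hα
  have hc : 0 < bifAmp q (ampOf q α) / (per q (ampOf q α) * are q (ampOf q α)) *
      deriv (amp q) α :=
    mul_pos (div_pos (bifAmp_pos hq hr) (mul_pos (per_pos hq hr) (are_pos hq hr)))
      (deriv_amp_pos hq hα.1)
  rw [(hasDerivAt_bifurcationE hq hα).deriv]
  constructor
  · intro h
    rw [neg_mul, neg_lt_zero] at h
    exact pos_of_mul_pos_right h hc.le
  · intro h
    rw [neg_mul, neg_pos] at h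
    by_contra hn
    exact absurd h (not_lt.2 (mul_nonneg hc.le (not_lt.1 hn)))

/-! ### Functions that are locally in `H¹` -/

/-- Absolutely continuous functions on the line with locally square integrable derivative. -/
structure IsH1Loc (u : ℝ → ℝ) : Prop where
  absCont : ∀ a b, AbsolutelyContinuousOnInterval u a b
  sq_deriv : ∀ a b, IntervalIntegrable (fun x => deriv u x ^ 2) volume a b

namespace IsH1Loc

lemma of_integral {u g : ℝ → ℝ} {c : ℝ} (hg : ∀ a b, IntervalIntegrable g volume a b)
    (hu : ∀ x, u x = c + ∫ t in (0 : ℝ)..x, g t) (a b : ℝ) :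
    AbsolutelyContinuousOnInterval u a b := by
  have h1 : AbsolutelyContinuousOnInterval (fun x => ∫ t in a..x, g t) a b :=
    (hg a b).absolutelyContinuousOnInterval_intervalIntegral left_mem_uIcc
  have h2 : AbsolutelyContinuousOnInterval (fun _ => u a) a b :=
    ContDiffOn.absolutelyContinuousOnInterval contDiffOn_const
  have h3 : u = (fun _ => u a) + fun x => ∫ t in a..x, g t := by
    funext x
    have := intervalIntegral.integral_add_adjacent_intervals (hg 0 a) (hg a x)
    simp only [Pi.add_apply, hu, ← this]
    ring
  rw [h3]
  exact h2.add h1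

lemma of_contDiff {u : ℝ → ℝ} (hu : ContDiff ℝ 1 u) : IsH1Loc u where
  absCont _ _ := hu.contDiffOn.absolutelyContinuousOnInterval
  sq_deriv _ _ := ((hu.continuous_deriv le_rfl).pow 2).intervalIntegrable _ _

lemma continuous {u : ℝ → ℝ} (hu : IsH1Loc u) : Continuous u := by
  rw [continuous_iff_continuousAt]
  intro x
  have h := (hu.absCont (x - 1) (x + 1)).continuousOn
  rw [uIcc_of_le (by linarith)] at h
  exact h.continuousAt (Icc_mem_nhds (by linarith) (by linarith))

lemma intervalIntegrable_deriv {u : ℝ → ℝ} (hu : IsH1Loc u) (a b : ℝ) :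
    IntervalIntegrable (deriv u) volume a b := (hu.absCont a b).intervalIntegrable_deriv

lemma ae_differentiableAt {u : ℝ → ℝ} (hu : IsH1Loc u) : ∀ᵐ x : ℝ, DifferentiableAt ℝ u x := by
  have h : ∀ᵐ x : ℝ, ∀ n : ℕ, x ∈ uIcc (-(n : ℝ)) n → DifferentiableAt ℝ u x :=
    ae_all_iff.2 fun n => (hu.absCont _ _).ae_differentiableAt
  filter_upwards [h] with x hx
  obtain ⟨n, hn⟩ := exists_nat_ge |x|
  refine hx n ?_
  rw [uIcc_of_le (by linarith [abs_nonneg x])]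
  exact abs_le.1 hn

lemma ae_deriv_sub {u ψ ψ' : ℝ → ℝ} (hu : IsH1Loc u) (hψ : ∀ x, HasDerivAt ψ (ψ' x) x) :
    ∀ᵐ x : ℝ, deriv (fun x => u x - ψ x) x = deriv u x - ψ' x := by
  filter_upwards [hu.ae_differentiableAt] with x hx
  exact (hx.hasDerivAt.sub (hψ x)).deriv

lemma contDiff_one {ψ ψ' : ℝ → ℝ} (hψ : ∀ x, HasDerivAt ψ (ψ' x) x) (hc : Continuous ψ') :
    ContDiff ℝ 1 ψ := by
  rw [contDiff_one_iff_deriv, funext fun x => (hψ x).deriv]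
  exact ⟨fun x => (hψ x).differentiableAt, hc⟩

lemma sub_smooth {u ψ ψ' : ℝ → ℝ} (hu : IsH1Loc u) (hψ : ∀ x, HasDerivAt ψ (ψ' x) x)
    (hc : Continuous ψ') : IsH1Loc fun x => u x - ψ x where
  absCont a b := (hu.absCont a b).sub ((of_contDiff (contDiff_one hψ hc)).absCont a b)
  sq_deriv a b := by
    have h1 : IntervalIntegrable (fun x => deriv u x ^ 2 - deriv u x * (2 * ψ' x) + ψ' x ^ 2)
        volume a b :=
      ((hu.sq_deriv a b).sub ((hu.intervalIntegrable_deriv a b).mul_continuousOn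
        (by fun_prop))).add ((hc.pow 2).intervalIntegrable a b)
    refine h1.congr_ae (ae_restrict_of_ae ?_)
    filter_upwards [hu.ae_deriv_sub hψ] with x hx
    rw [hx]; ring

/-- A Cauchy–Schwarz estimate for increments. -/
lemma sq_increment_le {u : ℝ → ℝ} (hu : IsH1Loc u) (a b : ℝ) :
    (u b - u a) ^ 2 ≤ (b - a) * ∫ x in a..b, deriv u x ^ 2 := by
  wlog hab : a ≤ b generalizing a b
  · have := this b a (by linarith)
    rw [intervalIntegral.integral_symm]
    nlinarith
  rcases hab.eq_or_lt with rfl | hab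
  · simp
  -- The mean slope: expanding ∫ (u' - s)² ≥ 0 is the estimate.
  set s := (u b - u a) / (b - a) with hs
  have h0 : 0 < b - a := by linarith
  have hi := hu.intervalIntegrable_deriv a b
  have h1 : 0 ≤ ∫ x in a..b, (deriv u x - s) ^ 2 :=
    intervalIntegral.integral_nonneg hab.le fun x _ => sq_nonneg _
  have h2 : ∫ x in a..b, (deriv u x - s) ^ 2 =
      (∫ x in a..b, deriv u x ^ 2) - 2 * s * (u b - u a) + s ^ 2 * (b - a) := by
    rw [← (hu.absCont a b).integral_deriv_eq_sub, ← intervalIntegral.integral_const_mul,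
      ← intervalIntegral.integral_sub (hu.sq_deriv a b) (hi.const_mul _)]
    have := intervalIntegral.integral_add (((hu.sq_deriv a b).sub (hi.const_mul (2 * s))))
      (intervalIntegrable_const (c := s ^ 2))
    simp only [intervalIntegral.integral_const, smul_eq_mul] at this
    rw [mul_comm (s ^ 2), ← this]
    exact intervalIntegral.integral_congr fun x _ => by ring
  have h3 : u b - u a = s * (b - a) := by rw [hs]; field_simp
  rw [h2, h3] at h1
  rw [h3]
  nlinarith

/-- Composition with an affine map. -/
lemma comp_affine {u : ℝ → ℝ} (hu : IsH1Loc u) {c : ℝ} (hc : c ≠ 0) (d : ℝ) :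
    IsH1Loc fun x => u (d + c * x) := by
  have hd : ∀ x, deriv (fun x => u (d + c * x)) x = c * deriv u (d + c * x) := fun x => by
    rw [deriv_comp_mul_left c (fun y => u (d + y)), deriv_comp_const_add, smul_eq_mul]
  have hI : ∀ {f : ℝ → ℝ}, (∀ a b, IntervalIntegrable f volume a b) → ∀ a b,
      IntervalIntegrable (fun x => f (d + c * x)) volume a b := fun {f} hf a b => by
    have h1 : ∀ a b, IntervalIntegrable (fun x => f (d + x)) volume a b := fun a b => by
      have := (hf (d + a) (d + b)).comp_add_left d
      simpa using this
    have := (h1 (c * a) (c * b)).comp_mul_left (c := c)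
    rwa [mul_div_cancel_left₀ _ hc, mul_div_cancel_left₀ _ hc] at this
  refine ⟨of_integral (g := fun x => c * deriv u (d + c * x)) (c := u d)
    (fun a b => (hI hu.intervalIntegrable_deriv a b).const_mul c) fun x => ?_, fun a b => ?_⟩
  · have := intervalIntegral.smul_integral_comp_add_mul (a := 0) (b := x) (deriv u) c d
    rw [smul_eq_mul] at this
    rw [intervalIntegral.integral_const_mul, this,
      (hu.absCont _ _).integral_deriv_eq_sub]
    simp
  · simp only [hd, mul_pow]
    exact (hI hu.sq_deriv a b).const_mul _

end IsH1Loc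

lemma deriv_periodic {u : ℝ → ℝ} {X : ℝ} (hu : Function.Periodic u X) :
    Function.Periodic (deriv u) X := fun x => by
  rw [← deriv_comp_add_const]
  exact congrArg (fun f => deriv f x) (funext hu)

/-- The difference between u and the primitive of u' is periodic, as u' has mean zero, and constant
on one period by absolute continuity. Hence u is a primitive of u' on the whole line. -/
lemma IsH1Periodic.isH1Loc {X : ℝ} (hX : 0 < X) {u : ℝ → ℝ} (hu : IsH1Periodic X u) :
    IsH1Loc u := by
  have hd := deriv_periodic hu.periodic
  have h1 : ∀ a b, IntervalIntegrable (deriv u) volume a b :=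
    hd.intervalIntegrable (t := 0) hX.ne' (by
      rw [zero_add]; exact hu.absCont.intervalIntegrable_deriv)
  have h2 : ∀ a b, IntervalIntegrable (fun x => deriv u x ^ 2) volume a b := by
    refine Function.Periodic.intervalIntegrable (T := X) (t := 0) (fun x => ?_) hX.ne' ?_
    · simp only [hd x]
    · rw [zero_add, intervalIntegrable_iff_integrableOn_Ioc_of_le hX.le]
      exact hu.deriv_memLp.integrable_sq
  refine ⟨IsH1Loc.of_integral (c := u 0) h1 fun x => ?_, h2⟩
  have h0 : ∫ t in (0 : ℝ)..X, deriv u t = 0 := by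
    rw [hu.absCont.integral_deriv_eq_sub]
    have := hu.periodic 0
    rw [zero_add] at this
    linarith
  have hF : Function.Periodic (fun x => u x - ∫ t in (0 : ℝ)..x, deriv u t) X := fun x => by
    have h3 := intervalIntegral.integral_add_adjacent_intervals (h1 0 x) (h1 x (x + X))
    have h4 := hd.intervalIntegral_add_eq x 0
    rw [zero_add, h0] at h4
    simp only [hu.periodic x, ← h3, h4, add_zero]
  obtain ⟨y, hy, hxy⟩ := hF.exists_mem_Ico₀ hX x
  have h5 : u y - ∫ t in (0 : ℝ)..y, deriv u t = u 0 := by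
    rw [AbsolutelyContinuousOnInterval.integral_deriv_eq_sub]
    · ring
    · refine hu.absCont.mono ?_
      rw [uIcc_of_le hy.1, uIcc_of_le hX.le]
      exact Icc_subset_Icc_right hy.2.le
  linarith

/-! ### The Dirichlet form on an interval bounded by zeros of a Jacobi field -/

/-- The quadratic form of `-d²/dx² - W` on `[a, b]`. -/
def quadForm (W : ℝ → ℝ) (a b : ℝ) (u : ℝ → ℝ) : ℝ :=
  ∫ x in a..b, (deriv u x ^ 2 - W x * u x ^ 2)

lemma IsH1Loc.integrable_quad {u W : ℝ → ℝ} (hu : IsH1Loc u) (hW : Continuous W) (a b : ℝ) :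
    IntervalIntegrable (fun x => deriv u x ^ 2 - W x * u x ^ 2) volume a b :=
  (hu.sq_deriv a b).sub ((hW.mul (hu.continuous.pow 2)).intervalIntegrable a b)

/-- By Cauchy–Schwarz v² ≤ |x - x₀| · |∫ v'²| = o(|x - x₀|), while w has a simple zero. No
derivative of v at x₀ is needed, so the argument covers all of H¹. -/
lemma tendsto_boundary_term {w w₁ v : ℝ → ℝ} (hv : IsH1Loc v) {x₀ : ℝ}
    (hw : HasDerivAt w (w₁ x₀) x₀) (hw₁ : ContinuousAt w₁ x₀) (h0 : w x₀ = 0) (h1 : w₁ x₀ ≠ 0)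
    (hv0 : v x₀ = 0) : Tendsto (fun x => w₁ x / w x * v x ^ 2) (𝓝[≠] x₀) (𝓝 0) := by
  have hs := hasDerivAt_iff_tendsto_slope.1 hw
  have hr : Tendsto (fun x => w₁ x / slope w x₀ x) (𝓝[≠] x₀) (𝓝 1) := by
    have := (hw₁.tendsto.mono_left nhdsWithin_le_nhds).div hs h1
    rwa [div_self h1] at this
  have hI : Tendsto (fun x => ∫ t in x₀..x, deriv v t ^ 2) (𝓝[≠] x₀) (𝓝 0) := by
    have hc := intervalIntegral.continuousOn_primitive_interval' (a := x₀)
      (hv.sq_deriv (x₀ - 1) (x₀ + 1)) (by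
        rw [uIcc_of_le (by linarith)]; exact ⟨by linarith, by linarith⟩)
    rw [uIcc_of_le (by linarith)] at hc
    have := (hc.continuousAt (x := x₀)
      (Icc_mem_nhds (by linarith) (by linarith))).tendsto.mono_left
      (nhdsWithin_le_nhds (s := {x₀}ᶜ))
    simpa using this
  have hq : Tendsto (fun x => v x ^ 2 / (x - x₀)) (𝓝[≠] x₀) (𝓝 0) := by
    refine squeeze_zero_norm' ?_ (by simpa using hI.abs)
    filter_upwards [self_mem_nhdsWithin] with x hx
    have hx' : x - x₀ ≠ 0 := sub_ne_zero.2 hx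
    have h2 := hv.sq_increment_le x₀ x
    rw [hv0, sub_zero] at h2
    rw [Real.norm_eq_abs, abs_div, abs_of_nonneg (sq_nonneg (v x)), div_le_iff₀ (abs_pos.2 hx')]
    calc v x ^ 2 ≤ _ := h2
      _ ≤ _ := le_abs_self _
      _ = _ := by rw [abs_mul, mul_comm]
  have := hr.mul hq
  rw [one_mul] at this
  refine this.congr' ?_
  filter_upwards [self_mem_nhdsWithin] with x hx
  have hx' : x - x₀ ≠ 0 := sub_ne_zero.2 hx
  rw [slope_def_field, h0, sub_zero]
  by_cases hwx : w x = 0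
  · simp [hwx]
  · field_simp

/-- Picone's identity away from the zeros of the Jacobi field. -/
lemma picone {W w w₁ v : ℝ → ℝ} (hW : Continuous W) (hv : IsH1Loc v)
    (hw : ∀ x, HasDerivAt w (w₁ x) x) (hw₁ : ∀ x, HasDerivAt w₁ (-(W x * w x)) x) {a b : ℝ}
    (hab : a ≤ b) (hpos : ∀ x ∈ Icc a b, w x ≠ 0) :
    IntervalIntegrable (fun x => (deriv v x - w₁ x / w x * v x) ^ 2) volume a b ∧
    ∫ x in a..b, (deriv v x - w₁ x / w x * v x) ^ 2 =
      quadForm W a b v - (w₁ b / w b * v b ^ 2 - w₁ a / w a * v a ^ 2) := by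
  have hwc : Continuous w := continuous_iff_continuousAt.2 fun x => (hw x).continuousAt
  have hw₁c : Continuous w₁ := continuous_iff_continuousAt.2 fun x => (hw₁ x).continuousAt
  have hvc := hv.continuous
  have hpc : ContinuousOn (fun x => w₁ x / w x) (uIcc a b) := by
    rw [uIcc_of_le hab]
    exact hw₁c.continuousOn.div hwc.continuousOn hpos
  have hpd : ∀ x ∈ Icc a b, HasDerivAt (fun x => w₁ x / w x) (-W x - (w₁ x / w x) ^ 2) x := by
    intro x hx
    refine ((hw₁ x).div (hw x) (hpos x hx)).congr_deriv ?_
    have := hpos x hx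
    field_simp
  have hpac : AbsolutelyContinuousOnInterval (fun x => w₁ x / w x) a b := by
    apply ContDiffOn.absolutelyContinuousOnInterval
    rw [uIcc_of_le hab]
    have hww : ContDiff ℝ 1 w := IsH1Loc.contDiff_one hw hw₁c
    have hww₁ : ContDiff ℝ 1 w₁ := IsH1Loc.contDiff_one hw₁ (hW.mul hwc).neg
    exact hww₁.contDiffOn.div hww.contDiffOn hpos
  have hac := (hpac.mul ((hv.absCont a b).mul (hv.absCont a b)))
  have hint := hac.integral_deriv_eq_sub
  have hde : ∀ᵐ x : ℝ, x ∈ Icc a b →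
      deriv ((fun x => w₁ x / w x) * (v * v)) x =
      (-W x - (w₁ x / w x) ^ 2) * v x ^ 2 + w₁ x / w x * (2 * v x * deriv v x) := by
    filter_upwards [hv.ae_differentiableAt] with x hx hxab
    rw [((hpd x hxab).mul (hx.hasDerivAt.mul hx.hasDerivAt)).deriv]
    simp only [Pi.mul_apply]
    ring
  have hi1 := hv.integrable_quad hW a b
  have hi2 : IntervalIntegrable (fun x => (-W x - (w₁ x / w x) ^ 2) * v x ^ 2 +
      w₁ x / w x * (2 * v x * deriv v x)) volume a b := by
    have h1 : ContinuousOn (fun x => (-W x - (w₁ x / w x) ^ 2) * v x ^ 2) (uIcc a b) := by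
      fun_prop
    have h2 : ContinuousOn (fun x => w₁ x / w x * (2 * v x)) (uIcc a b) := by fun_prop
    refine h1.intervalIntegrable.add ?_
    refine ((hv.intervalIntegrable_deriv a b).mul_continuousOn h2).congr ?_
    exact fun x _ => by ring
  have hrw : ∀ x, (deriv v x - w₁ x / w x * v x) ^ 2 = (deriv v x ^ 2 - W x * v x ^ 2) -
      ((-W x - (w₁ x / w x) ^ 2) * v x ^ 2 + w₁ x / w x * (2 * v x * deriv v x)) := fun x => by
    ring
  have hint2 : ∫ x in a..b, ((-W x - (w₁ x / w x) ^ 2) * v x ^ 2 +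
      w₁ x / w x * (2 * v x * deriv v x)) = w₁ b / w b * v b ^ 2 - w₁ a / w a * v a ^ 2 := by
    rw [← intervalIntegral.integral_congr_ae (f := deriv ((fun x => w₁ x / w x) * (v * v))), hint]
    · simp only [Pi.mul_apply]; ring
    · filter_upwards [hde] with x hx hxab
      rw [uIoc_of_le hab] at hxab
      exact hx (Ioc_subset_Icc_self hxab)
  simp only [hrw]
  refine ⟨hi1.sub hi2, ?_⟩
  rw [intervalIntegral.integral_sub hi1 hi2, hint2, quadForm]

/-- Picone's identity on [d, l - d]; its boundary terms vanish as d → 0. Shrinking the domain of the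
integral to the fixed interval [a, b] only decreases it, since the integrand is a square. -/
lemma dirichlet_aux {W w w₁ v : ℝ → ℝ} (hW : Continuous W) (hv : IsH1Loc v)
    (hw : ∀ x, HasDerivAt w (w₁ x) x) (hw₁ : ∀ x, HasDerivAt w₁ (-(W x * w x)) x) {l : ℝ}
    (hpos : ∀ x ∈ Ioo 0 l, w x ≠ 0) (h0 : w 0 = 0) (hl : w l = 0) (h10 : w₁ 0 ≠ 0)
    (h1l : w₁ l ≠ 0) (hv0 : v 0 = 0) (hvl : v l = 0) {a b : ℝ} (ha : 0 < a) (hab : a ≤ b)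
    (hb : b < l) :
    ∫ x in a..b, (deriv v x - w₁ x / w x * v x) ^ 2 ≤ quadForm W 0 l v := by
  have hw₁c : Continuous w₁ := continuous_iff_continuousAt.2 fun x => (hw₁ x).continuousAt
  have t1 : Tendsto (fun d : ℝ => l - d) (𝓝[>] 0) (𝓝[≠] l) := by
    apply tendsto_nhdsWithin_of_tendsto_nhds_of_eventually_within
    · have : Tendsto (fun d : ℝ => l - d) (𝓝 0) (𝓝 (l - 0)) := by
        apply Continuous.tendsto; fun_prop
      rw [sub_zero] at this
      exact this.mono_left nhdsWithin_le_nhds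
    · filter_upwards [self_mem_nhdsWithin] with d hd
      have : (0 : ℝ) < d := hd
      exact ne_of_lt (by linarith)
  have t2 : Tendsto (fun d : ℝ => d) (𝓝[>] 0) (𝓝[≠] 0) :=
    nhdsWithin_mono _ fun x hx => ne_of_gt hx
  have b1 := (tendsto_boundary_term hv (hw l) hw₁c.continuousAt hl h1l hvl).comp t1
  have b0 := (tendsto_boundary_term hv (hw 0) hw₁c.continuousAt h0 h10 hv0).comp t2
  have hq := hv.integrable_quad hW
  have hQ : Tendsto (fun d : ℝ => quadForm W d (l - d) v) (𝓝[>] 0) (𝓝 (quadForm W 0 l v)) := by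
    have hl1 : 0 < l := by linarith
    have hc : Continuous fun x => ∫ t in (0 : ℝ)..x, (deriv v t ^ 2 - W t * v t ^ 2) :=
      intervalIntegral.continuous_primitive hq 0
    have he : ∀ d, quadForm W d (l - d) v = (∫ t in (0 : ℝ)..(l - d),
        (deriv v t ^ 2 - W t * v t ^ 2))
        - ∫ t in (0 : ℝ)..d, (deriv v t ^ 2 - W t * v t ^ 2) := fun d => by
      rw [intervalIntegral.integral_interval_sub_left (hq _ _) (hq _ _), quadForm]
    simp only [he]
    have h3 := (hc.tendsto l).comp (t1.mono_right nhdsWithin_le_nhds)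
    have h4 := (hc.tendsto 0).comp (t2.mono_right nhdsWithin_le_nhds)
    have := h3.sub h4
    simpa [quadForm] using this
  have hlim := hQ.sub (b1.sub b0)
  rw [sub_zero, sub_zero] at hlim
  refine ge_of_tendsto hlim ?_
  filter_upwards [Ioo_mem_nhdsGT ha, Ioo_mem_nhdsGT (show 0 < l - b by linarith)] with d hd hd2
  have hp := picone hW hv hw hw₁ (a := d) (b := l - d) (by linarith [hd.2, hd2.2])
    (fun x hx => hpos x ⟨hd.1.trans_le hx.1, by linarith [hx.2, hd.1]⟩)
  simp only [Function.comp_apply]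
  rw [← hp.2]
  exact intervalIntegral.integral_mono_interval hd.2.le hab (by linarith [hd2.2])
    (.of_forall fun x => sq_nonneg _) hp.1

/-- Between consecutive zeros of a Jacobi field the Dirichlet form is nonnegative, and only the
multiples of the field are null vectors. -/
lemma dirichlet_form {W w w₁ v : ℝ → ℝ} (hW : Continuous W) (hv : IsH1Loc v)
    (hw : ∀ x, HasDerivAt w (w₁ x) x) (hw₁ : ∀ x, HasDerivAt w₁ (-(W x * w x)) x) {l : ℝ}
    (hl0 : 0 < l) (hpos : ∀ x ∈ Ioo 0 l, w x ≠ 0) (h0 : w 0 = 0) (hl : w l = 0) (h10 : w₁ 0 ≠ 0)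
    (h1l : w₁ l ≠ 0) (hv0 : v 0 = 0) (hvl : v l = 0) :
    0 ≤ quadForm W 0 l v ∧
      (quadForm W 0 l v = 0 → ∃ c, ∀ x ∈ Icc 0 l, v x = c * w x) := by
  have key := fun {a b : ℝ} => dirichlet_aux hW hv hw hw₁ hpos h0 hl h10 h1l hv0 hvl
    (a := a) (b := b)
  have hwc : Continuous w := continuous_iff_continuousAt.2 fun x => (hw x).continuousAt
  have hw₁c : Continuous w₁ := continuous_iff_continuousAt.2 fun x => (hw₁ x).continuousAt
  refine ⟨?_, fun hz => ?_⟩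
  -- A degenerate interval makes the left-hand side zero.
  · have := key (a := l / 2) (b := l / 2) (by linarith) le_rfl (by linarith)
    simpa using this
  -- In the case of equality the Picone square vanishes almost everywhere, that is (v / w)' = 0.
  have hconst : ∀ a b, 0 < a → a ≤ b → b < l → v b / w b = v a / w a := by
    intro a b ha hab hb
    have hne : ∀ x ∈ Icc a b, w x ≠ 0 := fun x hx =>
      hpos x ⟨ha.trans_le hx.1, hx.2.trans_lt hb⟩
    have hp := picone hW hv hw hw₁ hab hne
    have hI : ∫ x in a..b, (deriv v x - w₁ x / w x * v x) ^ 2 = 0 :=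
      le_antisymm ((key ha hab hb).trans hz.le)
        (intervalIntegral.integral_nonneg hab fun x _ => sq_nonneg _)
    rw [intervalIntegral.integral_eq_zero_iff_of_nonneg_ae (.of_forall fun x => sq_nonneg _) hp.1,
      Ioc_eq_empty_of_le hab, union_empty] at hI
    have hI' := (ae_restrict_iff' measurableSet_Ioc).1 hI
    have hac : AbsolutelyContinuousOnInterval (v * fun x => (w x)⁻¹) a b := by
      refine (hv.absCont a b).mul (ContDiffOn.absolutelyContinuousOnInterval ?_)
      rw [uIcc_of_le hab]
      exact (IsH1Loc.contDiff_one hw hw₁c).contDiffOn.inv hne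
    have h1 := hac.integral_deriv_eq_sub
    rw [intervalIntegral.integral_congr_ae (g := fun _ => (0 : ℝ))] at h1
    · simp only [intervalIntegral.integral_zero, Pi.mul_apply, ← div_eq_mul_inv] at h1
      linarith
    · filter_upwards [hI', hv.ae_differentiableAt] with x hx hxd hxab
      rw [uIoc_of_le hab] at hxab
      have h2 := hne x (Ioc_subset_Icc_self hxab)
      have h3 : deriv v x - w₁ x / w x * v x = 0 := by simpa using hx hxab
      have h5 : deriv (v * fun x => (w x)⁻¹) x = _ :=
        (hxd.hasDerivAt.mul ((hw x).inv h2)).deriv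
      rw [h5]
      have h4 : deriv v x = w₁ x / w x * v x := by linarith
      rw [h4, Pi.inv_apply]
      field_simp
      ring
  refine ⟨v (l / 2) / w (l / 2), fun x hx => ?_⟩
  rcases hx.1.eq_or_lt with rfl | hx0
  · rw [hv0, h0, mul_zero]
  rcases hx.2.eq_or_lt with rfl | hxl
  · rw [hvl, hl, mul_zero]
  have h5 : v x / w x = v (l / 2) / w (l / 2) := by
    rcases le_total x (l / 2) with h | h
    · exact (hconst x (l / 2) hx0 h (by linarith)).symm
    · exact hconst (l / 2) x (by linarith) h hxl
  rw [← h5, div_mul_cancel₀ _ (hpos x ⟨hx0, hxl⟩)]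

/-! ### Jacobi fields along the orbit -/

/-- The potential of the linearised operator along the orbit. -/
def wgt (q r x : ℝ) : ℝ := orbit q r x ^ (q - 1)

/-- The rate of the phase drift of the Jacobi field `jac`. -/
def tauRate (q r x : ℝ) : ℝ :=
  -(sig q r x * deriv (deriv (kap q)) (sig q r x) / deriv (kap q) (sig q r x))

/-- The phase drift of the Jacobi field `jac`. -/
def tau (q r x : ℝ) : ℝ := ∫ t in (0 : ℝ)..x, tauRate q r t

/-- The Jacobi field that is a multiple of the derivative of the orbit in the amplitude. -/
def jac (q r x : ℝ) : ℝ := sig q r x * deriv (kap q) (sig q r x) + vel q r x * tau q r x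

/-- The derivative of `jac`. -/
def jacVel (q r x : ℝ) : ℝ := vel q r x - force q (orbit q r x) * tau q r x

/-- The infinitesimal generator of the scaling family of the orbit. -/
def scal (q r x : ℝ) : ℝ := orbit q r x + (q - 1) / 2 * x * vel q r x

/-- The derivative of `scal`. -/
def scalVel (q r x : ℝ) : ℝ :=
  (q + 1) / 2 * vel q r x - (q - 1) / 2 * x * force q (orbit q r x)

lemma contDiff_wgt {q r : ℝ} (hq : 1 < q) (hr : r ∈ ampRange q) : ContDiff ℝ ∞ (wgt q r) := by
  rw [contDiff_iff_contDiffAt]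
  intro x
  have h : ContDiffAt ℝ ∞ (fun y : ℝ => y ^ (q - 1)) (orbit q r x) :=
    Real.contDiffAt_rpow_const_of_ne (orbit_pos hr hq x).ne'
  exact h.comp x (contDiff_orbit hq hr).contDiffAt

lemma continuous_wgt {q r : ℝ} (hq : 1 < q) (hr : r ∈ ampRange q) : Continuous (wgt q r) :=
  (contDiff_wgt hq hr).continuous

lemma wgt_pos {q r : ℝ} (hq : 1 < q) (hr : r ∈ ampRange q) (x : ℝ) : 0 < wgt q r x :=
  Real.rpow_pos_of_pos (orbit_pos hr hq x) _

lemma hasDerivAt_force_orbit {q r : ℝ} (hq : 1 < q) (hr : r ∈ ampRange q) (x : ℝ) :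
    HasDerivAt (fun x => force q (orbit q r x)) (wgt q r x * vel q r x) x :=
  (hasDerivAt_force hq (orbit_pos hr hq x)).comp x (hasDerivAt_orbit hq hr x)

lemma continuous_tauRate {q r : ℝ} (hq : 1 < q) (hr : r ∈ ampRange q) :
    Continuous (tauRate q r) := by
  have h1 : Continuous fun x => deriv (kap q) (sig q r x) :=
    (continuousOn_kap' hq).comp_continuous (continuous_sig hq hr) (sig_mem hr)
  have h2 : Continuous fun x => deriv (deriv (kap q)) (sig q r x) :=
    (continuousOn_kap'' hq).comp_continuous (continuous_sig hq hr) (sig_mem hr)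
  exact (((continuous_sig hq hr).mul h2).div h1 fun x => (deriv_kap_pos hq (sig_mem hr x)).ne').neg

lemma hasDerivAt_tau {q r : ℝ} (hq : 1 < q) (hr : r ∈ ampRange q) (x : ℝ) :
    HasDerivAt (tau q r) (tauRate q r x) x :=
  (continuous_tauRate hq hr).integral_hasStrictDerivAt 0 x |>.hasDerivAt

lemma tauRate_periodic {q r : ℝ} (hq : 1 < q) (hr : r ∈ ampRange q) :
    Function.Periodic (tauRate q r) (per q r) := fun x => by
  simp only [tauRate, sig_periodic hq hr x]

lemma tauRate_neg {q r : ℝ} (hq : 1 < q) (hr : r ∈ ampRange q) (x : ℝ) :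
    tauRate q r (-x) = tauRate q r x := by
  simp only [tauRate, sig_neg hq hr x]

/-- The integral of an even periodic function over half a period. -/
lemma integral_half_period {f : ℝ → ℝ} {P : ℝ} (hf : Continuous f) (hP : Function.Periodic f P)
    (he : ∀ x, f (-x) = f x) : ∫ x in (0 : ℝ)..P / 2, f x = (∫ x in (0 : ℝ)..P, f x) / 2 := by
  have hi := fun a b => hf.intervalIntegrable (μ := volume) a b
  have h1 := intervalIntegral.integral_add_adjacent_intervals (hi 0 (P / 2)) (hi (P / 2) P)
  have h2 : ∫ x in P / 2..P, f x = ∫ x in (0 : ℝ)..P / 2, f x := by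
    have h3 := intervalIntegral.integral_comp_sub_left (a := 0) (b := P / 2) f P
    rw [sub_zero, show P - P / 2 = P / 2 by ring] at h3
    rw [← h3]
    refine intervalIntegral.integral_congr fun x _ => ?_
    rw [← he, ← hP (-(P - x))]
    congr 1; ring
  linarith

/-- `jac` is r times the amplitude derivative of the orbit. Differentiating k(x + P(r)) = k(x) in r
shows that it fails to be periodic by -rP' k', and this defect is carried by `tau`. -/
lemma tau_per {q r : ℝ} (hq : 1 < q) (hr : r ∈ ampRange q) :
    tau q r (per q r) = -(r * dper q r) := by
  have hc : Continuous fun t => -(-(r * Real.cos t) * deriv (deriv (kap q)) (-(r * Real.cos t)) /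
      deriv (kap q) (-(r * Real.cos t))) :=
    continuous_comp_cos hr (g := fun σ => -(σ * deriv (deriv (kap q)) σ / deriv (kap q) σ))
      ((continuousOn_id.mul (continuousOn_kap'' hq)).div (continuousOn_kap' hq)
        fun σ hσ => (deriv_kap_pos hq hσ).ne').neg
  have h := integral_phase hq hr hc
  rw [tau]
  simp only [tauRate, sig] at *
  rw [h, dper, ← intervalIntegral.integral_const_mul, ← intervalIntegral.integral_neg]
  refine intervalIntegral.integral_congr fun t _ => ?_
  have := (deriv_kap_pos hq (mul_cos_mem hr t)).ne'
  simp only [speed]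
  field_simp

lemma tau_half {q r : ℝ} (hq : 1 < q) (hr : r ∈ ampRange q) :
    tau q r (per q r / 2) = -(r * dper q r / 2) := by
  rw [tau, integral_half_period (continuous_tauRate hq hr) (tauRate_periodic hq hr)
    (tauRate_neg hq hr), ← tau, tau_per hq hr]
  ring

lemma tau_add {q r : ℝ} (hq : 1 < q) (hr : r ∈ ampRange q) (x : ℝ) :
    tau q r (x + per q r) = tau q r x - r * dper q r := by
  have hi := fun a b => (continuous_tauRate hq hr).intervalIntegrable (μ := volume) a b
  have h1 := (tauRate_periodic hq hr).intervalIntegral_add_eq x 0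
  rw [zero_add, ← tau, tau_per hq hr] at h1
  rw [tau, ← intervalIntegral.integral_add_adjacent_intervals (hi 0 x) (hi _ _), h1, tau]
  ring

lemma tau_zero (q r : ℝ) : tau q r 0 = 0 := by simp [tau]

lemma hasDerivAt_jac {q r : ℝ} (hq : 1 < q) (hr : r ∈ ampRange q) (x : ℝ) :
    HasDerivAt (jac q r) (jacVel q r x) x := by
  have h1 := hasDerivAt_sig hq hr x
  have h2 := (hasDerivAt_kap' hq (sig_mem hr x)).comp x h1
  have h := (h1.mul h2).add ((hasDerivAt_vel hq hr x).mul (hasDerivAt_tau hq hr x))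
  refine HasDerivAt.congr_deriv h ?_
  have h0 := (deriv_kap_pos hq (sig_mem hr x)).ne'
  simp only [jacVel, tauRate, Function.comp_apply]
  field_simp
  ring

lemma hasDerivAt_jacVel {q r : ℝ} (hq : 1 < q) (hr : r ∈ ampRange q) (x : ℝ) :
    HasDerivAt (jacVel q r) (0 - wgt q r x * jac q r x) x := by
  have h := (hasDerivAt_vel hq hr x).sub
    ((hasDerivAt_force_orbit hq hr x).mul (hasDerivAt_tau hq hr x))
  refine HasDerivAt.congr_deriv h ?_
  have h0 := (deriv_kap_pos hq (sig_mem hr x)).ne'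
  have h1 := force_mul_deriv_kap hq (sig_mem hr x)
  have h2 := kap_second_order hq (sig_mem hr x)
  simp only [jac, tauRate, wgt, orbit] at *
  generalize deriv (deriv (kap q)) (sig q r x) = k2 at *
  generalize deriv (kap q) (sig q r x) = k1 at *
  generalize force q (kap q (sig q r x)) = F at *
  generalize kap q (sig q r x) ^ (q - 1) = w at *
  field_simp
  linear_combination (-1) * h1 + sig q r x * h2

lemma hasDerivAt_scal {q r : ℝ} (hq : 1 < q) (hr : r ∈ ampRange q) (x : ℝ) :
    HasDerivAt (scal q r) (scalVel q r x) x := by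
  have h := (hasDerivAt_orbit hq hr x).add
    (((hasDerivAt_id x).const_mul ((q - 1) / 2)).mul (hasDerivAt_vel hq hr x))
  refine HasDerivAt.congr_deriv h ?_
  simp only [scalVel, id]
  ring

lemma orbit_mul_wgt {q r : ℝ} (hq : 1 < q) (hr : r ∈ ampRange q) (x : ℝ) :
    wgt q r x * orbit q r x = q * force q (orbit q r x) + 1 := by
  have h0 := (orbit_pos hr hq x).ne'
  have : q ≠ 0 := by linarith
  rw [wgt, Real.rpow_sub_one h0, force]
  field_simp
  ring

/-- The rescalings λ k(λ^((q-1)/2) x) solve the canonical equation with constant term λ^q/q in place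
of 1/q; differentiating at λ = 1 gives the linearised equation with right-hand side 1. -/
lemma hasDerivAt_scalVel {q r : ℝ} (hq : 1 < q) (hr : r ∈ ampRange q) (x : ℝ) :
    HasDerivAt (scalVel q r) (1 - wgt q r x * scal q r x) x := by
  have h := ((hasDerivAt_vel hq hr x).const_mul ((q + 1) / 2)).sub
    (((hasDerivAt_id x).const_mul ((q - 1) / 2)).mul (hasDerivAt_force_orbit hq hr x))
  refine HasDerivAt.congr_deriv h ?_
  have := orbit_mul_wgt hq hr x
  simp only [scal, id]
  linear_combination this

lemma continuous_jac {q r : ℝ} (hq : 1 < q) (hr : r ∈ ampRange q) : Continuous (jac q r) :=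
  continuous_iff_continuousAt.2 fun x => (hasDerivAt_jac hq hr x).continuousAt

lemma continuous_scal {q r : ℝ} (hq : 1 < q) (hr : r ∈ ampRange q) : Continuous (scal q r) :=
  continuous_iff_continuousAt.2 fun x => (hasDerivAt_scal hq hr x).continuousAt

lemma jacVel_zero {q r : ℝ} (hq : 1 < q) (hr : r ∈ ampRange q) : jacVel q r 0 = 0 := by
  rw [jacVel, vel_zero hq hr, tau_zero]; ring

lemma scalVel_zero {q r : ℝ} (hq : 1 < q) (hr : r ∈ ampRange q) : scalVel q r 0 = 0 := by
  rw [scalVel, vel_zero hq hr]; ring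

/-- Lagrange's identity: the right-hand sides for `jac` and `scal` are 0 and 1, so the derivative of
their Wronskian is `jac` itself. -/
lemma integral_jac {q r : ℝ} (hq : 1 < q) (hr : r ∈ ampRange q) (b : ℝ) :
    ∫ x in (0 : ℝ)..b, jac q r x = jac q r b * scalVel q r b - jacVel q r b * scal q r b := by
  have h := intervalIntegral.integral_eq_sub_of_hasDerivAt (a := 0) (b := b)
    (f := fun x => jac q r x * scalVel q r x - jacVel q r x * scal q r x) (f' := jac q r)
    (fun x _ => ?_) ((continuous_jac hq hr).intervalIntegrable _ _)
  · rw [h, jacVel_zero hq hr, scalVel_zero hq hr]; ring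
  · refine HasDerivAt.congr_deriv (((hasDerivAt_jac hq hr x).mul (hasDerivAt_scalVel hq hr x)).sub
      ((hasDerivAt_jacVel hq hr x).mul (hasDerivAt_scal hq hr x))) ?_
    ring

lemma integral_scal {q r : ℝ} (hq : 1 < q) (hr : r ∈ ampRange q) (b : ℝ) :
    ∫ x in (0 : ℝ)..b, scal q r x =
      (3 - q) / 2 * (∫ x in (0 : ℝ)..b, orbit q r x) + (q - 1) / 2 * (b * orbit q r b) := by
  have hc := continuous_orbit hq hr
  have hv := continuous_vel hq hr
  have h := intervalIntegral.integral_eq_sub_of_hasDerivAt (a := 0) (b := b)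
    (f := fun x => x * orbit q r x) (f' := fun x => orbit q r x + x * vel q r x)
    (fun x _ => ?_) (Continuous.intervalIntegrable (by fun_prop) _ _)
  · have e : ∀ x, scal q r x = (3 - q) / 2 * orbit q r x +
        (q - 1) / 2 * (orbit q r x + x * vel q r x) := fun x => by rw [scal]; ring
    simp only [e]
    rw [intervalIntegral.integral_add (Continuous.intervalIntegrable (by fun_prop) _ _)
      (Continuous.intervalIntegrable (by fun_prop) _ _), intervalIntegral.integral_const_mul,
      intervalIntegral.integral_const_mul, h]
    ring
  · refine HasDerivAt.congr_deriv ((hasDerivAt_id x).mul (hasDerivAt_orbit hq hr x)) ?_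
    simp

/-- Subtracting a solution `ψ` of `ψ'' + W ψ = c` from the argument of the quadratic form. -/
lemma quadForm_sub {W ψ ψ₁ y : ℝ → ℝ} {c : ℝ} (hW : Continuous W) (hy : IsH1Loc y)
    (hψ : ∀ x, HasDerivAt ψ (ψ₁ x) x) (hψ₁ : ∀ x, HasDerivAt ψ₁ (c - W x * ψ x) x) (a b : ℝ) :
    quadForm W a b y = quadForm W a b (fun x => y x - ψ x) +
      2 * (ψ₁ b * y b - ψ₁ a * y a - c * ∫ x in a..b, y x) -
      (ψ₁ b * ψ b - ψ₁ a * ψ a - c * ∫ x in a..b, ψ x) := by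
  have hψc : Continuous ψ := continuous_iff_continuousAt.2 fun x => (hψ x).continuousAt
  have hψ₁c : Continuous ψ₁ := continuous_iff_continuousAt.2 fun x => (hψ₁ x).continuousAt
  have hyc := hy.continuous
  have hψ₁s : ContDiff ℝ 1 ψ₁ := IsH1Loc.contDiff_one hψ₁ (by fun_prop)
  have hψs : ContDiff ℝ 1 ψ := IsH1Loc.contDiff_one hψ hψ₁c
  have hg : ∀ g : ℝ → ℝ, IsH1Loc g → ∫ x in a..b, (ψ₁ x * deriv g x - W x * ψ x * g x) =
      ψ₁ b * g b - ψ₁ a * g a - c * ∫ x in a..b, g x := fun g hg => by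
    have hgc := hg.continuous
    have h1 := AbsolutelyContinuousOnInterval.integral_mul_deriv_eq_deriv_mul
      ((IsH1Loc.of_contDiff hψ₁s).absCont a b) (hg.absCont a b)
    have i1 := (hg.intervalIntegrable_deriv a b).continuousOn_mul hψ₁c.continuousOn
    rw [intervalIntegral.integral_sub i1 (Continuous.intervalIntegrable (by fun_prop) _ _), h1,
      ← intervalIntegral.integral_const_mul, sub_sub, ← intervalIntegral.integral_add]
    · congr 1
      refine intervalIntegral.integral_congr fun x _ => ?_
      simp only [(hψ₁ x).deriv]
      ring
    · refine Continuous.intervalIntegrable ?_ _ _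
      rw [funext fun x => (hψ₁ x).deriv]
      fun_prop
    · exact Continuous.intervalIntegrable (by fun_prop) _ _
  rw [← hg y hy, ← hg ψ (IsH1Loc.of_contDiff hψs)]
  have hI : ∀ g : ℝ → ℝ, IsH1Loc g →
      IntervalIntegrable (fun x => ψ₁ x * deriv g x - W x * ψ x * g x) volume a b := fun g hg =>
    ((hg.intervalIntegrable_deriv a b).continuousOn_mul hψ₁c.continuousOn).sub
      (((hW.mul hψc).mul hg.continuous).intervalIntegrable a b)
  have i1 := (hy.sub_smooth hψ hψ₁c).integrable_quad hW a b
  have i2 := hI y hy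
  have i3 := hI ψ (IsH1Loc.of_contDiff hψs)
  rw [quadForm, quadForm, ← intervalIntegral.integral_const_mul,
    ← intervalIntegral.integral_add i1 (i2.const_mul 2),
    ← intervalIntegral.integral_sub (i1.add (i2.const_mul 2)) i3]
  refine intervalIntegral.integral_congr_ae ?_
  filter_upwards [hy.ae_deriv_sub hψ] with x hx _
  rw [hx, (hψ x).deriv]
  ring

/-! ### The stable case -/

/-- The zeros of k' at 0 and P/2 are simple, as `dirichlet_form` requires. -/
lemma vel_half_slope {q r : ℝ} (hq : 1 < q) (hr : r ∈ ampRange q) (hr0 : 0 < r) :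
    -force q (orbit q r 0) ≠ 0 ∧ -force q (orbit q r (per q r / 2)) ≠ 0 := by
  have h1 : ∀ x, sig q r x ≠ 0 → -force q (orbit q r x) ≠ 0 := fun x hx h => by
    have := force_mul_deriv_kap hq (sig_mem hr x)
    rw [orbit, neg_eq_zero] at h
    rw [h, zero_mul] at this
    exact hx (by linarith)
  refine ⟨h1 _ ?_, h1 _ ?_⟩
  · rw [sig_zero hq hr]; exact neg_ne_zero.2 hr0.ne'
  · rw [sig_half hq hr]; exact hr0.ne'

/-- At 0 and P/2, where k' vanishes, `jac` takes opposite signs and `scal` equals k > 0, so the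
determinant of the interpolation problem is negative. -/
lemma exists_coeff {q r : ℝ} (hq : 1 < q) (hr : r ∈ ampRange q) (hr0 : 0 < r) (s t : ℝ) :
    ∃ c₁ c₂, s = c₁ * jac q r 0 + c₂ * scal q r 0 ∧
      t = c₁ * jac q r (per q r / 2) + c₂ * scal q r (per q r / 2) := by
  have hd : jac q r 0 * scal q r (per q r / 2) - jac q r (per q r / 2) * scal q r 0 < 0 := by
    have h1 := deriv_kap_pos hq hr
    have h2 := deriv_kap_pos hq (neg_mem_ampRange hr)
    have h3 := orbit_pos hr hq 0
    have h4 := orbit_pos hr hq (per q r / 2)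
    simp only [jac, scal, vel_zero hq hr, vel_half hq hr, sig_zero hq hr, sig_half hq hr]
    have h5 : 0 < r * deriv (kap q) (-r) * orbit q r (per q r / 2) := by positivity
    have h6 : 0 < r * deriv (kap q) r * orbit q r 0 := by positivity
    linarith
  refine ⟨(s * scal q r (per q r / 2) - t * scal q r 0) /
    (jac q r 0 * scal q r (per q r / 2) - jac q r (per q r / 2) * scal q r 0),
    (t * jac q r 0 - s * jac q r (per q r / 2)) /
    (jac q r 0 * scal q r (per q r / 2) - jac q r (per q r / 2) * scal q r 0), ?_, ?_⟩
  · rw [div_mul_eq_mul_div, div_mul_eq_mul_div, ← add_div, eq_div_iff hd.ne]; ring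
  · rw [div_mul_eq_mul_div, div_mul_eq_mul_div, ← add_div, eq_div_iff hd.ne]; ring

/-- The boundary contribution to the quadratic form on a half period. -/
def bdryForm (q r c₁ c₂ : ℝ) : ℝ :=
  r ^ 3 * dper q r * c₁ ^ 2 - (q - 1) * per q r * r ^ 2 * c₁ * c₂ +
    ((3 - q) / 4 * are q r + (q - 1) / 4 * per q r * (1 - (q + 1) * r ^ 2)) * c₂ ^ 2

/-- Completing the square: 4r³P' times the form is a square plus r³ · dbifAmp · c₂². Here the slope
of the bifurcation function enters the stability question. -/
lemma bdryForm_nonneg {q r : ℝ} (hq : 1 < q) (hr : r ∈ ampRange q) (hr0 : 0 < r)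
    (hb : 0 < dbifAmp q r) (c₁ c₂ : ℝ) :
    0 ≤ bdryForm q r c₁ c₂ ∧ (bdryForm q r c₁ c₂ = 0 → c₁ = 0 ∧ c₂ = 0) := by
  have hD := dper_pos hq hr hr0
  have key : 4 * (r ^ 3 * dper q r) * bdryForm q r c₁ c₂ =
      (2 * (r ^ 3 * dper q r) * c₁ - (q - 1) * per q r * r ^ 2 * c₂) ^ 2 +
        r ^ 3 * dbifAmp q r * c₂ ^ 2 := by
    rw [bdryForm, dbifAmp, dare]; ring
  have ha : 0 < 4 * (r ^ 3 * dper q r) := by positivity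
  have h2 : 0 ≤ r ^ 3 * dbifAmp q r * c₂ ^ 2 := by positivity
  constructor
  · refine nonneg_of_mul_nonneg_right ?_ ha
    rw [key]
    positivity
  · intro h0
    rw [h0, mul_zero] at key
    have h3 : r ^ 3 * dbifAmp q r * c₂ ^ 2 = 0 := by
      have := sq_nonneg (2 * (r ^ 3 * dper q r) * c₁ - (q - 1) * per q r * r ^ 2 * c₂)
      linarith
    have h4 : c₂ = 0 := by
      have : r ^ 3 * dbifAmp q r ≠ 0 := by positivity
      simpa [this] using h3
    subst h4
    refine ⟨?_, rfl⟩
    have h5 : (2 * (r ^ 3 * dper q r) * c₁) ^ 2 = 0 := by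
      simpa using key.symm
    have h6 : 2 * (r ^ 3 * dper q r) ≠ 0 := by positivity
    rw [sq_eq_zero_iff] at h5
    exact (mul_eq_zero.1 h5).resolve_left h6

/-- `quadForm_sub` with ψ = c₁ jac + c₂ scal. As ψ' vanishes at 0, only the value of y at P/2 has to
be matched; the explicit integrals of `jac` and `scal` then collect into `bdryForm`. -/
lemma quadForm_half {q r : ℝ} (hq : 1 < q) (hr : r ∈ ampRange q) {y : ℝ → ℝ} (hy : IsH1Loc y)
    {c₁ c₂ : ℝ} (hl : y (per q r / 2) = c₁ * jac q r (per q r / 2) + c₂ * scal q r (per q r / 2)) :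
    quadForm (wgt q r) 0 (per q r / 2) y =
      quadForm (wgt q r) 0 (per q r / 2) (fun x => y x - (c₁ * jac q r x + c₂ * scal q r x)) -
      2 * c₂ * (∫ x in (0 : ℝ)..per q r / 2, y x) + bdryForm q r c₁ c₂ := by
  have hψ : ∀ x, HasDerivAt (fun x => c₁ * jac q r x + c₂ * scal q r x)
      (c₁ * jacVel q r x + c₂ * scalVel q r x) x := fun x =>
    ((hasDerivAt_jac hq hr x).const_mul c₁).add ((hasDerivAt_scal hq hr x).const_mul c₂)
  have hψ₁ : ∀ x, HasDerivAt (fun x => c₁ * jacVel q r x + c₂ * scalVel q r x)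
      (c₂ - wgt q r x * (c₁ * jac q r x + c₂ * scal q r x)) x := fun x => by
    refine HasDerivAt.congr_deriv (((hasDerivAt_jacVel hq hr x).const_mul c₁).add
      ((hasDerivAt_scalVel hq hr x).const_mul c₂)) ?_
    ring
  rw [quadForm_sub (continuous_wgt hq hr) hy hψ hψ₁ 0 (per q r / 2),
    intervalIntegral.integral_add
      (((continuous_jac hq hr).const_mul c₁).intervalIntegrable _ _)
      (((continuous_scal hq hr).const_mul c₂).intervalIntegrable _ _),
    intervalIntegral.integral_const_mul, intervalIntegral.integral_const_mul, integral_jac hq hr,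
    integral_scal hq hr, integral_half_period (continuous_orbit hq hr) (orbit_periodic hq hr)
    (orbit_neg hq hr), ← are, jacVel_zero hq hr, scalVel_zero hq hr, hl]
  have h1 := force_mul_deriv_kap hq hr
  have h2 := mul_force hq (kap_pos hq hr)
  rw [pot_kap hq hr] at h2
  simp only [bdryForm, jac, jacVel, scal, scalVel, vel_half hq hr, sig_half hq hr, tau_half hq hr,
    orbit]
  generalize deriv (kap q) r = k1 at *
  generalize force q (kap q r) = F at *
  generalize kap q r = k at *
  generalize per q r = P at *
  generalize dper q r = D at *
  generalize are q r = A at *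
  linear_combination (c₁ ^ 2 * r ^ 2 * D / 2 - c₁ * c₂ * (q - 1) * P * r / 2) * h1 +
    ((q - 1) / 4 * P * c₂ ^ 2) * h2

lemma wgt_reflect {q r : ℝ} (hq : 1 < q) (hr : r ∈ ampRange q) (x : ℝ) :
    wgt q r (per q r - x) = wgt q r x := by
  rw [wgt, ← orbit_neg hq hr, neg_sub, ← orbit_periodic hq hr, sub_add_cancel, wgt]

/-- The second variation is nonnegative on functions of mean zero, and its null vectors are the
multiples of the derivative of the orbit. -/
lemma stable_form {q r : ℝ} (hq : 1 < q) (hr : r ∈ ampRange q) (hr0 : 0 < r)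
    (hb : 0 < dbifAmp q r) {y : ℝ → ℝ} (hy : IsH1Loc y) (hp : Function.Periodic y (per q r))
    (hm : ∫ x in (0 : ℝ)..per q r, y x = 0) :
    0 ≤ quadForm (wgt q r) 0 (per q r) y ∧
      (quadForm (wgt q r) 0 (per q r) y = 0 → ∃ c, ∀ x, y x = c * vel q r x) := by
  set P := per q r with hP
  have hP0 : 0 < P := per_pos hq hr
  -- Reflection about P/2 moves the second half period onto the first. By periodicity y and its
  -- reflection agree at 0 and P/2, so the same c₁, c₂ serve for both.
  set y' := fun x => y (P + -1 * x) with hy'def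
  have hy' : IsH1Loc y' := hy.comp_affine (by norm_num) P
  obtain ⟨c₁, c₂, e0, el⟩ := exists_coeff hq hr hr0 (y 0) (y (P / 2))
  rw [← hP] at el
  have e0' : y' 0 = c₁ * jac q r 0 + c₂ * scal q r 0 := by
    rw [← e0, hy'def]
    simpa using hp 0
  have el' : y' (P / 2) = c₁ * jac q r (P / 2) + c₂ * scal q r (P / 2) := by
    rw [← el, hy'def]
    simp only
    congr 1; ring
  have hjs : ∀ x, HasDerivAt (fun x => c₁ * jac q r x + c₂ * scal q r x)
      (c₁ * jacVel q r x + c₂ * scalVel q r x) x := fun x =>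
    ((hasDerivAt_jac hq hr x).const_mul c₁).add ((hasDerivAt_scal hq hr x).const_mul c₂)
  have hjc : Continuous fun x => c₁ * jacVel q r x + c₂ * scalVel q r x :=
    ((continuous_iff_continuousAt.2 fun x => (hasDerivAt_jacVel hq hr x).continuousAt).const_mul
      c₁).add ((continuous_iff_continuousAt.2 fun x =>
      (hasDerivAt_scalVel hq hr x).continuousAt).const_mul c₂)
  have hdir := fun (v : ℝ → ℝ) (hv : IsH1Loc v) (h0 : v 0 = 0) (h1 : v (P / 2) = 0) =>
    dirichlet_form (continuous_wgt hq hr) hv (hasDerivAt_vel hq hr)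
        (w₁ := fun x => -force q (orbit q r x)) (l := P / 2)
      (fun x => by
        refine HasDerivAt.congr_deriv (hasDerivAt_force_orbit hq hr x).neg rfl) (by linarith)
      (fun x hx => (vel_pos hq hr hr0 hx.1 hx.2).ne') (vel_zero hq hr) (vel_half hq hr)
      (vel_half_slope hq hr hr0).1 (vel_half_slope hq hr hr0).2 h0 h1
  have d1 := hdir _ (hy.sub_smooth hjs hjc) (by linarith) (by linarith)
  have d2 := hdir _ (hy'.sub_smooth hjs hjc) (by linarith) (by linarith)
  have q1 := quadForm_half hq hr hy el
  have q2 := quadForm_half hq hr hy' el'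
  rw [← hP] at q1 q2
  have hi := fun a b => hy.continuous.intervalIntegrable (μ := volume) a b
  -- The mean-zero constraint enters here: it cancels the terms linear in c₂ coming from the two
  -- halves.
  have hmean : (∫ x in (0 : ℝ)..P / 2, y x) + ∫ x in (0 : ℝ)..P / 2, y' x = 0 := by
    have h3 := intervalIntegral.integral_comp_sub_left (a := 0) (b := P / 2) y P
    rw [sub_zero, show P - P / 2 = P / 2 by ring] at h3
    have h4 : ∀ x, y' x = y (P - x) := fun x => by rw [hy'def]; simp only; congr 1; ring
    simp only [h4]
    rw [h3, intervalIntegral.integral_add_adjacent_intervals (hi _ _) (hi _ _), hm]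
  have hsplit : quadForm (wgt q r) 0 P y = quadForm (wgt q r) 0 (P / 2) y +
      quadForm (wgt q r) 0 (P / 2) y' := by
    have hq' := hy.integrable_quad (continuous_wgt hq hr)
    have h3 := intervalIntegral.integral_comp_sub_left (a := 0) (b := P / 2)
      (fun x => deriv y x ^ 2 - wgt q r x * y x ^ 2) P
    rw [sub_zero, show P - P / 2 = P / 2 by ring] at h3
    rw [quadForm, ← intervalIntegral.integral_add_adjacent_intervals (hq' 0 (P / 2)) (hq' _ _),
      ← h3, quadForm, quadForm]
    congr 1
    refine intervalIntegral.integral_congr fun x _ => ?_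
    have hd : deriv y' x = -deriv y (P - x) := by
      rw [hy'def, deriv_comp_mul_left (-1 : ℝ) (fun z => y (P + z)), deriv_comp_const_add]
      simp [sub_eq_add_neg]
    have h4 : y' x = y (P - x) := by rw [hy'def]; simp only; congr 1; ring
    simp only [hd, h4, hP, wgt_reflect hq hr]
    ring
  have hF := bdryForm_nonneg hq hr hr0 hb c₁ c₂
  have htot : quadForm (wgt q r) 0 P y =
      quadForm (wgt q r) 0 (P / 2) (fun x => y x - (c₁ * jac q r x + c₂ * scal q r x)) +
      quadForm (wgt q r) 0 (P / 2) (fun x => y' x - (c₁ * jac q r x + c₂ * scal q r x)) +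
      2 * bdryForm q r c₁ c₂ := by
    rw [hsplit, q1, q2]
    linear_combination (-2 * c₂) * hmean
  refine ⟨by linarith [hF.1, d1.1, d2.1], fun hz => ?_⟩
  have z0 : bdryForm q r c₁ c₂ = 0 := by linarith [hF.1, d1.1, d2.1]
  obtain ⟨r1, r2⟩ := hF.2 z0
  subst r1 r2
  simp only [zero_mul, add_zero, sub_zero] at d1 d2 htot
  obtain ⟨c, hc⟩ := d1.2 (by linarith [hF.1, d1.1, d2.1])
  obtain ⟨d, hd⟩ := d2.2 (by linarith [hF.1, d1.1, d2.1])
  have hvi : 0 < ∫ x in (0 : ℝ)..P / 2, vel q r x :=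
    intervalIntegral.intervalIntegral_pos_of_pos_on
      ((continuous_vel hq hr).intervalIntegrable _ _)
      (fun x hx => vel_pos hq hr hr0 hx.1 hx.2) (by linarith)
  -- On each half a null vector is a multiple of k'. The zero mean forces opposite multiples, which
  -- fit together since k' is odd about P/2.
  have hcd : d = -c := by
    have i1 : ∫ x in (0 : ℝ)..P / 2, y x = c * ∫ x in (0 : ℝ)..P / 2, vel q r x := by
      rw [← intervalIntegral.integral_const_mul]
      refine intervalIntegral.integral_congr fun x hx => hc x ?_
      rwa [uIcc_of_le (by linarith)] at hx
    have i2 : ∫ x in (0 : ℝ)..P / 2, y' x = d * ∫ x in (0 : ℝ)..P / 2, vel q r x := by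
      rw [← intervalIntegral.integral_const_mul]
      refine intervalIntegral.integral_congr fun x hx => hd x ?_
      rwa [uIcc_of_le (by linarith)] at hx
    rw [i1, i2, ← add_mul] at hmean
    have := (mul_eq_zero.1 hmean).resolve_right hvi.ne'
    linarith
  have hfull : ∀ x ∈ Ico 0 P, y x = c * vel q r x := by
    intro x hx
    rcases le_total x (P / 2) with h | h
    · exact hc x ⟨hx.1, h⟩
    · have h1 := hd (P - x) ⟨by linarith [hx.2], by linarith⟩
      have h2 : y' (P - x) = y x := by rw [hy'def]; simp only; congr 1; ring
      rw [h2, hcd] at h1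
      rw [h1, show P - x = -(x - P) by ring, vel_neg hq hr, ← vel_periodic hq hr (x - P), ← hP,
        sub_add_cancel]
      ring
  refine ⟨c, fun x => ?_⟩
  have hper : Function.Periodic (fun x => y x - c * vel q r x) P := fun x => by
    have h1 := vel_periodic hq hr x
    rw [← hP] at h1
    simp only [hp x, h1]
  obtain ⟨z, hz, hxz⟩ := hper.exists_mem_Ico₀ hP0 x
  have := hfull z hz
  linarith

/-! ### The unstable case -/

/-- The periodic solution of the linearised equation with constant right-hand side. -/
def nullDir (q r x : ℝ) : ℝ :=
  r * dper q r / 2 * scal q r x + (q - 1) / 4 * per q r * jac q r x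

/-- The derivative of `nullDir`. -/
def nullDirVel (q r x : ℝ) : ℝ :=
  r * dper q r / 2 * scalVel q r x + (q - 1) / 4 * per q r * jacVel q r x

lemma hasDerivAt_nullDir {q r : ℝ} (hq : 1 < q) (hr : r ∈ ampRange q) (x : ℝ) :
    HasDerivAt (nullDir q r) (nullDirVel q r x) x :=
  ((hasDerivAt_scal hq hr x).const_mul _).add ((hasDerivAt_jac hq hr x).const_mul _)

lemma hasDerivAt_nullDirVel {q r : ℝ} (hq : 1 < q) (hr : r ∈ ampRange q) (x : ℝ) :
    HasDerivAt (nullDirVel q r) (r * dper q r / 2 - wgt q r x * nullDir q r x) x := by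
  refine HasDerivAt.congr_deriv (((hasDerivAt_scalVel hq hr x).const_mul _).add
    ((hasDerivAt_jacVel hq hr x).const_mul _)) ?_
  rw [nullDir]; ring

/-- Over a period `scal` gains (q-1)/2 · P k' and `jac` gains -rP' k'; the coefficients are chosen
so that these cancel. -/
lemma nullDir_periodic {q r : ℝ} (hq : 1 < q) (hr : r ∈ ampRange q) :
    Function.Periodic (nullDir q r) (per q r) := fun x => by
  simp only [nullDir, scal, jac, orbit_periodic hq hr x, vel_periodic hq hr x,
    sig_periodic hq hr x, tau_add hq hr x]
  ring

lemma nullDirVel_periodic {q r : ℝ} (hq : 1 < q) (hr : r ∈ ampRange q) :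
    Function.Periodic (nullDirVel q r) (per q r) := by
  have := deriv_periodic (nullDir_periodic hq hr)
  rwa [funext fun x => (hasDerivAt_nullDir hq hr x).deriv] at this

lemma contDiff_nullDir {q r : ℝ} (hq : 1 < q) (hr : r ∈ ampRange q) :
    ContDiff ℝ ∞ (nullDir q r) := by
  have hz : deriv (nullDir q r) = nullDirVel q r :=
    funext fun x => (hasDerivAt_nullDir hq hr x).deriv
  have hz' : deriv (nullDirVel q r) = fun x => r * dper q r / 2 - wgt q r x * nullDir q r x :=
    funext fun x => (hasDerivAt_nullDirVel hq hr x).deriv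
  have hd : Differentiable ℝ (nullDir q r) := fun x => (hasDerivAt_nullDir hq hr x).differentiableAt
  have hd' : Differentiable ℝ (nullDirVel q r) := fun x =>
    (hasDerivAt_nullDirVel hq hr x).differentiableAt
  have key : ∀ n : ℕ, ContDiff ℝ n (nullDir q r) ∧ ContDiff ℝ n (nullDirVel q r) := by
    intro n
    induction n with
    | zero => exact ⟨contDiff_zero.2 hd.continuous, contDiff_zero.2 hd'.continuous⟩
    | succ n ih =>
      push_cast
      rw [contDiff_succ_iff_deriv, contDiff_succ_iff_deriv, hz, hz']
      exact ⟨⟨hd, by simp, ih.2⟩, hd', by simp,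
        contDiff_const.sub ((contDiff_infty.1 (contDiff_wgt hq hr) n).mul ih.1)⟩
  exact contDiff_infty.2 fun n => (key n).1

/-- The link between the bifurcation function and instability: for r > 0 the periodic solution of
z'' + W z = rP'/2 has negative mean exactly when `dbifAmp` is negative. -/
lemma integral_nullDir {q r : ℝ} (hq : 1 < q) (hr : r ∈ ampRange q) :
    ∫ x in (0 : ℝ)..per q r, nullDir q r x = r / 4 * dbifAmp q r := by
  have hvP : vel q r (per q r) = 0 := by
    have := vel_periodic hq hr 0
    rwa [zero_add, vel_zero hq hr] at this
  have hsP : sig q r (per q r) = -r := by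
    have := sig_periodic hq hr 0
    rwa [zero_add, sig_zero hq hr] at this
  simp only [nullDir]
  rw [intervalIntegral.integral_add
      (((continuous_scal hq hr).const_mul _).intervalIntegrable _ _)
      (((continuous_jac hq hr).const_mul _).intervalIntegrable _ _),
    intervalIntegral.integral_const_mul, intervalIntegral.integral_const_mul, integral_jac hq hr,
    integral_scal hq hr, ← are]
  have h1 := force_mul_deriv_kap hq (neg_mem_ampRange hr)
  have h2 := mul_force hq (kap_pos hq (neg_mem_ampRange hr))
  rw [pot_kap hq (neg_mem_ampRange hr)] at h2
  simp only [dbifAmp, dare, jac, jacVel, scal, scalVel, hvP, hsP, tau_per hq hr, orbit]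
  generalize deriv (kap q) (-r) = k1 at *
  generalize force q (kap q (-r)) = F at *
  generalize kap q (-r) = k at *
  generalize per q r = P at *
  generalize dper q r = D at *
  generalize are q r = A at *
  linear_combination ((q - 1) ^ 2 / 8 * P ^ 2 * r) * h1 + ((q - 1) / 4 * P * r * D) * h2

/-- A smooth direction of mean zero in which the second variation is negative. -/
lemma unstable_form {q r : ℝ} (hq : 1 < q) (hr : r ∈ ampRange q) (hr0 : 0 < r)
    (hb : dbifAmp q r < 0) : ∃ y : ℝ → ℝ, ContDiff ℝ ∞ y ∧ Function.Periodic y (per q r) ∧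
      ∫ x in (0 : ℝ)..per q r, y x = 0 ∧ quadForm (wgt q r) 0 (per q r) y < 0 := by
  have hD := dper_pos hq hr hr0
  have hP := per_pos hq hr
  have hI : ∫ x in (0 : ℝ)..per q r, nullDir q r x < 0 := by
    rw [integral_nullDir hq hr]
    exact mul_neg_of_pos_of_neg (by positivity) hb
  set I := ∫ x in (0 : ℝ)..per q r, nullDir q r x with hIdef
  -- This makes 1 - s z have mean zero. Removing -s z by `quadForm_sub` then leaves -∫ W + s²
  -- (rP'/2) I, where I < 0.
  set s := per q r / I with hs
  have hzc := (contDiff_nullDir hq hr).continuous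
  have hint : ∫ x in (0 : ℝ)..per q r, (1 - s * nullDir q r x) = 0 := by
    rw [intervalIntegral.integral_sub intervalIntegrable_const
      ((hzc.const_mul s).intervalIntegrable _ _), intervalIntegral.integral_const_mul, ← hIdef, hs]
    have := hI.ne
    simp
    field_simp
    ring
  have hy : ContDiff ℝ ∞ fun x => 1 - s * nullDir q r x :=
    contDiff_const.sub (contDiff_const.mul (contDiff_nullDir hq hr))
  refine ⟨fun x => 1 - s * nullDir q r x, hy, fun x => by
    simp only [nullDir_periodic hq hr x], hint, ?_⟩
  have hψ : ∀ x, HasDerivAt (fun x => -s * nullDir q r x) (-s * nullDirVel q r x) x := fun x =>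
    (hasDerivAt_nullDir hq hr x).const_mul _
  have hψ₁ : ∀ x, HasDerivAt (fun x => -s * nullDirVel q r x)
      (-s * (r * dper q r / 2) - wgt q r x * (-s * nullDir q r x)) x := fun x => by
    refine HasDerivAt.congr_deriv ((hasDerivAt_nullDirVel hq hr x).const_mul (-s)) ?_
    ring
  have hq1 := quadForm_sub (continuous_wgt hq hr)
    (IsH1Loc.of_contDiff (contDiff_infty.1 hy 1)) hψ hψ₁ 0 (per q r)
  have p0 := nullDir_periodic hq hr 0
  have p1 := nullDirVel_periodic hq hr 0
  rw [zero_add] at p0 p1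
  have hone : quadForm (wgt q r) 0 (per q r) (fun x => 1 - s * nullDir q r x - -s * nullDir q r x)
      = -∫ x in (0 : ℝ)..per q r, wgt q r x := by
    rw [quadForm, ← intervalIntegral.integral_neg]
    refine intervalIntegral.integral_congr fun x _ => ?_
    have : (fun x => 1 - s * nullDir q r x - -s * nullDir q r x) = fun _ => 1 := by
      funext x; ring
    simp only [this]
    simp
  have hW : 0 < ∫ x in (0 : ℝ)..per q r, wgt q r x :=
    intervalIntegral.intervalIntegral_pos_of_pos
      ((continuous_wgt hq hr).intervalIntegrable _ _) (wgt_pos hq hr) hP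
  rw [hq1, hone, p0, p1, hint, intervalIntegral.integral_const_mul, ← hIdef]
  have : s ^ 2 * (r * dper q r / 2) * I ≤ 0 :=
    mul_nonpos_of_nonneg_of_nonpos (by positivity) hI.le
  linarith

/-! ### The energy density -/

/-- The energy density with `H'' = B y ^ (q - 1)` and vanishing affine part. -/
def dens (q B y : ℝ) : ℝ := B / (q * (q + 1)) * y ^ (q + 1)

/-- The second order Taylor remainder of `dens`. -/
def densRem (q B y d : ℝ) : ℝ :=
  dens q B (y + d) - dens q B y - B / q * y ^ q * d - B / 2 * y ^ (q - 1) * d ^ 2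

lemma hasDerivAt_dens {q B y : ℝ} (hq : 1 < q) (hy : 0 < y) :
    HasDerivAt (dens q B) (B / q * y ^ q) y := by
  have h := (Real.hasDerivAt_rpow_const (x := y) (p := q + 1) (Or.inl hy.ne')).const_mul
    (B / (q * (q + 1)))
  refine HasDerivAt.congr_deriv h ?_
  have : q + 1 ≠ 0 := by linarith
  rw [add_sub_cancel_right]
  field_simp

lemma hasDerivAt_dens' {q B y : ℝ} (hq : 1 < q) (hy : 0 < y) :
    HasDerivAt (fun y => B / q * y ^ q) (B * y ^ (q - 1)) y := by
  have h := (Real.hasDerivAt_rpow_const (x := y) (p := q) (Or.inl hy.ne')).const_mul (B / q)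
  refine HasDerivAt.congr_deriv h ?_
  have : q ≠ 0 := by linarith
  field_simp

lemma hasDerivAt_dens_add {q B y d : ℝ} (hq : 1 < q) (hd : 0 < y + d) :
    HasDerivAt (fun d => dens q B (y + d)) (B / q * (y + d) ^ q) d := by
  simpa using (hasDerivAt_dens hq hd).comp_const_add y d

lemma hasDerivAt_dens'_add {q B y d : ℝ} (hq : 1 < q) (hd : 0 < y + d) :
    HasDerivAt (fun d => B / q * (y + d) ^ q) (B * (y + d) ^ (q - 1)) d := by
  simpa using (hasDerivAt_dens' hq hd).comp_const_add y d

/-- On the positive half-line an energy density agrees with `dens` up to an affine function. -/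
lemma IsEnergyDensity.eq_dens {m n q B : ℝ} (hqmn : q = m - n + 1) (hq : 1 < q) {H : ℝ → ℝ}
    (hH : IsEnergyDensity (fun y => y ^ n) (fun y => B * y ^ m) H) :
    ∃ c₁ c₀, ∀ y, 0 < y → H y = dens q B y + c₁ * y + c₀ := by
  have h2 : ∀ y, 0 < y → HasDerivAt (deriv H) (B * y ^ (q - 1)) y := fun y hy => by
    refine (hH y hy).2.congr_deriv ?_
    rw [mul_div_assoc, ← Real.rpow_sub hy, show m - n = q - 1 by linarith]
  have hc : ∀ g : ℝ → ℝ, (∀ y, 0 < y → HasDerivAt g 0 y) → ∀ y, 0 < y → g y = g 1 := by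
    intro g hg y hy
    exact isOpen_Ioi.is_const_of_deriv_eq_zero isPreconnected_Ioi
      (fun z hz => (hg z hz).differentiableAt.differentiableWithinAt)
      (fun z hz => (hg z hz).deriv) hy (one_pos : (0 : ℝ) < 1)
  have e1 := hc (fun y => deriv H y - B / q * y ^ q) fun y hy => by
    exact HasDerivAt.congr_deriv ((h2 y hy).sub (hasDerivAt_dens' hq hy)) (sub_self _)
  set c₁ := deriv H 1 - B / q * 1 ^ q with hc₁
  have e2 := hc (fun y => H y - (dens q B y + c₁ * y)) fun y hy => by
    have h3 := (hH y hy).1.hasDerivAt.sub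
      ((hasDerivAt_dens (B := B) hq hy).add ((hasDerivAt_id y).const_mul c₁))
    refine HasDerivAt.congr_deriv h3 ?_
    have := e1 y hy
    simp only [mul_one] at *
    linarith
  refine ⟨c₁, H 1 - (dens q B 1 + c₁ * 1), fun y hy => ?_⟩
  have := e2 y hy
  linarith

/-- Subadditivity of t^p for exponents between 0 and 1. -/
lemma abs_rpow_sub_rpow_le {p x y : ℝ} (hp : 0 ≤ p) (hp1 : p ≤ 1) (hx : 0 < x) (hy : 0 < y) :
    |x ^ p - y ^ p| ≤ |x - y| ^ p := by
  wlog h : y ≤ x generalizing x y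
  · rw [abs_sub_comm, abs_sub_comm x]
    exact this hy hx (by linarith)
  have h1 := Real.rpow_add_le_add_rpow (sub_nonneg.2 h) hy.le hp hp1
  rw [sub_add_cancel] at h1
  have h2 := Real.rpow_le_rpow hy.le h hp
  rw [abs_of_nonneg (by linarith), abs_of_nonneg (by linarith)]
  linarith

/-- The Taylor remainder is of order `q + 1 > 2`. -/
lemma abs_densRem_le {q B y d : ℝ} (hq : 1 < q) (hq2 : q < 2) (hB : 0 < B) (hy : 0 < y)
    (hd : 0 < y + d) : |densRem q B y d| ≤ B * |d| ^ (q + 1) := by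
  have hpos : ∀ e ∈ uIcc 0 d, 0 < y + e ∧ |e| ≤ |d| := fun e he => by
    rcases le_total 0 d with h | h
    · rw [uIcc_of_le h] at he
      exact ⟨by linarith [he.1], by rw [abs_of_nonneg he.1, abs_of_nonneg h]; exact he.2⟩
    · rw [uIcc_of_ge h] at he
      exact ⟨by linarith [he.1], by rw [abs_of_nonpos he.2, abs_of_nonpos h]; linarith [he.1]⟩
  have hd1 : ∀ e ∈ uIcc 0 d, HasDerivAt
      (fun e => B / q * (y + e) ^ q - B / q * y ^ q - B * y ^ (q - 1) * e)
      (B * (y + e) ^ (q - 1) - B * y ^ (q - 1)) e := fun e he => by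
    refine HasDerivAt.congr_deriv (((hasDerivAt_dens'_add hq (hpos e he).1).sub_const
      (B / q * y ^ q)).sub ((hasDerivAt_id e).const_mul (B * y ^ (q - 1)))) (by simp)
  have hd0 : ∀ e ∈ uIcc 0 d, HasDerivAt (densRem q B y)
      (B / q * (y + e) ^ q - B / q * y ^ q - B * y ^ (q - 1) * e) e := fun e he => by
    refine HasDerivAt.congr_deriv ((((hasDerivAt_dens_add hq (hpos e he).1).sub_const
      (dens q B y)).sub ((hasDerivAt_id e).const_mul (B / q * y ^ q))).sub
      (((hasDerivAt_id e).pow 2).const_mul (B / 2 * y ^ (q - 1)))) ?_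
    simp
    ring
  -- The second derivative of the density is Hölder continuous with exponent q - 1, as q < 2. The
  -- mean value inequality is applied here to the derivative of the remainder and then once more to
  -- the remainder.
  have b1 : ∀ e ∈ uIcc 0 d,
      ‖B / q * (y + e) ^ q - B / q * y ^ q - B * y ^ (q - 1) * e‖ ≤ B * |d| ^ (q - 1) * |d| := by
    intro e he
    have := (convex_uIcc 0 d).norm_image_sub_le_of_norm_hasDerivWithin_le
      (C := B * |d| ^ (q - 1)) (fun e he => (hd1 e he).hasDerivWithinAt) (fun e he => ?_)
      left_mem_uIcc he
    · simp only [add_zero, mul_zero, sub_self, sub_zero] at this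
      refine this.trans ?_
      rw [Real.norm_eq_abs]
      exact mul_le_mul_of_nonneg_left (hpos e he).2 (by positivity)
    · rw [← mul_sub, Real.norm_eq_abs, abs_mul, abs_of_pos hB]
      refine mul_le_mul_of_nonneg_left ?_ hB.le
      refine (abs_rpow_sub_rpow_le (by linarith) (by linarith) (hpos e he).1 hy).trans ?_
      rw [add_sub_cancel_left]
      exact Real.rpow_le_rpow (abs_nonneg _) (hpos e he).2 (by linarith)
  have := (convex_uIcc 0 d).norm_image_sub_le_of_norm_hasDerivWithin_le
    (fun e he => (hd0 e he).hasDerivWithinAt) b1 left_mem_uIcc right_mem_uIcc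
  have h0 : densRem q B y 0 = 0 := by simp [densRem]
  rw [h0, sub_zero, sub_zero, Real.norm_eq_abs, Real.norm_eq_abs] at this
  refine this.trans (le_of_eq ?_)
  rcases eq_or_ne d 0 with rfl | h
  · have : q + 1 ≠ 0 := by linarith
    simp [Real.zero_rpow this]
  · have hd' := (abs_pos.2 h).ne'
    rw [Real.rpow_add_one hd', Real.rpow_sub_one hd']
    field_simp

/-- The symmetrised Taylor remainder is negative, as the fourth derivative of the density is. -/
lemma densRem_add_neg_lt {q B y d : ℝ} (hq : 1 < q) (hq2 : q < 2) (hB : 0 < B) (hd : 0 < d)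
    (hdy : d < y) : densRem q B y d + densRem q B y (-d) < 0 := by
  have hy : 0 < y := hd.trans hdy
  have hneg : ∀ e, HasDerivAt (fun e : ℝ => -e) (-1) e := fun e => by
    exact hasDerivAt_neg e
  have hs1 : ∀ e ∈ Icc 0 d, HasDerivAt
      (fun e => B / q * (y + e) ^ q - B / q * (y + -e) ^ q - 2 * (B * y ^ (q - 1)) * e)
      (B * (y + e) ^ (q - 1) + B * (y + -e) ^ (q - 1) - 2 * (B * y ^ (q - 1))) e := fun e he => by
    have h1 := hasDerivAt_dens'_add (B := B) (y := y) (d := e) hq (by linarith [he.1])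
    have h2 := (hasDerivAt_dens'_add (B := B) (y := y) (d := -e) hq (by linarith [he.2])).comp e
      (hneg e)
    refine HasDerivAt.congr_deriv ((h1.sub h2).sub
      ((hasDerivAt_id e).const_mul (2 * (B * y ^ (q - 1))))) ?_
    ring
  have hs0 : ∀ e ∈ Icc 0 d, HasDerivAt (fun e => densRem q B y e + densRem q B y (-e))
      (B / q * (y + e) ^ q - B / q * (y + -e) ^ q - 2 * (B * y ^ (q - 1)) * e) e := fun e he => by
    have h1 := hasDerivAt_dens_add (B := B) (y := y) (d := e) hq (by linarith [he.1])
    have h2 := (hasDerivAt_dens_add (B := B) (y := y) (d := -e) hq (by linarith [he.2])).comp e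
      (hneg e)
    have h3 := (h1.add h2).sub (((hasDerivAt_id e).pow 2).const_mul (B * y ^ (q - 1)))
    refine ((h3.sub_const (2 * dens q B y)).congr_of_eventuallyEq (.of_forall fun e => ?_))
      |>.congr_deriv ?_
    · simp only [densRem, Pi.sub_apply, Pi.add_apply, Function.comp_apply, Pi.pow_apply, id]
      ring
    · simp
      ring
  -- Strict midpoint concavity of y^(q-1), whose exponent lies in (0, 1). Two integrations from 0,
  -- with zero initial data, carry the sign over to the symmetrised remainder.
  have hconc : ∀ e, 0 < e → e < y →
      B * (y + e) ^ (q - 1) + B * (y + -e) ^ (q - 1) - 2 * (B * y ^ (q - 1)) < 0 := by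
    intro e he hey
    have hsc := Real.strictConcaveOn_rpow (p := q - 1) (by linarith) (by linarith)
    have := hsc.2 (show y + e ∈ Ici 0 from by simp only [mem_Ici]; linarith)
      (show y + -e ∈ Ici 0 from by simp only [mem_Ici]; linarith)
      (fun h => by linarith) (one_half_pos (α := ℝ)) one_half_pos (add_halves 1)
    simp only [smul_eq_mul] at this
    rw [show 1 / 2 * (y + e) + 1 / 2 * (y + -e) = y by ring] at this
    nlinarith
  have a1 : StrictAntiOn
      (fun e => B / q * (y + e) ^ q - B / q * (y + -e) ^ q - 2 * (B * y ^ (q - 1)) * e)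
      (Icc 0 d) := by
    apply strictAntiOn_of_deriv_neg (convex_Icc _ _)
    · exact fun e he => (hs1 e he).continuousAt.continuousWithinAt
    · intro e he
      rw [interior_Icc] at he
      rw [(hs1 e (Ioo_subset_Icc_self he)).deriv]
      exact hconc e he.1 (he.2.trans hdy)
  have a0 : StrictAntiOn (fun e => densRem q B y e + densRem q B y (-e)) (Icc 0 d) := by
    apply strictAntiOn_of_deriv_neg (convex_Icc _ _)
    · exact fun e he => (hs0 e he).continuousAt.continuousWithinAt
    · intro e he
      rw [interior_Icc] at he
      rw [(hs0 e (Ioo_subset_Icc_self he)).deriv]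
      have := a1 ⟨le_rfl, hd.le⟩ (Ioo_subset_Icc_self he) he.1
      simpa using this
  have := a0 ⟨le_rfl, hd.le⟩ ⟨hd.le, le_rfl⟩ hd
  simpa [densRem] using this

/-! ### Comparison of energies along the family of steady states of a fixed period -/

/-- The normalised mass of the steady state of fixed period. -/
def massN (q r : ℝ) : ℝ := per q r ^ (2 / (q - 1) - 1) * are q r

/-- The normalised energy of the steady state of fixed period. -/
def energyN (q r : ℝ) : ℝ :=
  per q r ^ (2 * (2 / (q - 1)) + 1) * (act q r / 2 - act q r / (q + 1) - are q r / (q * (q + 1)))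

lemma hasDerivAt_per_rpow {q r : ℝ} (hq : 1 < q) (hr : r ∈ ampRange q) (s : ℝ) :
    HasDerivAt (fun r => per q r ^ s) (s * per q r ^ s / per q r * dper q r) r := by
  have hP := per_pos hq hr
  refine ((hasDerivAt_per hq hr).rpow_const (p := s) (Or.inl hP.ne')).congr_deriv ?_
  rw [Real.rpow_sub_one hP.ne']
  ring

/-- The normalised mass is `bifAmp` to the power 1/(q-1), so its derivative has the sign of
`dbifAmp`. -/
lemma hasDerivAt_massN {q r : ℝ} (hq : 1 < q) (hr : r ∈ ampRange q) :
    HasDerivAt (massN q) (per q r ^ (2 / (q - 1) - 1) / per q r / (q - 1) * dbifAmp q r) r := by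
  have hP := per_pos hq hr
  refine ((hasDerivAt_per_rpow hq hr _).mul (hasDerivAt_are hq hr)).congr_deriv ?_
  have h1 : q - 1 ≠ 0 := by linarith
  rw [dbifAmp, ← dare]
  generalize per q r ^ (2 / (q - 1) - 1) = w
  field_simp
  ring

lemma massN_pos {q r : ℝ} (hq : 1 < q) (hr : r ∈ ampRange q) : 0 < massN q r :=
  mul_pos (Real.rpow_pos_of_pos (per_pos hq hr) _) (are_pos hq hr)

lemma per_rpow_aux {q r : ℝ} (hq : 1 < q) (hr : r ∈ ampRange q) :
    per q r ^ (2 * (2 / (q - 1)) + 1) = per q r ^ (2 / (q - 1) + 2) *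
      per q r ^ (2 / (q - 1) - 1) := by
  rw [← Real.rpow_add (per_pos hq hr)]
  congr 1
  ring

/-- Each state is critical for the energy at fixed mass, so this is a Lagrange multiplier times the
derivative of the mass in `hasDerivAt_massN`. The multiplier has absolute value P^(2/(q-1)+2)/q. -/
lemma hasDerivAt_energyN {q r : ℝ} (hq : 1 < q) (hr : r ∈ ampRange q) :
    HasDerivAt (energyN q) (-(per q r ^ (2 / (q - 1) + 2) / q) *
      (per q r ^ (2 / (q - 1) - 1) / per q r / (q - 1) * dbifAmp q r)) r := by
  have hP := per_pos hq hr
  have hS := hasDerivAt_act hq hr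
  refine ((hasDerivAt_per_rpow hq hr _).mul (((hS.div_const 2).sub (hS.div_const (q + 1))).sub
    ((hasDerivAt_are hq hr).div_const (q * (q + 1))))).congr_deriv ?_
  have h1 : q - 1 ≠ 0 := by linarith
  have h2 : q + 1 ≠ 0 := by linarith
  have h3 : q ≠ 0 := by linarith
  rw [per_rpow_aux hq hr, dbifAmp, dare]
  simp only [Pi.sub_apply]
  rw [are_eq hq hr]
  generalize per q r ^ (2 / (q - 1) - 1) = w
  generalize per q r ^ (2 / (q - 1) + 2) = v
  field_simp
  ring

/-- If the normalised mass dips below its common value at two amplitudes strictly between them,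
the state of larger amplitude has less energy. -/
lemma energyN_lt {q r₁ r₂ : ℝ} (hq : 1 < q) (hr₁ : r₁ ∈ ampRange q) (hr₂ : r₂ ∈ ampRange q)
    (h0 : 0 < r₂) (h : r₂ < r₁) (he : massN q r₁ = massN q r₂)
    (hlt : ∀ r ∈ Ioo r₂ r₁, massN q r < massN q r₁) : energyN q r₁ < energyN q r₂ := by
  have hmem : ∀ r ∈ Icc r₂ r₁, r ∈ ampRange q :=
      fun r hr => ⟨hr₂.1.trans_le hr.1, hr.2.trans_lt hr₁.2⟩
  -- Adding the multiplier times the mass defect cancels the terms with the derivative of the mass.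
  -- Only the derivative of the multiplier survives; it is positive because P' > 0, while the defect
  -- is negative inside the interval.
  have hd : ∀ r ∈ Icc r₂ r₁, HasDerivAt
      (fun r => energyN q r + 1 / q * per q r ^ (2 / (q - 1) + 2) * (massN q r - massN q r₁))
      (1 / q * ((2 / (q - 1) + 2) * per q r ^ (2 / (q - 1) + 2) / per q r * dper q r) *
        (massN q r - massN q r₁)) r := fun r hr => by
    have hr' := hmem r hr
    refine ((hasDerivAt_energyN hq hr').add (((hasDerivAt_per_rpow hq hr' _).const_mul
      (1 / q)).mul ((hasDerivAt_massN hq hr').sub_const _))).congr_deriv ?_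
    ring
  have ha : StrictAntiOn (fun r => energyN q r +
      1 / q * per q r ^ (2 / (q - 1) + 2) * (massN q r - massN q r₁)) (Icc r₂ r₁) := by
    apply strictAntiOn_of_deriv_neg (convex_Icc _ _)
    · exact fun r hr => (hd r hr).continuousAt.continuousWithinAt
    · intro r hr
      rw [interior_Icc] at hr
      have hr' := Ioo_subset_Icc_self hr
      rw [(hd r hr').deriv]
      have h1 := hlt r hr
      have h2 := dper_pos hq (hmem r hr') (h0.trans hr.1)
      have h3 := per_pos hq (hmem r hr')
      have h4 : 0 < q - 1 := by linarith
      exact mul_neg_of_pos_of_neg (by positivity) (by linarith)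
  have := ha ⟨le_rfl, h.le⟩ ⟨h.le, le_rfl⟩ h
  simpa [he] using this

/-- If the normalised mass decreases in the amplitude up to `r`, the state of amplitude `r` has
more energy than the constant state of the same mass. -/
lemma energyN_gt_const {q r : ℝ} (hq : 1 < q) (hr : r ∈ ampRange q) (h0 : 0 < r)
    (hneg : ∀ s ∈ Ioo 0 r, dbifAmp q s < 0) :
    -(massN q r ^ (q + 1) / (q * (q + 1))) < energyN q r := by
  have hmem : ∀ s ∈ Icc 0 r, s ∈ ampRange q := fun s hs =>
    ⟨(zero_mem_ampRange hq).1.trans_le hs.1, hs.2.trans_lt hr.2⟩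
  have h1 : q - 1 ≠ 0 := by linarith
  have h2 : q + 1 ≠ 0 := by linarith
  have h3 : q ≠ 0 := by linarith
  -- A constant of normalised mass M has normalised energy -M^(q+1)/(q(q+1)), hence multiplier
  -- M^q/q. The derivative of the difference of energies is the derivative of the mass times the
  -- difference of multipliers, both negative; the latter by A < P.
  have hd : ∀ s ∈ Icc 0 r, HasDerivAt
      (fun s => energyN q s + massN q s ^ (q + 1) / (q * (q + 1)))
      (1 / q * (per q s ^ (2 / (q - 1) - 1) / per q s / (q - 1) * dbifAmp q s) *
        (massN q s ^ q - per q s ^ (2 / (q - 1) + 2))) s := fun s hs => by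
    have hs' := hmem s hs
    refine ((hasDerivAt_energyN hq hs').add (((hasDerivAt_massN hq hs').rpow_const (p := q + 1)
      (Or.inl (massN_pos hq hs').ne')).div_const _)).congr_deriv ?_
    rw [add_sub_cancel_right]
    field_simp
    ring
  have hmono : StrictMonoOn (fun s => energyN q s + massN q s ^ (q + 1) / (q * (q + 1)))
      (Icc 0 r) := by
    apply strictMonoOn_of_deriv_pos (convex_Icc _ _)
    · exact fun s hs => (hd s hs).continuousAt.continuousWithinAt
    · intro s hs
      rw [interior_Icc] at hs
      have hs' := Ioo_subset_Icc_self hs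
      rw [(hd s hs').deriv]
      have hP := per_pos hq (hmem s hs')
      have hA := are_lt_per hq (hmem s hs') hs.1.ne'
      have hm : massN q s ^ q < per q s ^ (2 / (q - 1) + 2) := by
        have e : per q s ^ (2 / (q - 1) + 2) = (per q s ^ (2 / (q - 1))) ^ q := by
          rw [← Real.rpow_mul hP.le]
          congr 1
          field_simp
          ring
        rw [e]
        refine Real.rpow_lt_rpow (massN_pos hq (hmem s hs')).le ?_ (by linarith)
        rw [massN, Real.rpow_sub_one hP.ne', div_mul_eq_mul_div, div_lt_iff₀ hP]
        exact mul_lt_mul_of_pos_left hA (Real.rpow_pos_of_pos hP _)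
      have h4 : 0 < q - 1 := by linarith
      refine mul_pos_of_neg_of_neg (mul_neg_of_pos_of_neg (by positivity) ?_) (by linarith)
      exact mul_neg_of_pos_of_neg (by positivity) (hneg s hs)
  have h5 := hmono ⟨le_rfl, h0.le⟩ ⟨h0.le, le_rfl⟩ h0
  -- At r = 0 the orbit is itself the constant state.
  have hz : energyN q 0 + massN q 0 ^ (q + 1) / (q * (q + 1)) = 0 := by
    have hP := per_pos hq (zero_mem_ampRange hq)
    have e : massN q 0 ^ (q + 1) = per q 0 ^ (2 * (2 / (q - 1)) + 1) * per q 0 := by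
      rw [massN, are_zero hq, ← Real.rpow_add_one hP.ne', ← Real.rpow_add_one hP.ne',
        ← Real.rpow_mul hP.le]
      congr 1
      field_simp
      ring
    rw [e, energyN, act_zero, are_zero hq]
    field_simp
    ring
  simp only [hz] at h5
  linarith

/-! ### Equal masses on the two sides of the critical amplitude -/

lemma massN_strictMonoOn {q r s : ℝ} (hq : 1 < q) (hr : r ∈ ampRange q) (hs : s ∈ ampRange q)
    (h : ∀ t ∈ Ioo r s, 0 < dbifAmp q t) : StrictMonoOn (massN q) (Icc r s) := by
  have hmem : ∀ t ∈ Icc r s, t ∈ ampRange q := fun t ht => ⟨hr.1.trans_le ht.1, ht.2.trans_lt hs.2⟩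
  apply strictMonoOn_of_deriv_pos (convex_Icc _ _)
  · exact fun t ht => (hasDerivAt_massN hq (hmem t ht)).continuousAt.continuousWithinAt
  · intro t ht
    rw [interior_Icc] at ht
    have ht' := hmem t (Ioo_subset_Icc_self ht)
    rw [(hasDerivAt_massN hq ht').deriv]
    have hP := per_pos hq ht'
    have h1 := h t ht
    have h4 : 0 < q - 1 := by linarith
    positivity

lemma massN_strictAntiOn {q r s : ℝ} (hq : 1 < q) (hr : r ∈ ampRange q) (hs : s ∈ ampRange q)
    (h : ∀ t ∈ Ioo r s, dbifAmp q t < 0) : StrictAntiOn (massN q) (Icc r s) := by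
  have hmem : ∀ t ∈ Icc r s, t ∈ ampRange q := fun t ht => ⟨hr.1.trans_le ht.1, ht.2.trans_lt hs.2⟩
  apply strictAntiOn_of_deriv_neg (convex_Icc _ _)
  · exact fun t ht => (hasDerivAt_massN hq (hmem t ht)).continuousAt.continuousWithinAt
  · intro t ht
    rw [interior_Icc] at ht
    have ht' := hmem t (Ioo_subset_Icc_self ht)
    rw [(hasDerivAt_massN hq ht').deriv]
    have hP := per_pos hq ht'
    have h4 : 0 < q - 1 := by linarith
    exact mul_neg_of_pos_of_neg (by positivity) (h t ht)

/-- Two amplitudes of equal normalised mass lie on the two sides of the critical one, and the mass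
is smaller in between. -/
lemma critical_between {q r₁ r₂ rc : ℝ} (hq : 1 < q) (hr₁ : r₁ ∈ ampRange q)
    (hrc : rc ∈ ampRange q) (hr₂ : r₂ ∈ ampRange q) (h0 : 0 < r₂) (h : r₂ < r₁)
    (he : massN q r₁ = massN q r₂)
    (hneg : ∀ t ∈ Ioo 0 rc, dbifAmp q t < 0)
    (hpos : ∀ t ∈ ampRange q, rc < t → 0 < dbifAmp q t) :
    r₂ < rc ∧ rc < r₁ ∧ ∀ r ∈ Ioo r₂ r₁, massN q r < massN q r₁ := by
  have hanti : ∀ s, r₂ ≤ s → s ≤ rc → s ∈ ampRange q → StrictAntiOn (massN q) (Icc r₂ s) :=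
    fun s hs hsc hsm => massN_strictAntiOn hq hr₂ hsm fun t ht =>
      hneg t ⟨h0.trans ht.1, ht.2.trans_le hsc⟩
  have hmono : ∀ s, rc ≤ s → s ≤ r₁ → s ∈ ampRange q → StrictMonoOn (massN q) (Icc s r₁) :=
    fun s hs hsc hsm => massN_strictMonoOn hq hsm hr₁ fun t ht =>
      hpos t ⟨hsm.1.trans ht.1, ht.2.trans hr₁.2⟩ (hs.trans_lt ht.1)
  have h1 : r₂ < rc := by
    by_contra hc
    have := hmono r₂ (not_lt.1 hc) h.le hr₂ ⟨le_rfl, h.le⟩ ⟨h.le, le_rfl⟩ h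
    linarith
  have h2 : rc < r₁ := by
    by_contra hc
    have := hanti r₁ h.le (not_lt.1 hc) hr₁ ⟨le_rfl, h.le⟩ ⟨h.le, le_rfl⟩ h
    linarith
  refine ⟨h1, h2, fun r hr => ?_⟩
  rcases le_total r rc with hc | hc
  · rw [he]
    exact hanti rc h1.le le_rfl hrc ⟨le_rfl, h1.le⟩ ⟨hr.1.le, hc⟩ hr.1
  · exact hmono rc le_rfl h2.le hrc ⟨hc, hr.2.le⟩ ⟨h2.le, le_rfl⟩ hr.2

/-! ### Classification of positive periodic steady states -/

lemma monotone_periodic_const {g : ℝ → ℝ} {X : ℝ} (hX : 0 < X) (hp : Function.Periodic g X)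
    (hg : Antitone g) (x y : ℝ) : g x = g y := by
  have key : ∀ x y, g x ≤ g y := fun x y => by
    obtain ⟨n, hn⟩ := exists_nat_ge ((y - x) / X)
    have h1 : y ≤ x + n * X := by
      rw [div_le_iff₀ hX] at hn
      linarith
    rw [← hp.nat_mul n x]
    exact hg h1
  exact le_antisymm (key x y) (key y x)

lemma IsLeastPeriod.not_const {h : ℝ → ℝ} {X : ℝ} (hX : IsLeastPeriod h X) :
    ¬ ∀ x y, h x = h y := fun hc => by
  have h0 : 0 < X := hX.1.1
  have := hX.2 ⟨half_pos h0, fun x => hc _ _⟩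
  linarith

/-- The steady state equation integrates twice for periodic solutions. -/
lemma IsPositiveSteadyState.exists_second_order {m n q B X : ℝ} {h : ℝ → ℝ} (hq : q = m - n + 1)
    (hq1 : 1 < q) (hss : IsPositiveSteadyState (fun y => y ^ n) (fun y => B * y ^ m) h)
    (hX : 0 < X) (hper : Function.Periodic h X) :
    ∃ D, ∀ x, HasDerivAt (deriv h) (D - B / q * h x ^ q) x := by
  have hq0 : q ≠ 0 := by linarith
  have hc4 := hss.contDiff
  have i1 : iteratedDeriv 1 h = deriv h := iteratedDeriv_one
  have i2 : iteratedDeriv 2 h = deriv (deriv h) := by rw [iteratedDeriv_succ, i1]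
  have i3 : iteratedDeriv 3 h = deriv (deriv (deriv h)) := by rw [iteratedDeriv_succ, i2]
  have d0 : ∀ x, HasDerivAt h (deriv h x) x := fun x =>
    (hc4.differentiable (by norm_num) x).hasDerivAt
  have d1 : ∀ x, HasDerivAt (deriv h) (deriv (deriv h) x) x := fun x => by
    have := hc4.differentiable_iteratedDeriv 1 (by norm_num) x
    rw [i1] at this
    exact this.hasDerivAt
  have d2 : ∀ x, HasDerivAt (deriv (deriv h)) (iteratedDeriv 3 h x) x := fun x => by
    have := hc4.differentiable_iteratedDeriv 2 (by norm_num) x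
    rw [i2] at this
    rw [i3]
    exact this.hasDerivAt
  have d3 : Differentiable ℝ (iteratedDeriv 3 h) :=
    hc4.differentiable_iteratedDeriv 3 (by norm_num)
  have dp : ∀ (s : ℝ) x, DifferentiableAt ℝ (fun x => h x ^ s) x := fun s x =>
    ((d0 x).rpow_const (p := s) (Or.inl (hss.pos x).ne')).differentiableAt
  obtain ⟨C, hC⟩ : ∃ C, ∀ x, h x ^ n * iteratedDeriv 3 h x + B * h x ^ m * deriv h x = C := by
    have e1 : ∀ x, DifferentiableAt ℝ (fun x => h x ^ n * iteratedDeriv 3 h x) x :=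
      fun x => (dp n x).mul (d3 x)
    have e2 : ∀ x, DifferentiableAt ℝ (fun x => B * h x ^ m * deriv h x) x :=
      fun x => ((dp m x).const_mul B).mul (d1 x).differentiableAt
    refine ⟨_, fun x => is_const_of_deriv_eq_zero (f := fun x => h x ^ n * iteratedDeriv 3 h x +
      B * h x ^ m * deriv h x) (fun x => (e1 x).add (e2 x)) (fun x => ?_) x 0⟩
    have := hss.steady x
    rw [deriv_fun_add (e1 x) (e2 x)]
    linarith
  have hG : ∀ x, HasDerivAt (fun x => deriv (deriv h) x + B / q * h x ^ q) (C / h x ^ n) x := by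
    intro x
    have hx := hss.pos x
    refine HasDerivAt.congr_deriv ((d2 x).add (((d0 x).rpow_const (p := q)
      (Or.inl hx.ne')).const_mul (B / q))) ?_
    rw [← hC x, show q - 1 = m - n by linarith, Real.rpow_sub hx]
    have := (Real.rpow_pos_of_pos hx n).ne'
    field_simp
  have hp2 := deriv_periodic (deriv_periodic hper)
  -- The flux constant vanishes: G' = C / h^n never changes sign, yet Rolle's theorem gives it a
  -- zero, as G is periodic.
  have hC0 : C = 0 := by
    obtain ⟨c, -, hc⟩ := exists_hasDerivAt_eq_zero hX
      (fun x _ => (hG x).continuousAt.continuousWithinAt)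
      (by simp only [hp2.eq, hper.eq]) (fun x _ => hG x)
    rcases div_eq_zero_iff.1 hc with h | h
    · exact h
    · exact absurd h (Real.rpow_pos_of_pos (hss.pos c) n).ne'
  refine ⟨deriv (deriv h) 0 + B / q * h 0 ^ q, fun x => (d1 x).congr_deriv ?_⟩
  have := is_const_of_deriv_eq_zero (fun x => (hG x).differentiableAt)
    (fun x => by rw [(hG x).deriv, hC0, zero_div]) x 0
  linarith

/-- The amplitude scale of steady states of period `X`. -/
def scale (q B X : ℝ) : ℝ := (1 / (X ^ 2 * B)) ^ (1 / (q - 1))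

/-- The steady state of period `X` and amplitude `r` with minimum at `x₀`. -/
def state (q B X r x₀ x : ℝ) : ℝ :=
  scale q B X * per q r ^ (2 / (q - 1)) * orbit q r (per q r / X * (x - x₀))

lemma scale_pos {q B X : ℝ} (hB : 0 < B) (hX : 0 < X) : 0 < scale q B X :=
  Real.rpow_pos_of_pos (by positivity) _

lemma scale_rpow {q B X : ℝ} (hq : 1 < q) (hB : 0 < B) (hX : 0 < X) :
    scale q B X ^ (q - 1) = 1 / (X ^ 2 * B) := by
  have : q - 1 ≠ 0 := by linarith
  rw [scale, ← Real.rpow_mul (by positivity), one_div_mul_cancel this, Real.rpow_one]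

/-- Measuring height in units of the rest value a and length in units of 1/b turns the twice
integrated equation into the canonical one, with minimum h(x₀)/a < 1. The least period then fixes b
= P/X, and through b also a. -/
theorem IsPositiveSteadyState.eq_state {m n q B X : ℝ} {h : ℝ → ℝ} (hB : 0 < B)
    (hq : q = m - n + 1) (hq1 : 1 < q)
    (hss : IsPositiveSteadyState (fun y => y ^ n) (fun y => B * y ^ m) h)
    (hX : IsLeastPeriod h X) :
    ∃ r ∈ ampRange q, 0 < r ∧ ∃ x₀, h = state q B X r x₀ ∧ ∀ x, h x₀ ≤ h x := by
  have hX0 : 0 < X := hX.1.1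
  have hper : Function.Periodic h X := hX.1.2
  have hq0 : 0 < q := by linarith
  have hq1' : 0 < q - 1 := by linarith
  obtain ⟨D, hD⟩ := hss.exists_second_order hq hq1 hX0 hper
  have d0 : ∀ x, HasDerivAt h (deriv h x) x := fun x =>
    (hss.contDiff.differentiable (by norm_num) x).hasDerivAt
  obtain ⟨x₀, hx₀⟩ : ∃ x₀, ∀ x, h x₀ ≤ h x := by
    obtain ⟨x₀, _, h₀⟩ := (isCompact_Icc (a := 0) (b := X)).exists_isMinOn
      (nonempty_Icc.2 hX0.le) hss.contDiff.continuous.continuousOn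
    refine ⟨x₀, fun x => ?_⟩
    obtain ⟨y, hy, hxy⟩ := hper.exists_mem_Ico₀ hX0 x
    rw [hxy]
    exact h₀ (Ico_subset_Icc_self hy)
  have hd0 : deriv h x₀ = 0 := IsLocalMin.deriv_eq_zero (.of_forall hx₀)
  -- Otherwise h'' ≤ 0 everywhere, so h' is monotone and periodic, hence constantly h'(x₀) = 0, and
  -- h would be constant.
  have hlt : B / q * h x₀ ^ q < D := by
    by_contra hc
    have ha : Antitone (deriv h) := by
      refine antitone_of_deriv_nonpos (fun x => (hD x).differentiableAt) fun x => ?_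
      rw [(hD x).deriv]
      have h1 : h x₀ ^ q ≤ h x ^ q := Real.rpow_le_rpow (hss.pos _).le (hx₀ x) hq0.le
      have h2 := mul_le_mul_of_nonneg_left h1 (div_pos hB hq0).le
      linarith
    refine hX.not_const fun x y => is_const_of_deriv_eq_zero
      (fun x => (d0 x).differentiableAt) (fun x => ?_) x y
    rw [← hd0]
    exact monotone_periodic_const hX0 (deriv_periodic hper) ha x x₀
  have hp0 := Real.rpow_pos_of_pos (hss.pos x₀) q
  have hDpos : 0 < D := lt_of_le_of_lt (by positivity) hlt
  -- The rest value, where D - (B/q) y^q vanishes.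
  set a := (q * D / B) ^ (1 / q) with ha
  have ha0 : 0 < a := Real.rpow_pos_of_pos (by positivity) _
  have haq : a ^ q = q * D / B := by
    rw [ha, ← Real.rpow_mul (by positivity), one_div_mul_cancel hq0.ne', Real.rpow_one]
  have hha : h x₀ < a := by
    refine (Real.rpow_lt_rpow_iff (hss.pos x₀).le ha0.le hq0).1 ?_
    rw [haq, lt_div_iff₀ hB]
    rw [div_mul_eq_mul_div, div_lt_iff₀ hq0] at hlt
    linarith
  -- The frequency that normalises the coefficient of the rescaled equation to 1/q.
  set b := √(B * a ^ (q - 1)) with hb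
  have hap := Real.rpow_pos_of_pos ha0 (q - 1)
  have hb0 : 0 < b := Real.sqrt_pos.2 (by positivity)
  have hb2 : b ^ 2 = B * a ^ (q - 1) := Real.sq_sqrt (by positivity)
  set k := fun y => h (x₀ + 1 / b * y) / a with hk
  have k1 : ∀ y, HasDerivAt k (deriv h (x₀ + 1 / b * y) / (a * b)) y := fun y => by
    have hl : HasDerivAt (fun y => x₀ + 1 / b * y) (1 / b) y := by
      simpa using ((hasDerivAt_id y).const_mul (1 / b)).const_add x₀
    refine (((d0 _).comp y hl).div_const a).congr_deriv ?_
    field_simp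
  have k2 : ∀ y, HasDerivAt (deriv k) (-force q (k y)) y := fun y => by
    have hl : HasDerivAt (fun y => x₀ + 1 / b * y) (1 / b) y := by
      simpa using ((hasDerivAt_id y).const_mul (1 / b)).const_add x₀
    rw [funext fun y => (k1 y).deriv]
    refine (((hD _).comp y hl).div_const (a * b)).congr_deriv ?_
    rw [force, hk]
    simp only
    rw [Real.div_rpow (hss.pos _).le ha0.le, haq]
    have hD' : D = B * a ^ (q - 1) * a / q := by
      rw [Real.rpow_sub_one ha0.ne', haq]
      field_simp
    have : 1 / b * (1 / b) = 1 / (B * a ^ (q - 1)) := by rw [← hb2]; ring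
    rw [show (D - B / q * h (x₀ + 1 / b * y) ^ q) * (1 / b) / (a * b) =
      (D - B / q * h (x₀ + 1 / b * y) ^ q) * (1 / b * (1 / b)) / a by field_simp, this]
    rw [show (D - B / q * h (x₀ + 1 / b * y) ^ q) * (1 / (B * a ^ (q - 1))) / a =
      (D - B / q * h (x₀ + 1 / b * y) ^ q) / (B * a ^ (q - 1) * a) by field_simp,
      show B * a ^ (q - 1) * a = q * D by rw [hD']; field_simp]
    field_simp
    ring
  have hprof : IsCanonicalProfile q (h x₀ / a) k := by
    refine ⟨?_, fun y => div_pos (hss.pos _) ha0, ⟨b * X, by positivity, fun y => ?_⟩,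
      fun y => ?_, ?_, ?_⟩
    · have : ContDiff ℝ 2 h := hss.contDiff.of_le (by norm_num)
      rw [hk]
      fun_prop
    · simp only [hk]
      rw [show x₀ + 1 / b * (y + b * X) = x₀ + 1 / b * y + X by field_simp; ring, hper]
    · rw [(k2 y).deriv, force]
      ring
    · simp [hk]
    · rw [(k1 0).deriv]
      simp [hd0]
  have hα : h x₀ / a ∈ Ioo (0 : ℝ) 1 := ⟨div_pos (hss.pos _) ha0, (div_lt_one ha0).2 hha⟩
  have hko := isCanonicalProfile_eq_orbit hq1 hα hprof
  set r := ampOf q (h x₀ / a) with hrdef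
  have hr : r ∈ ampRange q := ampOf_mem hq1 hα
  have hr0 : 0 < r := ampOf_pos hq1 hα
  have hP := per_pos hq1 hr
  have hh : ∀ x, h x = a * orbit q r (b * (x - x₀)) := fun x => by
    rw [← hko]
    simp only [hk]
    rw [show x₀ + 1 / b * (b * (x - x₀)) = x by field_simp; ring]
    field_simp
  have hperb : per q r = b * X := by
    apply le_antisymm
    · refine (isLeastPeriod_orbit hq1 hr hr0.ne').2 ⟨by positivity, fun y => ?_⟩
      rw [← hko]
      simp only [hk]
      rw [show x₀ + 1 / b * (y + b * X) = x₀ + 1 / b * y + X by field_simp; ring, hper]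
    · have := hX.2 ⟨div_pos hP hb0, fun x => by
        rw [hh, hh, show b * (x + per q r / b - x₀) = b * (x - x₀) + per q r by field_simp; ring,
          orbit_periodic hq1 hr]⟩
      rw [le_div_iff₀ hb0] at this
      linarith
  -- Eliminate b between b² = B a^(q-1) and P = bX.
  have haP : a = scale q B X * per q r ^ (2 / (q - 1)) := by
    have e : per q r ^ (2 / (q - 1)) = (per q r ^ 2) ^ (1 / (q - 1)) := by
      rw [← Real.rpow_natCast (per q r) 2, ← Real.rpow_mul hP.le]
      congr 1
      push_cast
      ring
    rw [e, scale, ← Real.mul_rpow (by positivity) (by positivity), hperb, mul_pow, hb2,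
      show 1 / (X ^ 2 * B) * (B * a ^ (q - 1) * X ^ 2) = a ^ (q - 1) by field_simp,
      ← Real.rpow_mul ha0.le, mul_one_div_cancel hq1'.ne', Real.rpow_one]
  refine ⟨r, hr, hr0, x₀, funext fun x => ?_, hx₀⟩
  rw [state, hh, ← haP, show per q r / X = b by rw [hperb]; field_simp]

lemma state_pos {q B X r x₀ : ℝ} (hq : 1 < q) (hB : 0 < B) (hX : 0 < X) (hr : r ∈ ampRange q)
    (x : ℝ) : 0 < state q B X r x₀ x :=
  mul_pos (mul_pos (scale_pos hB hX) (Real.rpow_pos_of_pos (per_pos hq hr) _)) (orbit_pos hr hq _)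

lemma state_self {q B X r x₀ : ℝ} (hq : 1 < q) (hr : r ∈ ampRange q) :
    state q B X r x₀ x₀ = scale q B X * per q r ^ (2 / (q - 1)) * kap q (-r) := by
  rw [state, sub_self, mul_zero, orbit_zero hq hr]

lemma integral_comp_state {P X x₀ : ℝ} (hP : 0 < P) (hX : 0 < X) {g : ℝ → ℝ}
    (hg : Function.Periodic g P) :
    ∫ x in (0 : ℝ)..X, g (P / X * (x - x₀)) = X / P * ∫ y in (0 : ℝ)..P, g y := by
  have h1 : (fun x => g (P / X * (x - x₀))) = fun x => g (P / X * x - P / X * x₀) := by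
    funext x; rw [mul_sub]
  rw [h1, intervalIntegral.integral_comp_mul_sub g (div_pos hP hX).ne', smul_eq_mul, inv_div]
  congr 1
  have := hg.intervalIntegral_add_eq (P / X * 0 - P / X * x₀) 0
  rw [zero_add] at this
  rw [← this]
  congr 1
  field_simp
  ring

lemma integral_state {q B X r x₀ : ℝ} (hq : 1 < q) (hX : 0 < X) (hr : r ∈ ampRange q) :
    ∫ x in (0 : ℝ)..X, state q B X r x₀ x = scale q B X * X * massN q r := by
  have hP := per_pos hq hr
  have : ∀ x, state q B X r x₀ x = (fun y => scale q B X * per q r ^ (2 / (q - 1)) * orbit q r y)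
      (per q r / X * (x - x₀)) := fun x => rfl
  rw [funext this, integral_comp_state hP hX (fun y => by
    simp only [orbit_periodic hq hr y]), intervalIntegral.integral_const_mul, ← are, massN,
    Real.rpow_sub_one hP.ne']
  field_simp

/-- The amplitudes of the two steady states: their position relative to the critical amplitude. -/
lemma amplitudes {q B X αcrit r₁ r₂ x₁ x₂ : ℝ} (hq : 1 < q) (hB : 0 < B) (hX : 0 < X)
    (hαcrit : αcrit ∈ Ioo (0 : ℝ) 1)
    (hEdec : ∀ α ∈ Ioo (0 : ℝ) αcrit, deriv (bifurcationE q) α < 0)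
    (hEinc : ∀ α ∈ Ioo αcrit (1 : ℝ), 0 < deriv (bifurcationE q) α)
    (hP : StrictMonoOn (fun α : ℝ => α * (period q α) ^ (2 / (q - 1))) (Ioo (0 : ℝ) 1))
    (hr₁ : r₁ ∈ ampRange q) (h₁ : 0 < r₁) (hr₂ : r₂ ∈ ampRange q) (h₂ : 0 < r₂)
    (harea : ∫ x in (0 : ℝ)..X, state q B X r₁ x₁ x = ∫ x in (0 : ℝ)..X, state q B X r₂ x₂ x)
    (hmin : state q B X r₁ x₁ x₁ < state q B X r₂ x₂ x₂) :
    r₂ < r₁ ∧ massN q r₁ = massN q r₂ ∧ 0 < dbifAmp q r₁ ∧ (∀ t ∈ Ioc 0 r₂, dbifAmp q t < 0) ∧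
      ∀ r ∈ Ioo r₂ r₁, massN q r < massN q r₁ := by
  have hK := scale_pos (q := q) hB hX
  have a₁ := kap_neg_mem hq hr₁ h₁
  have a₂ := kap_neg_mem hq hr₂ h₂
  have he : massN q r₁ = massN q r₂ := by
    rw [integral_state hq hX hr₁, integral_state hq hX hr₂] at harea
    exact mul_left_cancel₀ (by positivity) harea
  have hlt : r₂ < r₁ := by
    rw [state_self hq hr₁, state_self hq hr₂, mul_assoc, mul_assoc,
      mul_lt_mul_iff_right₀ hK] at hmin
    -- Up to the common scale, the minimum of a state is α P(α)^(2/(q-1)), so the ordering of the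
    -- minima is an ordering of α by the monotonicity hypothesis.
    have hα : kap q (-r₁) < kap q (-r₂) := by
      rw [← hP.lt_iff_lt a₁ a₂, period_eq hq a₁, period_eq hq a₂, ampOf_kap_neg hq hr₁,
          ampOf_kap_neg hq hr₂]
      linarith
    have := ampOf_lt_ampOf hq a₁.1 hα
    rwa [ampOf_kap_neg hq hr₁, ampOf_kap_neg hq hr₂] at this
  have hrc := ampOf_mem hq hαcrit
  have kc := kap_neg_ampOf hq hαcrit
  have hneg : ∀ t ∈ Ioo 0 (ampOf q αcrit), dbifAmp q t < 0 := fun t ht => by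
    have htm : t ∈ ampRange q :=
      ⟨(zero_mem_ampRange hq).1.trans ht.1, ht.2.trans hrc.2⟩
    have hα := kap_neg_mem hq htm ht.1
    have := (dbifAmp_sign hq hα).2 (hEinc _ ⟨?_, hα.2⟩)
    · rwa [ampOf_kap_neg hq htm] at this
    · rw [← kc]
      exact kap_lt_kap hq (neg_mem_ampRange hrc) (neg_mem_ampRange htm) (by linarith [ht.2])
  have hpos : ∀ t ∈ ampRange q, ampOf q αcrit < t → 0 < dbifAmp q t := fun t htm ht => by
    have hα := kap_neg_mem hq htm ((ampOf_pos hq hαcrit).trans ht)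
    have := (dbifAmp_sign hq hα).1 (hEdec _ ⟨hα.1, ?_⟩)
    · rwa [ampOf_kap_neg hq htm] at this
    · rw [← kc]
      exact kap_lt_kap hq (neg_mem_ampRange htm) (neg_mem_ampRange hrc) (by linarith)
  obtain ⟨c₂, c₁, c⟩ := critical_between hq hr₁ hrc hr₂ h₂ hlt he hneg hpos
  exact ⟨hlt, he, hpos r₁ hr₁ c₁, fun t ht => hneg t ⟨ht.1, ht.2.trans_lt c₂⟩, c⟩

/-! ### Expansion of the energy -/

lemma continuous_dens_comp {q B : ℝ} (hq : 1 < q) {f : ℝ → ℝ} (hf : Continuous f) :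
    Continuous fun x => dens q B (f x) :=
  (hf.rpow_const fun _ => Or.inr (by linarith)).const_mul _

lemma continuous_densRem_comp {q B : ℝ} (hq : 1 < q) {f g : ℝ → ℝ} (hf : Continuous f)
    (hg : Continuous g) : Continuous fun x => densRem q B (f x) (g x) := by
  have h1 := continuous_dens_comp (B := B) hq (hf.add hg)
  have h2 := continuous_dens_comp (B := B) hq hf
  have h3 : Continuous fun x => f x ^ q := hf.rpow_const fun _ => Or.inr (by linarith)
  have h4 : Continuous fun x => f x ^ (q - 1) := hf.rpow_const fun _ => Or.inr (by linarith)
  simp only [densRem]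
  exact ((h1.sub h2).sub ((h3.const_mul _).mul hg)).sub ((h4.const_mul _).mul (hg.pow 2))

/-- The energy along a zero-mean perturbation of a solution of the twice integrated equation. -/
lemma energy_expansion {q B X D c₁ c₀ ε : ℝ} {H h h₁ u : ℝ → ℝ} (hq : 1 < q)
    (hH : ∀ y, 0 < y → H y = dens q B y + c₁ * y + c₀)
    (hh : ∀ x, HasDerivAt h (h₁ x) x) (hh₁ : ∀ x, HasDerivAt h₁ (D - B / q * h x ^ q) x)
    (hpos : ∀ x, 0 < h x) (hper : Function.Periodic h₁ X) (hu : IsH1Loc u)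
    (hup : Function.Periodic u X) (hm : ∫ x in (0 : ℝ)..X, u x = 0)
    (hε : ∀ x, 0 < h x + ε * u x) :
    energy H X (fun x => h x + ε * u x) - energy H X h =
      ε ^ 2 / 2 * quadForm (fun x => B * h x ^ (q - 1)) 0 X u -
        ∫ x in (0 : ℝ)..X, densRem q B (h x) (ε * u x) := by
  have ch : Continuous h := continuous_iff_continuousAt.2 fun x => (hh x).continuousAt
  have chq : Continuous fun x => h x ^ q := ch.rpow_const fun _ => Or.inr (by linarith)
  have chq1 : Continuous fun x => B * h x ^ (q - 1) :=
    (ch.rpow_const fun _ => Or.inr (by linarith)).const_mul B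
  have ch₁ : Continuous h₁ := continuous_iff_continuousAt.2 fun x => (hh₁ x).continuousAt
  have cu := hu.continuous
  have dh₁ : deriv h₁ = fun x => D - B / q * h x ^ q := funext fun x => (hh₁ x).deriv
  have cdh₁ : Continuous (deriv h₁) := by rw [dh₁]; fun_prop
  have cR := continuous_densRem_comp (B := B) hq ch (cu.const_mul ε)
  have cd := continuous_dens_comp (B := B) hq ch
  -- The first variation vanishes: integrating h' u' by parts leaves h'' + H'(h), a constant,
  -- against u of mean zero.
  have hparts : ∫ x in (0 : ℝ)..X, deriv h₁ x * u x + h₁ x * deriv u x = 0 := by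
    have p1 := hper 0
    have p2 := hup 0
    rw [zero_add] at p1 p2
    have hac : AbsolutelyContinuousOnInterval h₁ 0 X :=
      (IsH1Loc.of_contDiff (IsH1Loc.contDiff_one (fun x => (hh₁ x).differentiableAt.hasDerivAt)
        cdh₁)).absCont 0 X
    rw [hac.integral_deriv_mul_eq_sub (hu.absCont 0 X), p1, p2, sub_self]
  have iu := hu.intervalIntegrable_deriv 0 X
  have i0 : IntervalIntegrable (fun x => 1 / 2 * h₁ x ^ 2 - (dens q B (h x) + c₁ * h x + c₀))
      volume 0 X := Continuous.intervalIntegrable (by fun_prop) _ _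
  have i1 : IntervalIntegrable (fun x => ε * (deriv h₁ x * u x + h₁ x * deriv u x)) volume 0 X :=
    (((cdh₁.mul cu).intervalIntegrable _ _).add (iu.continuousOn_mul ch₁.continuousOn)).const_mul ε
  have i2 : IntervalIntegrable (fun x => (-(ε * D) - c₁ * ε) * u x) volume 0 X :=
    (cu.intervalIntegrable _ _).const_mul _
  have i3 : IntervalIntegrable (fun x => ε ^ 2 / 2 * (deriv u x ^ 2 - B * h x ^ (q - 1) * u x ^ 2))
      volume 0 X := (hu.integrable_quad chq1 0 X).const_mul _
  have i4 : IntervalIntegrable (fun x => densRem q B (h x) (ε * u x)) volume 0 X :=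
    cR.intervalIntegrable _ _
  have e0 : energy H X h =
      ∫ x in (0 : ℝ)..X, (1 / 2 * h₁ x ^ 2 - (dens q B (h x) + c₁ * h x + c₀)) := by
    rw [energy]
    refine intervalIntegral.integral_congr fun x _ => ?_
    simp only [hH _ (hpos x), (hh x).deriv]
  have e1 : energy H X (fun x => h x + ε * u x) =
      ∫ x in (0 : ℝ)..X, ((1 / 2 * h₁ x ^ 2 - (dens q B (h x) + c₁ * h x + c₀)) +
        ε * (deriv h₁ x * u x + h₁ x * deriv u x) + (-(ε * D) - c₁ * ε) * u x +
        ε ^ 2 / 2 * (deriv u x ^ 2 - B * h x ^ (q - 1) * u x ^ 2) -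
        densRem q B (h x) (ε * u x)) := by
    rw [energy]
    refine intervalIntegral.integral_congr_ae ?_
    filter_upwards [hu.ae_differentiableAt] with x hx _
    have hd : deriv (fun x => h x + ε * u x) x = h₁ x + ε * deriv u x :=
      ((hh x).add (hx.hasDerivAt.const_mul ε)).deriv
    rw [hd, hH _ (hε x), dh₁, densRem]
    ring
  rw [e1, e0, intervalIntegral.integral_sub (((i0.add i1).add i2).add i3) i4,
    intervalIntegral.integral_add ((i0.add i1).add i2) i3,
    intervalIntegral.integral_add (i0.add i1) i2, intervalIntegral.integral_add i0 i1,
    intervalIntegral.integral_const_mul, intervalIntegral.integral_const_mul,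
    intervalIntegral.integral_const_mul, hparts, hm, quadForm]
  ring

/-- The sign of the energy difference is that of the second variation if this does not vanish. -/
lemma energy_sub_sign {q B X D c₁ c₀ : ℝ} {H h h₁ u : ℝ → ℝ} (hq : 1 < q) (hq2 : q < 2)
    (hB : 0 < B) (hX : 0 < X) (hH : ∀ y, 0 < y → H y = dens q B y + c₁ * y + c₀)
    (hh : ∀ x, HasDerivAt h (h₁ x) x) (hh₁ : ∀ x, HasDerivAt h₁ (D - B / q * h x ^ q) x)
    (hpos : ∀ x, 0 < h x) (hper : Function.Periodic h X) (hper₁ : Function.Periodic h₁ X)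
    (hu : IsH1Loc u) (hup : Function.Periodic u X) (hm : ∫ x in (0 : ℝ)..X, u x = 0) :
    (0 < quadForm (fun x => B * h x ^ (q - 1)) 0 X u →
      ∀ᶠ ε in 𝓝[>] (0 : ℝ), energy H X h < energy H X (fun x => h x + ε * u x)) ∧
    (quadForm (fun x => B * h x ^ (q - 1)) 0 X u < 0 →
      ∀ᶠ ε in 𝓝[>] (0 : ℝ), energy H X (fun x => h x + ε * u x) < energy H X h) := by
  have ch : Continuous h := continuous_iff_continuousAt.2 fun x => (hh x).continuousAt
  obtain ⟨a, _, ha, hab⟩ := exists_bounds_of_periodic hX hper ch hpos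
  -- The shift by 1 supplies the positivity that the bound lemma asks for; only the upper bound is
  -- used.
  obtain ⟨_, M, _, hM⟩ := exists_bounds_of_periodic (k := fun x => |u x| + 1) hX
    (fun x => by simp only [hup x]) (hu.continuous.abs.add continuous_const)
        (fun x => by positivity)
  have hM' : ∀ x, |u x| ≤ M := fun x => by linarith [(hM x).2]
  have hM0 : 0 ≤ M := (abs_nonneg _).trans (hM' 0)
  set Q := quadForm (fun x => B * h x ^ (q - 1)) 0 X u with hQ
  have hsmall : ∀ᶠ ε in 𝓝[>] (0 : ℝ), ε * M < a := by
    have : Tendsto (fun ε : ℝ => ε * M) (𝓝[>] 0) (𝓝 (0 * M)) :=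
      ((continuous_id.mul continuous_const).tendsto 0).mono_left nhdsWithin_le_nhds
    rw [zero_mul] at this
    exact this.eventually (gt_mem_nhds ha)
  have hbound : ∀ᶠ ε in 𝓝[>] (0 : ℝ),
      |energy H X (fun x => h x + ε * u x) - energy H X h - ε ^ 2 / 2 * Q| ≤
        B * (ε * M) ^ (q + 1) * X := by
    filter_upwards [hsmall, self_mem_nhdsWithin] with ε h1 h0
    have h0 : 0 < ε := h0
    have habs : ∀ x, |ε * u x| ≤ ε * M := fun x => by
      rw [abs_mul, abs_of_pos h0]
      exact mul_le_mul_of_nonneg_left (hM' x) h0.le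
    have hε : ∀ x, 0 < h x + ε * u x := fun x => by
      linarith [(abs_le.1 (habs x)).1, (hab x).1]
    rw [energy_expansion hq hH hh hh₁ hpos hper₁ hu hup hm hε, ← hQ, sub_sub_cancel_left, abs_neg]
    have := intervalIntegral.norm_integral_le_of_norm_le_const (a := 0) (b := X)
      (f := fun x => densRem q B (h x) (ε * u x)) (C := B * (ε * M) ^ (q + 1)) fun x _ => by
        refine (abs_densRem_le hq hq2 hB (hpos x) (hε x)).trans ?_
        refine mul_le_mul_of_nonneg_left ?_ hB.le
        exact Real.rpow_le_rpow (abs_nonneg _) (habs x) (by linarith)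
    rwa [sub_zero, abs_of_pos hX] at this
  -- The remainder is of order q + 1 > 2 in ε, hence negligible against the second variation.
  have hlim : ∀ δ : ℝ, 0 < δ → ∀ᶠ ε in 𝓝[>] (0 : ℝ),
      B * (ε * M) ^ (q + 1) * X < ε ^ 2 / 2 * δ := fun δ hδ => by
    have : Tendsto (fun ε : ℝ => B * ε ^ (q - 1) * M ^ (q + 1) * X) (𝓝[>] 0)
        (𝓝 (B * 0 ^ (q - 1) * M ^ (q + 1) * X)) := by
      have hc : Continuous fun ε : ℝ => B * ε ^ (q - 1) * M ^ (q + 1) * X :=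
        (((continuous_id.rpow_const fun _ => Or.inr (by linarith)).const_mul B).mul
          continuous_const).mul continuous_const
      exact (hc.tendsto 0).mono_left nhdsWithin_le_nhds
    rw [Real.zero_rpow (by linarith), mul_zero, zero_mul, zero_mul] at this
    filter_upwards [this.eventually (gt_mem_nhds (half_pos hδ)), self_mem_nhdsWithin] with ε h1 h0
    have h0 : 0 < ε := h0
    have e : ε ^ (q + 1) = ε ^ 2 * ε ^ (q - 1) := by
      rw [← Real.rpow_natCast, ← Real.rpow_add h0]
      congr 1
      push_cast
      ring
    rw [Real.mul_rpow h0.le hM0, e]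
    have := mul_lt_mul_of_pos_left h1 (pow_pos h0 2)
    linarith
  constructor
  · intro hQ0
    filter_upwards [hbound, hlim Q hQ0] with ε h1 h2
    linarith [(abs_le.1 h1).1]
  · intro hQ0
    filter_upwards [hbound, hlim (-Q) (by linarith)] with ε h1 h2
    linarith [(abs_le.1 h1).2]

/-! ### The energy of the steady states -/

/-- The height of a steady state of period `X` and amplitude `r` relative to its orbit. -/
def height (q B X r : ℝ) : ℝ := scale q B X * per q r ^ (2 / (q - 1))

lemma height_pos {q B X r : ℝ} (hq : 1 < q) (hB : 0 < B) (hX : 0 < X) (hr : r ∈ ampRange q) :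
    0 < height q B X r :=
  mul_pos (scale_pos hB hX) (Real.rpow_pos_of_pos (per_pos hq hr) _)

/-- The height is tied to the frequency P/X so that B h^(q-1) scales as two derivatives do. The
equation, the second variation and the energy (up to the affine part of H) therefore rescale from
those of the orbit. -/
lemma height_rpow {q B X r : ℝ} (hq : 1 < q) (hB : 0 < B) (hX : 0 < X) (hr : r ∈ ampRange q) :
    B * height q B X r ^ (q - 1) = (per q r / X) ^ 2 := by
  have hP := per_pos hq hr
  have h1 : q - 1 ≠ 0 := by linarith
  rw [height, Real.mul_rpow (scale_pos hB hX).le (Real.rpow_pos_of_pos hP _).le,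
    scale_rpow hq hB hX, ← Real.rpow_mul hP.le, div_mul_cancel₀ _ h1, Real.rpow_two]
  field_simp

/-- The derivative of `state`. -/
def stateVel (q B X r x₀ x : ℝ) : ℝ :=
  height q B X r * (per q r / X) * vel q r (per q r / X * (x - x₀))

lemma hasDerivAt_phaseArg (b x₀ x : ℝ) : HasDerivAt (fun x => b * (x - x₀)) b x := by
  simpa using ((hasDerivAt_id x).sub_const x₀).const_mul b

lemma hasDerivAt_state {q B X r : ℝ} (hq : 1 < q) (hr : r ∈ ampRange q) (x₀ x : ℝ) :
    HasDerivAt (state q B X r x₀) (stateVel q B X r x₀ x) x := by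
  refine HasDerivAt.congr_deriv (((hasDerivAt_orbit hq hr _).comp x
    (hasDerivAt_phaseArg (per q r / X) x₀ x)).const_mul (height q B X r)) ?_
  rw [stateVel]
  ring

lemma hasDerivAt_stateVel {q B X r : ℝ} (hq : 1 < q) (hB : 0 < B) (hX : 0 < X)
    (hr : r ∈ ampRange q) (x₀ x : ℝ) :
    HasDerivAt (stateVel q B X r x₀) (height q B X r * (per q r / X) ^ 2 / q -
      B / q * state q B X r x₀ x ^ q) x := by
  refine HasDerivAt.congr_deriv (((hasDerivAt_vel hq hr _).comp x
    (hasDerivAt_phaseArg (per q r / X) x₀ x)).const_mul (height q B X r * (per q r / X))) ?_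
  have hc := height_pos hq hB hX hr
  have e : B * height q B X r ^ q = height q B X r * (per q r / X) ^ 2 := by
    rw [← height_rpow hq hB hX hr, Real.rpow_sub_one hc.ne']
    field_simp
  rw [state, ← height, Real.mul_rpow hc.le (orbit_pos hr hq _).le, force,
    show B / q * (height q B X r ^ q * orbit q r (per q r / X * (x - x₀)) ^ q) =
      B * height q B X r ^ q * orbit q r (per q r / X * (x - x₀)) ^ q / q by ring, e]
  ring

lemma periodic_comp_phaseArg {P X : ℝ} (hX : 0 < X) {g : ℝ → ℝ}
    (hg : Function.Periodic g P) (x₀ : ℝ) : Function.Periodic (fun x => g (P / X * (x - x₀))) X :=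
  fun x => by
    simp only
    rw [show P / X * (x + X - x₀) = P / X * (x - x₀) + P by field_simp; ring, hg]

lemma state_periodic {q B X r : ℝ} (hq : 1 < q) (hX : 0 < X) (hr : r ∈ ampRange q) (x₀ : ℝ) :
    Function.Periodic (state q B X r x₀) X := fun x => by
  have := periodic_comp_phaseArg hX (orbit_periodic hq hr) x₀ x
  simp only at this
  rw [state, this, state]

lemma stateVel_periodic {q B X r : ℝ} (hq : 1 < q) (hX : 0 < X) (hr : r ∈ ampRange q) (x₀ : ℝ) :
    Function.Periodic (stateVel q B X r x₀) X := fun x => by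
  have := periodic_comp_phaseArg hX (vel_periodic hq hr) x₀ x
  simp only at this
  rw [stateVel, this, stateVel]

lemma integral_orbit_rpow {q r : ℝ} (hq : 1 < q) (hr : r ∈ ampRange q) :
    ∫ x in (0 : ℝ)..per q r, orbit q r x ^ (q + 1) = q * act q r + are q r := by
  have ck := continuous_orbit hq hr
  have cf := continuous_force_orbit hq hr
  have i1 : IntervalIntegrable (fun x => q * (orbit q r x * force q (orbit q r x))) volume 0
      (per q r) := ((ck.mul cf).const_mul q).intervalIntegrable _ _
  rw [← integral_orbit_mul_force hq hr, are, ← intervalIntegral.integral_const_mul,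
    ← intervalIntegral.integral_add i1 (ck.intervalIntegrable _ _)]
  refine intervalIntegral.integral_congr fun x _ => ?_
  rw [Real.rpow_add_one (orbit_pos hr hq x).ne', force]
  field_simp
  ring

lemma scale_rpow_add_one {q B X : ℝ} (hq : 1 < q) (hB : 0 < B) (hX : 0 < X) :
    B * scale q B X ^ (q + 1) = scale q B X ^ 2 / X ^ 2 := by
  have hK := scale_pos (q := q) hB hX
  rw [show q + 1 = q - 1 + 2 by ring, Real.rpow_add hK, scale_rpow hq hB hX, Real.rpow_two]
  field_simp

lemma energy_const {q B X c₁ c₀ s : ℝ} {H : ℝ → ℝ} (hq : 1 < q) (hB : 0 < B) (hX : 0 < X)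
    (hH : ∀ y, 0 < y → H y = dens q B y + c₁ * y + c₀) (hs : 0 < s) :
    energy H X (fun _ => scale q B X * s) = scale q B X ^ 2 / X * -(s ^ (q + 1) / (q * (q + 1))) -
      c₁ * (scale q B X * X * s) - c₀ * X := by
  have hK := scale_pos (q := q) hB hX
  have h2 : q + 1 ≠ 0 := by linarith
  have h3 : q ≠ 0 := by linarith
  have e : dens q B (scale q B X * s) =
      scale q B X ^ 2 / X ^ 2 * s ^ (q + 1) / (q * (q + 1)) := by
    rw [dens, Real.mul_rpow hK.le hs.le, ← scale_rpow_add_one hq hB hX]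
    ring
  simp only [energy, deriv_const, hH _ (mul_pos hK hs), e]
  rw [intervalIntegral.integral_const, smul_eq_mul]
  field_simp
  ring

/-- The affine part of H enters only through mass and period, so states with both in common are
compared by `energyN` alone. -/
lemma energy_state {q B X r c₁ c₀ : ℝ} {H : ℝ → ℝ} (hq : 1 < q) (hB : 0 < B) (hX : 0 < X)
    (hH : ∀ y, 0 < y → H y = dens q B y + c₁ * y + c₀) (hr : r ∈ ampRange q) (x₀ : ℝ) :
    energy H X (state q B X r x₀) = scale q B X ^ 2 / X * energyN q r -
      c₁ * (scale q B X * X * massN q r) - c₀ * X := by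
  have hP := per_pos hq hr
  have hc := height_pos hq hB hX hr
  have ck := continuous_orbit hq hr
  have cv := continuous_vel hq hr
  have h2 : q + 1 ≠ 0 := by linarith
  have h3 : q ≠ 0 := by linarith
  have cs : Continuous (state q B X r x₀) :=
    continuous_iff_continuousAt.2 fun x => (hasDerivAt_state hq hr x₀ x).continuousAt
  have ckq : Continuous fun y => orbit q r y ^ (q + 1) :=
    ck.rpow_const fun _ => Or.inr (by linarith)
  set g : ℝ → ℝ := fun y => height q B X r ^ 2 * (per q r / X) ^ 2 / 2 * vel q r y ^ 2 -
    height q B X r ^ 2 * (per q r / X) ^ 2 / (q * (q + 1)) * orbit q r y ^ (q + 1) with hg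
  have cg : Continuous g := by fun_prop
  have gper : Function.Periodic g (per q r) := fun y => by
    simp only [hg, vel_periodic hq hr y, orbit_periodic hq hr y]
  have e1 : B * height q B X r ^ (q + 1) = height q B X r ^ 2 * (per q r / X) ^ 2 := by
    rw [show q + 1 = q - 1 + 2 by ring, Real.rpow_add hc, ← mul_assoc, height_rpow hq hB hX hr,
      Real.rpow_two]
    ring
  have i1 : IntervalIntegrable (fun x => g (per q r / X * (x - x₀))) volume 0 X :=
    Continuous.intervalIntegrable (by fun_prop) _ _
  have i2 : IntervalIntegrable (fun x => c₁ * state q B X r x₀ x) volume 0 X :=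
    Continuous.intervalIntegrable (by fun_prop) _ _
  have i3 : IntervalIntegrable (fun _ => c₀) volume 0 X := intervalIntegrable_const
  have hgI : ∫ y in (0 : ℝ)..per q r, g y = height q B X r ^ 2 * (per q r / X) ^ 2 / 2 * act q r -
      height q B X r ^ 2 * (per q r / X) ^ 2 / (q * (q + 1)) * (q * act q r + are q r) := by
    have i4 : IntervalIntegrable (fun y => height q B X r ^ 2 * (per q r / X) ^ 2 / 2 *
        vel q r y ^ 2) volume 0 (per q r) := Continuous.intervalIntegrable (by fun_prop) _ _
    rw [hg, intervalIntegral.integral_sub i4 ((ckq.const_mul _).intervalIntegrable _ _),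
      intervalIntegral.integral_const_mul, intervalIntegral.integral_const_mul,
      integral_vel_sq hq hr, integral_orbit_rpow hq hr]
  have e2 : energy H X (state q B X r x₀) = ∫ x in (0 : ℝ)..X, (g (per q r / X * (x - x₀)) -
      c₁ * state q B X r x₀ x - c₀) := by
    rw [energy]
    refine intervalIntegral.integral_congr fun x _ => ?_
    simp only [hH _ (state_pos hq hB hX hr x), (hasDerivAt_state hq hr x₀ x).deriv, hg]
    have e3 : dens q B (state q B X r x₀ x) = height q B X r ^ 2 * (per q r / X) ^ 2 /
        (q * (q + 1)) * orbit q r (per q r / X * (x - x₀)) ^ (q + 1) := by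
      rw [← e1, state, ← height, dens, Real.mul_rpow hc.le (orbit_pos hr hq _).le]
      ring
    rw [e3, stateVel]
    ring
  rw [e2, intervalIntegral.integral_sub (i1.sub i2) i3, intervalIntegral.integral_sub i1 i2,
    integral_comp_state hP hX gper, intervalIntegral.integral_const_mul, integral_state hq hX hr,
    intervalIntegral.integral_const, hgI, smul_eq_mul, energyN, height, Real.rpow_add_one hP.ne',
    two_mul (2 / (q - 1)), Real.rpow_add hP]
  generalize per q r ^ (2 / (q - 1)) = w
  field_simp
  ring

/-! ### Stability and instability -/

lemma quadForm_state {q B X r : ℝ} (hq : 1 < q) (hB : 0 < B) (hX : 0 < X) (hr : r ∈ ampRange q)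
    (x₀ : ℝ) {y : ℝ → ℝ} (hy : Function.Periodic y (per q r)) :
    quadForm (fun x => B * state q B X r x₀ x ^ (q - 1)) 0 X (fun x => y (per q r / X * (x - x₀))) =
      per q r / X * quadForm (wgt q r) 0 (per q r) y := by
  have hP := per_pos hq hr
  have hc := height_pos hq hB hX hr
  have hd : ∀ x, deriv (fun x => y (per q r / X * (x - x₀))) x =
      per q r / X * deriv y (per q r / X * (x - x₀)) := fun x => by
    rw [deriv_comp_sub_const (f := fun x => y (per q r / X * x)),
      deriv_comp_mul_left, smul_eq_mul]
  have hg : Function.Periodic (fun z => (per q r / X) ^ 2 *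
      (deriv y z ^ 2 - wgt q r z * y z ^ 2)) (per q r) := fun z => by
    simp only [wgt, hy z, deriv_periodic hy z, orbit_periodic hq hr z]
  have e : quadForm (fun x => B * state q B X r x₀ x ^ (q - 1)) 0 X
      (fun x => y (per q r / X * (x - x₀))) = ∫ x in (0 : ℝ)..X, (fun z => (per q r / X) ^ 2 *
      (deriv y z ^ 2 - wgt q r z * y z ^ 2)) (per q r / X * (x - x₀)) := by
    rw [quadForm]
    refine intervalIntegral.integral_congr fun x _ => ?_
    simp only [hd, wgt]
    rw [state, ← height, Real.mul_rpow hc.le (orbit_pos hr hq _).le, ← mul_assoc,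
      height_rpow hq hB hX hr]
    ring
  rw [e, integral_comp_state hP hX hg, intervalIntegral.integral_const_mul, quadForm]
  field_simp

/-- The remainder term is negative in the direction of translations. -/
lemma integral_densRem_vel_neg {q B r a c : ℝ} (hq : 1 < q) (hq2 : q < 2) (hB : 0 < B)
    (hr : r ∈ ampRange q) (hr0 : 0 < r) (hc : c ≠ 0)
    (hlt : ∀ x, |c * vel q r x| < a * orbit q r x) :
    ∫ x in (0 : ℝ)..per q r, densRem q B (a * orbit q r x) (c * vel q r x) < 0 := by
  have hP := per_pos hq hr
  have ck := continuous_orbit hq hr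
  have cv := continuous_vel hq hr
  set g := fun x => densRem q B (a * orbit q r x) (c * vel q r x) with hg
  have cg : Continuous g := continuous_densRem_comp hq (by fun_prop) (by fun_prop)
  have gper : Function.Periodic g (per q r) := fun x => by
    simp only [hg, vel_periodic hq hr x, orbit_periodic hq hr x]
  -- k is even and k' is odd, so averaging over x and -x produces the symmetrised remainder.
  have hsym : ∫ x in (0 : ℝ)..per q r, g (-x) = ∫ x in (0 : ℝ)..per q r, g x := by
    rw [intervalIntegral.integral_comp_neg, neg_zero]
    have := gper.intervalIntegral_add_eq (-per q r) 0
    rwa [neg_add_cancel, zero_add] at this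
  have hg0 : ∀ x, c * vel q r x ≠ 0 → g x + g (-x) < 0 := fun x hx => by
    simp only [hg, vel_neg hq hr, orbit_neg hq hr, mul_neg]
    rcases lt_or_gt_of_ne hx with h | h
    · have := densRem_add_neg_lt hq hq2 hB (neg_pos.2 h)
        (by have := hlt x; rwa [abs_of_neg h] at this)
      rw [neg_neg] at this
      linarith
    · exact densRem_add_neg_lt hq hq2 hB h (by have := hlt x; rwa [abs_of_pos h] at this)
  have hpos : 0 < ∫ x in (0 : ℝ)..per q r, -(g x + g (-x)) := by
    refine intervalIntegral.integral_pos hP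
      (Continuous.continuousOn (by fun_prop)) (fun x _ => ?_)
          ⟨per q r / 4, ⟨by linarith, by linarith⟩, ?_⟩
    · by_cases hx : c * vel q r x = 0
      · simp [hg, vel_neg hq hr, orbit_neg hq hr, hx, densRem]
      · linarith [hg0 x hx]
    · linarith [hg0 (per q r / 4) (mul_ne_zero hc
        (vel_pos hq hr hr0 (by linarith) (by linarith)).ne')]
  have i1 : IntervalIntegrable (fun x => g (-x)) volume 0 (per q r) :=
    Continuous.intervalIntegrable (by fun_prop) _ _
  rw [intervalIntegral.integral_neg,
    intervalIntegral.integral_add (cg.intervalIntegrable _ _) i1, hsym] at hpos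
  linarith

/-- The second variation is positive except on multiples of the derivative of the state. There it
vanishes, and the energy increment is exactly minus the integrated Taylor remainder, which is
positive by `integral_densRem_vel_neg`. -/
theorem isEnergyStable_state {q B X r c₁ c₀ : ℝ} {H : ℝ → ℝ} (hq : 1 < q) (hq2 : q < 2)
    (hB : 0 < B) (hX : 0 < X) (hH : ∀ y, 0 < y → H y = dens q B y + c₁ * y + c₀)
    (hr : r ∈ ampRange q) (hr0 : 0 < r) (hb : 0 < dbifAmp q r) (x₀ : ℝ) :
    IsEnergyStable H X (state q B X r x₀) := by
  intro u hu hu0 hm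
  have hP := per_pos hq hr
  have huL := hu.isH1Loc hX
  set y : ℝ → ℝ := fun z => u (x₀ + X / per q r * z) with hy
  have hyL : IsH1Loc y := huL.comp_affine (by positivity) x₀
  have huy : u = fun x => y (per q r / X * (x - x₀)) := by
    funext x
    simp only [hy]
    congr 1
    field_simp
    ring
  have hyp : Function.Periodic y (per q r) := fun z => by
    simp only [hy]
    rw [show x₀ + X / per q r * (z + per q r) = x₀ + X / per q r * z + X by field_simp; ring,
      hu.periodic]
  have hym : ∫ z in (0 : ℝ)..per q r, y z = 0 := by
    rw [huy, integral_comp_state hP hX hyp] at hm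
    exact (mul_eq_zero.1 hm).resolve_left (by positivity)
  obtain ⟨s1, s2⟩ := stable_form hq hr hr0 hb hyL hyp hym
  have hQ := quadForm_state hq hB hX hr x₀ hyp
  rw [← huy] at hQ
  rcases s1.eq_or_lt with h0 | hpos
  · obtain ⟨c, hc⟩ := s2 h0.symm
    have hc0 : c ≠ 0 := by
      rintro rfl
      apply hu0
      funext x
      rw [huy]
      simp [hc]
    have ha := height_pos hq hB hX hr
    obtain ⟨k₀, _, hk₀, hk⟩ := exists_bounds_of_periodic hP (orbit_periodic hq hr)
      (continuous_orbit hq hr) (orbit_pos hr hq)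
    obtain ⟨_, M, _, hM⟩ := exists_bounds_of_periodic (k := fun x => |c * vel q r x| + 1) hP
      (fun x => by simp only [vel_periodic hq hr x])
      (((continuous_vel hq hr).const_mul c).abs.add continuous_const) (fun x => by positivity)
    have hsmall : ∀ᶠ ε in 𝓝[>] (0 : ℝ), ε * M < height q B X r * k₀ := by
      have : Tendsto (fun ε : ℝ => ε * M) (𝓝[>] 0) (𝓝 (0 * M)) :=
        ((continuous_id.mul continuous_const).tendsto 0).mono_left nhdsWithin_le_nhds
      rw [zero_mul] at this
      exact this.eventually (gt_mem_nhds (by positivity))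
    filter_upwards [hsmall, self_mem_nhdsWithin] with ε h1 h2
    have h2 : 0 < ε := h2
    have hlt : ∀ x, |ε * c * vel q r x| < height q B X r * orbit q r x := fun x => by
      rw [mul_assoc, abs_mul, abs_of_pos h2]
      have := mul_le_mul_of_nonneg_left (hM x).2 h2.le
      have := mul_le_mul_of_nonneg_left (hk x).1 ha.le
      linarith
    have hε : ∀ x, 0 < state q B X r x₀ x + ε * u x := fun x => by
      have := (abs_lt.1 (hlt (per q r / X * (x - x₀)))).1
      rw [huy]
      simp only [hc]
      rw [state, ← height]
      linarith
    have key := energy_expansion hq hH (hasDerivAt_state hq hr x₀)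
      (hasDerivAt_stateVel hq hB hX hr x₀) (state_pos hq hB hX hr) (stateVel_periodic hq hX hr x₀)
      huL hu.periodic hm hε
    have e : ∀ x, densRem q B (state q B X r x₀ x) (ε * u x) = (fun z => densRem q B
        (height q B X r * orbit q r z) (ε * c * vel q r z)) (per q r / X * (x - x₀)) := fun x => by
      rw [huy]
      simp only [hc, state, height, mul_assoc]
    have hI := integral_comp_state (x₀ := x₀) hP hX (g := fun z => densRem q B
      (height q B X r * orbit q r z) (ε * c * vel q r z)) fun z => by
        simp only [vel_periodic hq hr z, orbit_periodic hq hr z]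
    rw [hQ, ← h0, mul_zero, mul_zero, zero_sub, funext e, hI] at key
    have := mul_neg_of_pos_of_neg (div_pos hX hP)
      (integral_densRem_vel_neg hq hq2 hB hr hr0 (mul_ne_zero h2.ne' hc0) hlt)
    linarith
  · refine (energy_sub_sign hq hq2 hB hX hH (hasDerivAt_state hq hr x₀)
      (hasDerivAt_stateVel hq hB hX hr x₀) (state_pos hq hB hX hr) (state_periodic hq hX hr x₀)
      (stateVel_periodic hq hX hr x₀) huL hu.periodic hm).1 ?_
    rw [hQ]
    positivity

theorem isEnergyUnstable_state {q B X r c₁ c₀ : ℝ} {H : ℝ → ℝ} (hq : 1 < q) (hq2 : q < 2)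
    (hB : 0 < B) (hX : 0 < X) (hH : ∀ y, 0 < y → H y = dens q B y + c₁ * y + c₀)
    (hr : r ∈ ampRange q) (hr0 : 0 < r) (hb : dbifAmp q r < 0) (x₀ : ℝ) :
    IsEnergyUnstable H X (state q B X r x₀) := by
  have hP := per_pos hq hr
  obtain ⟨y, hys, hyp, hym, hyQ⟩ := unstable_form hq hr hr0 hb
  have hus : ContDiff ℝ ∞ fun x => y (per q r / X * (x - x₀)) :=
    hys.comp (contDiff_const.mul (contDiff_id.sub contDiff_const))
  have hup := periodic_comp_phaseArg hX hyp x₀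
  have hum : ∫ x in (0 : ℝ)..X, y (per q r / X * (x - x₀)) = 0 := by
    rw [integral_comp_state hP hX hyp, hym, mul_zero]
  refine ⟨_, hus, hup, hum, ?_⟩
  refine (energy_sub_sign hq hq2 hB hX hH (hasDerivAt_state hq hr x₀)
    (hasDerivAt_stateVel hq hB hX hr x₀) (state_pos hq hB hX hr) (state_periodic hq hX hr x₀)
    (stateVel_periodic hq hX hr x₀) (IsH1Loc.of_contDiff (contDiff_infty.1 hus 1)) hup hum).2 ?_
  rw [quadForm_state hq hB hX hr x₀ hyp]
  exact mul_neg_of_pos_of_neg (by positivity) hyQ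

end

end ThinFilm

/-! ### The main theorem -/

theorem mainTheorem5
    (m n q B : ℝ) (hB : 0 < B) (hq : q = m - n + 1) (hq1 : 1 < q) (hq2 : q < 2)
    (αcrit : ℝ) (hαcrit : αcrit ∈ Set.Ioo (0 : ℝ) 1)
    (hEdec : ∀ α ∈ Set.Ioo (0 : ℝ) αcrit, deriv (ThinFilm.bifurcationE q) α < 0)
    (hEinc : ∀ α ∈ Set.Ioo αcrit (1 : ℝ), 0 < deriv (ThinFilm.bifurcationE q) α)
    (hP : StrictMonoOn (fun α : ℝ => α * (ThinFilm.period q α) ^ (2 / (q - 1)))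
      (Set.Ioo (0 : ℝ) 1))
    (H : ℝ → ℝ)
    (hH : ThinFilm.IsEnergyDensity (fun y => y ^ n) (fun y => B * y ^ m) H)
    (h₁ h₂ : ℝ → ℝ) (X : ℝ)
    (hss₁ : ThinFilm.IsPositiveSteadyState (fun y => y ^ n) (fun y => B * y ^ m) h₁)
    (hss₂ : ThinFilm.IsPositiveSteadyState (fun y => y ^ n) (fun y => B * y ^ m) h₂)
    (hX₁ : ThinFilm.IsLeastPeriod h₁ X) (hX₂ : ThinFilm.IsLeastPeriod h₂ X)
    (harea : (∫ x in (0 : ℝ)..X, h₁ x) = ∫ x in (0 : ℝ)..X, h₂ x)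
    (hmin : (⨅ x, h₁ x) < ⨅ x, h₂ x) :
    ThinFilm.IsEnergyStable H X h₁ ∧
    ThinFilm.IsEnergyUnstable H X h₂ ∧
    ThinFilm.energy H X h₁ < ThinFilm.energy H X h₂ ∧
    ThinFilm.energy H X (fun _ => ThinFilm.mean X h₂) < ThinFilm.energy H X h₂ := by
  have hX : 0 < X := hX₁.1.1
  have hinf : ∀ {h : ℝ → ℝ} {x₀ : ℝ}, (∀ x, h x₀ ≤ h x) → ⨅ x, h x = h x₀ := fun {h x₀} hh =>
    le_antisymm (ciInf_le ⟨h x₀, by rintro _ ⟨x, rfl⟩; exact hh x⟩ x₀) (le_ciInf hh)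
  -- As the period is common, so is the scale; the two states differ only in amplitude and
  -- translation.
  obtain ⟨r₁, hr₁, h01, x₁, rfl, hm₁⟩ := hss₁.eq_state hB hq hq1 hX₁
  obtain ⟨r₂, hr₂, h02, x₂, rfl, hm₂⟩ := hss₂.eq_state hB hq hq1 hX₂
  rw [hinf hm₁, hinf hm₂] at hmin
  obtain ⟨hlt, hmass, hb₁, hb₂, hdip⟩ := ThinFilm.amplitudes hq1 hB hX hαcrit hEdec hEinc hP
    hr₁ h01 hr₂ h02 harea hmin
  obtain ⟨c₁, c₀, hHc⟩ := hH.eq_dens hq hq1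
  have hK := ThinFilm.scale_pos (q := q) hB hX
  refine ⟨ThinFilm.isEnergyStable_state hq1 hq2 hB hX hHc hr₁ h01 hb₁ x₁,
    ThinFilm.isEnergyUnstable_state hq1 hq2 hB hX hHc hr₂ h02 (hb₂ r₂ ⟨h02, le_rfl⟩) x₂, ?_, ?_⟩
  · rw [ThinFilm.energy_state hq1 hB hX hHc hr₁, ThinFilm.energy_state hq1 hB hX hHc hr₂, hmass]
    have := mul_lt_mul_of_pos_left (ThinFilm.energyN_lt hq1 hr₁ hr₂ h02 hlt hmass hdip)
      (div_pos (pow_pos hK 2) hX)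
    linarith
  · have hmean : ThinFilm.mean X (ThinFilm.state q B X r₂ x₂) =
        ThinFilm.scale q B X * ThinFilm.massN q r₂ := by
      rw [ThinFilm.mean, ThinFilm.integral_state hq1 hX hr₂]
      field_simp
    rw [hmean, ThinFilm.energy_const hq1 hB hX hHc (ThinFilm.massN_pos hq1 hr₂),
      ThinFilm.energy_state hq1 hB hX hHc hr₂]
    have := mul_lt_mul_of_pos_left (ThinFilm.energyN_gt_const hq1 hr₂ h02
      fun s hs => hb₂ s ⟨hs.1, hs.2.le⟩) (div_pos (pow_pos hK 2) hX)
    linarith
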